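/- Let $K$ be an infinite field and let $S=K[x_1,\dots,x_n,y_1,\dots,y_m]$ be bigraded by $\deg x_i=(1,0)$ and $\deg y_j=(0,1)$. Let $J\subsetneq S$ be a proper bigraded ideal and $R=S/J$. Put $\beta_{i,(a,b)}(R)=\dim_K\operatorname{Tor}_i^S(R,K)_{(a,b)}$ and $$\operatorname{reg}_x(R)=\sup\{a\in\mathbb Z : \beta_{i,(a+i,b)}(R)\neq 0\text{ for some } i,b\},\qquad \operatorname{reg}_y(R)=\sup\{b\in\mathbb Z : \beta_{i,(a,b+i)}(R)\neq 0\text{ for some } i,a\}.$$ Let $n_x$ and $n_y$ be the ideals of $R$ generated by $R_{(1,0)}$ and by $R_{(0,1)}$, respectively. A sequence $f_1,\dots,f_r$ in a commutative ring is called a $d$-sequence if it is a minimal system of generators of the ideal $I=(f_1,\dots,f_r)$ and $\bigl((f_1,\dots,f_{i-1}):f_i\bigr)\cap I=(f_1,\dots,f_{i-1})$ for $i=1,\dots,r$. We say that a generic minimal system of generators of $n_x$ consisting of $(1,0)$-forms has a property if there is a Zariski open subset $U$ of the affine space $(R_{(1,0)})^r$, $r=\dim_K R_{(1,0)}$, that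 contains at least one minimal system of generators of $n_x$, such that every minimal system of generators of $n_x$ that lies in $U$ has the property; similarly for $n_y$ and $(0,1)$-forms. Then: (i) $\operatorname{reg}_x(R)=0$ if and only if a generic minimal system of generators of $n_x$ consisting of $(1,0)$-forms is a $d$-sequence. (ii) $\operatorname{reg}_y(R)=0$ if and only if a generic minimal system of generators of $n_y$ consisting of $(0,1)$-forms is a $d$-sequence. -/

import Mathlib

open scoped TensorProduct

noncomputable section

universe u

namespace Bigraded

/-- The polynomial ring `S = K[x_1, …, x_n, y_1, …, y_m]`; `X (Sum.inl i)` is the variable `x_i`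
and `X (Sum.inr j)` is the variable `y_j`. -/
abbrev Poly (K : Type u) [Field K] (n m : ℕ) : Type u := MvPolynomial (Fin n ⊕ Fin m) K

/-- The bidegrees of the variables: `deg x_i = (1, 0)` and `deg y_j = (0, 1)`. -/
def varDeg (n m : ℕ) : Fin n ⊕ Fin m → ℤ × ℤ :=
  Sum.elim (fun _ => (1, 0)) (fun _ => (0, 1))

/-- The standard bigrading of `S`: the component `S_d`, for `d ∈ ℤ²`. -/
def polyPiece (K : Type u) [Field K] (n m : ℕ) (d : ℤ × ℤ) : Submodule K (Poly K n m) :=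
  MvPolynomial.weightedHomogeneousSubmodule K (varDeg n m) d

instance polyGraded (K : Type u) [Field K] (n m : ℕ) : GradedAlgebra (polyPiece K n m) :=
  MvPolynomial.weightedGradedAlgebra K (varDeg n m)

section

variable {K : Type u} [Field K] {n m : ℕ}

/-- The component `R_d` of the bigraded algebra `R = S / J`. -/
def quotPiece (J : Ideal (Poly K n m)) (d : ℤ × ℤ) : Submodule K (Poly K n m ⧸ J) :=
  (polyPiece K n m d).map (Ideal.Quotient.mkₐ K J).toLinearMap

/-- The ideal of `R = S / J` generated by the forms of bidegree `e`: for `e = (1, 0)` this is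
`n_x`, for `e = (0, 1)` it is `n_y`. -/
def formIdeal (J : Ideal (Poly K n m)) (e : ℤ × ℤ) : Ideal (Poly K n m ⧸ J) :=
  Ideal.span (quotPiece J e : Set (Poly K n m ⧸ J))

/-- The component in bidegree `d` of the bigraded free module `⨁_j S(-deg j)`, in which the `j`-th
basis vector has bidegree `deg j`. -/
def freePiece {ι : Type u} (deg : ι → ℤ × ℤ) (d : ℤ × ℤ) : Submodule K (ι →₀ Poly K n m) where
  carrier := {c | ∀ j, c j ∈ polyPiece K n m (d - deg j)}
  add_mem' ha hb j := by simpa using add_mem (ha j) (hb j)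
  zero_mem' j := by simp
  smul_mem' k c hc j := by simpa using Submodule.smul_mem _ k (hc j)

/-- A bigraded free resolution `⋯ → F_2 → F_1 → F_0 → S / I → 0` over `S`: the module `F_i` is
free with a basis indexed by `ι i`, whose elements have the bidegrees `deg i`, and all maps are
homogeneous of bidegree `(0, 0)`. -/
structure FreeResolution (I : Ideal (Poly K n m)) where
  /-- the index set of the basis of `F_i` -/
  ι : ℕ → Type u
  /-- the bidegrees of the basis elements of `F_i` -/
  deg : ∀ i, ι i → ℤ × ℤ
  /-- the differential `F_{i+1} → F_i` -/
  d : ∀ i, (ι (i + 1) →₀ Poly K n m) →ₗ[Poly K n m] (ι i →₀ Poly K n m)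
  /-- the augmentation `F_0 → S / I` -/
  aug : (ι 0 →₀ Poly K n m) →ₗ[Poly K n m] (Poly K n m ⧸ I)
  d_homogeneous : ∀ i j, d i (Finsupp.single j 1) ∈ freePiece (K := K) (deg i) (deg (i + 1) j)
  aug_homogeneous : ∀ j, aug (Finsupp.single j 1) ∈ quotPiece I (deg 0 j)
  aug_surjective : Function.Surjective aug
  exact_zero : Function.Exact (d 0) aug
  exact_succ : ∀ i, Function.Exact (d (i + 1)) (d i)

/-! ### Existence of bigraded free resolutions -/

/-- The projection of a bigraded free module to its component of bidegree `d`. -/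
def freeComp {ι : Type u} (deg : ι → ℤ × ℤ) (d : ℤ × ℤ) :
    (ι →₀ Poly K n m) →ₗ[K] (ι →₀ Poly K n m) :=
  Finsupp.lsum K fun j =>
    Finsupp.lsingle j ∘ₗ MvPolynomial.weightedHomogeneousComponent (varDeg n m) (d - deg j)

theorem freeComp_single {ι : Type u} (deg : ι → ℤ × ℤ) (d : ℤ × ℤ) (j : ι) (p : Poly K n m) :
    freeComp deg d (Finsupp.single j p) = Finsupp.single j
      (MvPolynomial.weightedHomogeneousComponent (varDeg n m) (d - deg j) p) := by
  simp [freeComp]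

theorem freeComp_apply {ι : Type u} (deg : ι → ℤ × ℤ) (d : ℤ × ℤ) (x : ι →₀ Poly K n m) (j : ι) :
    freeComp deg d x j =
      MvPolynomial.weightedHomogeneousComponent (varDeg n m) (d - deg j) (x j) := by
  classical
  induction x using Finsupp.induction_linear with
  | zero => simp
  | add f g hf hg => simp [hf, hg]
  | single k p =>
    rw [freeComp_single]
    by_cases h : k = j
    · subst h; simp
    · simp [Finsupp.single_eq_of_ne' h]

theorem freeComp_mem {ι : Type u} (deg : ι → ℤ × ℤ) (d : ℤ × ℤ) (x : ι →₀ Poly K n m) :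
    freeComp deg d x ∈ freePiece (K := K) deg d := by
  intro j
  rw [freeComp_apply]
  exact MvPolynomial.weightedHomogeneousComponent_mem _ _ _

theorem freeComp_of_mem {ι : Type u} (deg : ι → ℤ × ℤ) (d e : ℤ × ℤ) (x : ι →₀ Poly K n m)
    (hx : x ∈ freePiece (K := K) deg e) : freeComp deg d x = if d = e then x else 0 := by
  ext1 j
  rw [freeComp_apply, MvPolynomial.weightedHomogeneousComponent_of_mem (hx j)]
  by_cases h : d = e
  · simp [h]
  · simp [h]

theorem single_monomial_mem {ι : Type u} (deg : ι → ℤ × ℤ) (j : ι) (s : Fin n ⊕ Fin m →₀ ℕ)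
    (c : K) : Finsupp.single j (MvPolynomial.monomial s c) ∈
      freePiece (K := K) (n := n) (m := m) deg (Finsupp.weight (varDeg n m) s + deg j) := by
  classical
  intro k
  by_cases h : j = k
  · subst h
    simpa [polyPiece] using MvPolynomial.isWeightedHomogeneous_monomial (varDeg n m) s c rfl
  · simp [Finsupp.single_eq_of_ne' h]

theorem free_induction {ι : Type u} {P : (ι →₀ Poly K n m) → Prop} (h0 : P 0)
    (hadd : ∀ x y, P x → P y → P (x + y))
    (hs : ∀ j s c, P (Finsupp.single j (MvPolynomial.monomial s c))) (x) : P x := by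
  induction x using Finsupp.induction_linear with
  | zero => exact h0
  | add f g hf hg => exact hadd f g hf hg
  | single k p =>
    induction p using MvPolynomial.induction_on' with
    | monomial s c => exact hs k s c
    | add p q hp hq =>
      rw [Finsupp.single_add]
      exact hadd _ _ hp hq

theorem sum_freeComp {ι : Type u} (deg : ι → ℤ × ℤ) (x : ι →₀ Poly K n m) :
    ∃ D : Finset (ℤ × ℤ), ∀ D', D ⊆ D' → ∑ d ∈ D', freeComp deg d x = x := by
  classical
  refine free_induction (P := fun x => ∃ D : Finset (ℤ × ℤ), ∀ D', D ⊆ D' →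
    ∑ d ∈ D', freeComp deg d x = x) ⟨∅, by simp⟩ ?_ ?_ x
  · rintro x y ⟨D, hD⟩ ⟨E, hE⟩
    refine ⟨D ∪ E, fun D' h => ?_⟩
    simp only [map_add, Finset.sum_add_distrib]
    rw [hD D' (Finset.union_subset_left h), hE D' (Finset.union_subset_right h)]
  · intro j s c
    refine ⟨{Finsupp.weight (varDeg n m) s + deg j}, fun D' h => ?_⟩
    simp_rw [freeComp_of_mem deg _ _ _ (single_monomial_mem deg j s c)]
    rw [Finset.sum_ite_eq', if_pos (h (Finset.mem_singleton_self _))]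

theorem smul_freePiece {ι : Type u} (deg : ι → ℤ × ℤ) {a b : ℤ × ℤ} {p : Poly K n m}
    {x : ι →₀ Poly K n m} (hp : p ∈ polyPiece K n m a) (hx : x ∈ freePiece (K := K) deg b) :
    p • x ∈ freePiece (K := K) deg (a + b) := by
  intro j
  have := SetLike.mul_mem_graded hp (hx j)
  rwa [← add_sub_assoc] at this

theorem map_freeComp {ι ι' : Type u} (deg : ι → ℤ × ℤ) (deg' : ι' → ℤ × ℤ)
    (φ : (ι →₀ Poly K n m) →ₗ[Poly K n m] (ι' →₀ Poly K n m))
    (hφ : ∀ j, φ (Finsupp.single j 1) ∈ freePiece (K := K) deg' (deg j)) (d : ℤ × ℤ) (x) :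
    φ (freeComp deg d x) = freeComp deg' d (φ x) := by
  refine free_induction (P := fun x => φ (freeComp deg d x) = freeComp deg' d (φ x))
    (by simp) (fun x y hx hy => by simp [hx, hy]) ?_ x
  intro j s c
  have h2 : φ (Finsupp.single j (MvPolynomial.monomial s c)) ∈
      freePiece (K := K) deg' (Finsupp.weight (varDeg n m) s + deg j) := by
    have : (Finsupp.single j (MvPolynomial.monomial s c) : ι →₀ Poly K n m)
        = (MvPolynomial.monomial s c : Poly K n m) • Finsupp.single j 1 := by simp
    rw [this, map_smul]
    exact smul_freePiece deg' (MvPolynomial.isWeightedHomogeneous_monomial (varDeg n m) s c rfl)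
      (hφ j)
  rw [freeComp_of_mem deg _ _ _ (single_monomial_mem deg j s c), freeComp_of_mem deg' _ _ _ h2]
  split_ifs <;> simp

/-- A bigraded free module together with a bigraded submodule. -/
structure Stage (K : Type u) [Field K] (n m : ℕ) where
  /-- the index set of the basis -/
  ι : Type u
  /-- the bidegrees of the basis elements -/
  deg : ι → ℤ × ℤ
  /-- the submodule -/
  Z : Submodule (Poly K n m) (ι →₀ Poly K n m)
  homogeneous : ∀ z ∈ Z, ∀ d, freeComp deg d z ∈ Z

/-- The map onto `Z` from the free module on the homogeneous elements of `Z`. -/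
def Stage.map (s : Stage K n m) :
    ({p : (s.ι →₀ Poly K n m) × (ℤ × ℤ) // p.1 ∈ s.Z ∧ p.1 ∈ freePiece (K := K) s.deg p.2} →₀
      Poly K n m) →ₗ[Poly K n m] (s.ι →₀ Poly K n m) :=
  Finsupp.linearCombination (Poly K n m) fun p => p.1.1

theorem Stage.map_single (s : Stage K n m) (p) : s.map (Finsupp.single p 1) = p.1.1 := by
  simp [Stage.map]

/-- The free module on the homogeneous elements of `Z`, with the kernel of its map onto `Z`. -/
def Stage.next (s : Stage K n m) : Stage K n m where
  ι := {p : (s.ι →₀ Poly K n m) × (ℤ × ℤ) // p.1 ∈ s.Z ∧ p.1 ∈ freePiece (K := K) s.deg p.2}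
  deg p := p.1.2
  Z := LinearMap.ker s.map
  homogeneous z hz d := by
    rw [LinearMap.mem_ker] at hz ⊢
    rw [map_freeComp _ s.deg, hz, map_zero]
    intro p
    rw [Stage.map_single]
    exact p.2.2

theorem Stage.range_map (s : Stage K n m) : LinearMap.range s.map = s.Z := by
  apply le_antisymm
  · rw [Stage.map, Finsupp.range_linearCombination, Submodule.span_le]
    rintro _ ⟨p, rfl⟩
    exact p.2.1
  · intro z hz
    obtain ⟨D, hD⟩ := sum_freeComp s.deg z
    rw [← hD D subset_rfl]
    refine Submodule.sum_mem _ fun d _ => ?_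
    exact ⟨Finsupp.single ⟨(freeComp s.deg d z, d), s.homogeneous z hz d, freeComp_mem _ _ _⟩ 1,
      s.map_single _⟩

theorem Stage.exact_map (s : Stage K n m) {N : Type u} [AddCommGroup N] [Module (Poly K n m) N]
    {φ : (s.ι →₀ Poly K n m) →ₗ[Poly K n m] N} (h : LinearMap.ker φ = s.Z) :
    Function.Exact s.map φ :=
  LinearMap.exact_iff.2 (h.trans s.range_map.symm)

/-- The canonical surjection `S → S / I`, on the free module with one basis element. -/
def cyclicAug (I : Ideal (Poly K n m)) :
    (PUnit.{u + 1} →₀ Poly K n m) →ₗ[Poly K n m] (Poly K n m ⧸ I) :=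
  I.mkQ ∘ₗ Finsupp.lapply PUnit.unit

theorem cyclicAug_single (I : Ideal (Poly K n m)) (p : Poly K n m) :
    cyclicAug I (Finsupp.single PUnit.unit p) = Ideal.Quotient.mk I p := by
  rw [cyclicAug, LinearMap.comp_apply, Finsupp.lapply_apply, Finsupp.single_eq_same]
  rfl

theorem polyComp_mem {I : Ideal (Poly K n m)} (hI : I.IsHomogeneous (polyPiece K n m))
    {p : Poly K n m} (hp : p ∈ I) (d : ℤ × ℤ) :
    MvPolynomial.weightedHomogeneousComponent (varDeg n m) d p ∈ I :=
  MvPolynomial.weightedHomogeneousComponent_mem_of_mem K (varDeg n m) hI hp d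

/-- The first step in the construction of a bigraded free resolution of `S / I`. -/
def Stage.start {I : Ideal (Poly K n m)} (hI : I.IsHomogeneous (polyPiece K n m)) :
    Stage K n m where
  ι := PUnit
  deg _ := 0
  Z := LinearMap.ker (cyclicAug I)
  homogeneous z hz d := by
    simp only [cyclicAug, LinearMap.mem_ker, LinearMap.comp_apply, Finsupp.lapply_apply,
      Submodule.mkQ_apply, Submodule.Quotient.mk_eq_zero] at hz ⊢
    rw [freeComp_apply]
    exact polyComp_mem hI hz _

/-- Every quotient of `S` by a bigraded ideal has a bigraded free resolution. -/
theorem nonempty_freeResolution {I : Ideal (Poly K n m)}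
    (hI : I.IsHomogeneous (polyPiece K n m)) : Nonempty (FreeResolution I) := by
  let st : ℕ → Stage K n m := fun i => Nat.rec (Stage.start hI) (fun _ s => s.next) i
  refine ⟨{ ι := fun i => (st i).ι, deg := fun i => (st i).deg, d := fun i => (st i).map,
            aug := cyclicAug I, d_homogeneous := ?_, aug_homogeneous := ?_,
            aug_surjective := ?_, exact_zero := ?_, exact_succ := ?_ }⟩
  · intro i j
    have h := (st i).map_single j
    exact Set.mem_of_eq_of_mem h j.2.2
  · intro j
    refine ⟨1, MvPolynomial.isWeightedHomogeneous_one K (varDeg n m), ?_⟩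
    exact (cyclicAug_single I 1).symm
  · intro r
    obtain ⟨p, rfl⟩ := Ideal.Quotient.mk_surjective r
    exact ⟨Finsupp.single PUnit.unit p, cyclicAug_single I p⟩
  · exact (st 0).exact_map rfl
  · intro i
    exact (st (i + 1)).exact_map rfl

/-! ### Bigraded Betti numbers and regularity -/

variable (K n m) in
/-- The bigraded maximal ideal `𝔪 = (x_1, …, x_n, y_1, …, y_m)` of `S`, so that `K = S / 𝔪`. -/
def maxIdeal : Ideal (Poly K n m) := Ideal.span (Set.range MvPolynomial.X)

variable (K n m) in
theorem maxIdeal_homogeneous : (maxIdeal K n m).IsHomogeneous (polyPiece K n m) := by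
  refine Ideal.homogeneous_span _ _ ?_
  rintro _ ⟨i, rfl⟩
  exact ⟨varDeg n m i, MvPolynomial.isWeightedHomogeneous_X K (varDeg n m) i⟩

variable (K n m) in
/-- A bigraded free resolution of the residue class field `K = S / 𝔪` over `S`. -/
def residueResolution : FreeResolution (maxIdeal K n m) :=
  Classical.choice (nonempty_freeResolution (maxIdeal_homogeneous K n m))

/-- The component of bidegree `d` of `S / J ⊗ F_i`, spanned by the `r ⊗ c` with `r` and `c`
homogeneous and `deg r + deg c = d`. -/
def tensorPiece {I : Ideal (Poly K n m)} (F : FreeResolution I) (J : Ideal (Poly K n m))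
    (i : ℕ) (d : ℤ × ℤ) :
    Submodule K ((Poly K n m ⧸ J) ⊗[Poly K n m] (F.ι i →₀ Poly K n m)) :=
  Submodule.span K {t | ∃ (a b : ℤ × ℤ) (r : Poly K n m ⧸ J) (c : F.ι i →₀ Poly K n m),
    a + b = d ∧ r ∈ quotPiece J a ∧ c ∈ freePiece (K := K) (F.deg i) b ∧ t = r ⊗ₜ c}

/-- The `i`-cycles of the complex `S / J ⊗ F`. -/
def cycles {I : Ideal (Poly K n m)} (F : FreeResolution I) (J : Ideal (Poly K n m)) : ∀ i : ℕ,
    Submodule (Poly K n m) ((Poly K n m ⧸ J) ⊗[Poly K n m] (F.ι i →₀ Poly K n m))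
  | 0 => ⊤
  | i + 1 => LinearMap.ker ((F.d i).lTensor (Poly K n m ⧸ J))

/-- The `i`-boundaries of the complex `S / J ⊗ F`. -/
def boundaries {I : Ideal (Poly K n m)} (F : FreeResolution I) (J : Ideal (Poly K n m)) (i : ℕ) :
    Submodule (Poly K n m) ((Poly K n m ⧸ J) ⊗[Poly K n m] (F.ι i →₀ Poly K n m)) :=
  LinearMap.range ((F.d i).lTensor (Poly K n m ⧸ J))

/-- The `i`-cycles of bidegree `d` of the complex `S / J ⊗ F`. -/
def cyclesPiece {I : Ideal (Poly K n m)} (F : FreeResolution I) (J : Ideal (Poly K n m)) (i : ℕ)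
    (d : ℤ × ℤ) : Submodule K ((Poly K n m ⧸ J) ⊗[Poly K n m] (F.ι i →₀ Poly K n m)) :=
  (cycles F J i).restrictScalars K ⊓ tensorPiece F J i d

/-- The component of bidegree `d` of the homology `H_i(S / J ⊗ F)`, that is, the subspace of the
classes of the cycles of bidegree `d`, modulo boundaries. If `F` is a resolution of `S / I`, this is
`Tor_i^S(S / J, S / I)_d`. -/
def torPiece {I : Ideal (Poly K n m)} (F : FreeResolution I) (J : Ideal (Poly K n m)) (i : ℕ)
    (d : ℤ × ℤ) :
    Submodule K (((Poly K n m ⧸ J) ⊗[Poly K n m] (F.ι i →₀ Poly K n m)) ⧸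
      (boundaries F J i).restrictScalars K) :=
  (cyclesPiece F J i d).map ((boundaries F J i).restrictScalars K).mkQ

/-- The bigraded Betti number `β_{i,d}^S(S / J) = dim_K Tor_i^S(S / J, K)_d`. -/
def betti (J : Ideal (Poly K n m)) (i : ℕ) (d : ℤ × ℤ) : Cardinal.{u} :=
  Module.rank K (torPiece (residueResolution K n m) J i d)

/-- The `x`-regularity of `R = S / J`, with the supremum taken in `ℤ ∪ {-∞, ∞}`. -/
def regX (J : Ideal (Poly K n m)) : WithBot (WithTop ℤ) :=
  sSup {s | ∃ a : ℤ, s = ((a : WithTop ℤ) : WithBot (WithTop ℤ)) ∧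
    ∃ (i : ℕ) (b : ℤ), betti J i (a + i, b) ≠ 0}

/-- The `y`-regularity of `R = S / J`, with the supremum taken in `ℤ ∪ {-∞, ∞}`. -/
def regY (J : Ideal (Poly K n m)) : WithBot (WithTop ℤ) :=
  sSup {s | ∃ b : ℤ, s = ((b : WithTop ℤ) : WithBot (WithTop ℤ)) ∧
    ∃ (i : ℕ) (a : ℤ), betti J i (a, b + i) ≠ 0}

end

/-! ### d-sequences and generic systems of generators -/

/-- `f_1, …, f_r` is a minimal system of generators of the ideal `I`. -/
def IsMinimalSystem {A : Type u} [CommRing A] {r : ℕ} (f : Fin r → A) (I : Ideal A) : Prop :=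
  Ideal.span (Set.range f) = I ∧ ∀ i, Ideal.span (f '' {j | j ≠ i}) ≠ I

/-- `f_1, …, f_r` is a d-sequence. -/
def IsDSequence {A : Type u} [CommRing A] {r : ℕ} (f : Fin r → A) : Prop :=
  IsMinimalSystem f (Ideal.span (Set.range f)) ∧
    ∀ i, (Ideal.span (f '' {j | j < i})).colon {f i} ⊓ Ideal.span (Set.range f) =
      Ideal.span (f '' {j | j < i})

/-- The Zariski open subsets of a `K`-vector space `V` (used for `V` finite-dimensional). The
polynomial functions on `V` are the polynomials in the linear forms on `V`. -/
def IsZariskiOpen (K : Type u) [Field K] {V : Type u} [AddCommGroup V] [Module K V]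
    (U : Set V) : Prop :=
  ∃ Q : Set (MvPolynomial (Module.Dual K V) K),
    U = {v | ∃ q ∈ Q, MvPolynomial.eval (fun φ : Module.Dual K V => φ v) q ≠ 0}

/-- A generic minimal system of generators of the ideal `formIdeal J e` that consists of forms of
bidegree `e` has the property `P`: there is a Zariski open set of `r`-tuples of forms of bidegree
`e`, where `r = dim_K R_e`, that contains a minimal system of generators, such that all the minimal
systems of generators in it have the property `P`. (If `J ≠ S` and `e` is `(1, 0)` or `(0, 1)`, the
minimal systems of generators that consist of forms of bidegree `e` are the `K`-bases of `R_e`.) -/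
def GenericMinimalSystem {K : Type u} [Field K] {n m : ℕ} (J : Ideal (Poly K n m)) (e : ℤ × ℤ)
    (P : (Fin (Module.finrank K (quotPiece J e)) → Poly K n m ⧸ J) → Prop) : Prop :=
  ∃ U : Set (Fin (Module.finrank K (quotPiece J e)) → quotPiece J e),
    IsZariskiOpen K U ∧
    (∃ f ∈ U, IsMinimalSystem (fun i => (f i : Poly K n m ⧸ J)) (formIdeal J e)) ∧
    ∀ f ∈ U, IsMinimalSystem (fun i => (f i : Poly K n m ⧸ J)) (formIdeal J e) →
      P (fun i => (f i : Poly K n m ⧸ J))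

end Bigraded

end

/-! Let `e` be the bidegree in question, `π` the matching coordinate of bidegrees, and `Q_j` the
ideal generated by `J` and the first `j` of a sequence of forms of bidegree `e`. As `J` is proper,
`β_{0,0}(R) ≠ 0`, so regularity `0` means that `Tor_i(R, K)_d = 0` whenever `π d > i` (`LinearTor`).

A basis `u_1, …, u_N` of `S_e` is a regular sequence on `S`. Hence `Tor_i(R, S/(u_1, …, u_j))` is
Koszul homology `H_i(j)`, and the step from `j` to `j + 1` is a mapping cone with its long exact
sequence. Adjoining the variables of the other kind does not affect the vanishing in the range `π d
> i`, because they leave `π` unchanged; one direction is a Nakayama argument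
(`linearTor_iff_initIdeal`). So `LinearTor` says that `H_i(N)_d = 0` for `π d > i`.

If `(Q_j : u_{j+1})_d = (Q_j)_d` for all `j` and all `d` with `π d ≥ 1`, the exact sequences give
this vanishing by induction on `j` (`linearTor_of_colon`). Conversely, the vanishing descends from
`N` to smaller `j` and yields the colon equalities (`colon_of_linearTor`), provided that every `(Q_j
: u_{j+1}) / Q_j` is torsion with respect to `S_e`. Then the homology in positive homological degree
is torsion, whereas the exact sequence makes `u_{j+1}` injective on it in the relevant bidegrees.

The ideal of `R` generated by `R_e` is the part of `R` with `π ≥ 1`, so the colon equalities are the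
d-sequence condition (`colon_inf_eq_iff`). A basis of `R_e` lifts to `S` and extends by elements of
`J` to a basis of `S_e`; the additional conditions are void. Thus a single basis of `R_e` that is a
d-sequence forces regularity `0`, without genericity.

For the other direction, prime avoidance over the infinite field gives a basis with the torsion
property (`exists_torsion_point`), hence with the colon equalities. They spread to an open set: `dim
(Q : z)_d` is determined by the Hilbert functions of `Q` and `Q + (z)` (`finrank_colonPiece`), and
the Hilbert functions of the `Q_j` are constant on a nonempty open set of coefficient matrices
(`exists_finrank_eq`), where the basis can be chosen. -/

noncomputable section

universe u

namespace Bigraded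

variable {K : Type u} [Field K] {n m : ℕ}

/-! ### Homology modulo an ideal, in terms of elements -/

/-- The elements of a free module whose coefficients lie in `J`. -/
def coeffIn (J : Ideal (Poly K n m)) (ι : Type u) : Submodule (Poly K n m) (ι →₀ Poly K n m) where
  carrier := {x | ∀ j, x j ∈ J}
  add_mem' ha hb j := J.add_mem (ha j) (hb j)
  zero_mem' _ := J.zero_mem
  smul_mem' c _ hx j := J.mul_mem_left c (hx j)

theorem mem_coeffIn {J : Ideal (Poly K n m)} {ι : Type u} {x : ι →₀ Poly K n m} :
    x ∈ coeffIn J ι ↔ ∀ j, x j ∈ J := Iff.rfl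

theorem smul_mem_coeffIn {J : Ideal (Poly K n m)} {ι : Type u} {p : Poly K n m} (hp : p ∈ J)
    (x : ι →₀ Poly K n m) : p • x ∈ coeffIn J ι := fun j => J.mul_mem_right (x j) hp

theorem map_mem_coeffIn {J : Ideal (Poly K n m)} {ι ι' : Type u}
    (φ : (ι →₀ Poly K n m) →ₗ[Poly K n m] (ι' →₀ Poly K n m)) {x : ι →₀ Poly K n m}
    (hx : x ∈ coeffIn J ι) : φ x ∈ coeffIn J ι' := by
  rw [← Finsupp.sum_single x, Finsupp.sum, map_sum]
  refine Submodule.sum_mem _ fun j _ => ?_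
  rw [← mul_one (x j), ← smul_eq_mul, ← Finsupp.smul_single, map_smul]
  exact smul_mem_coeffIn (hx j) _

theorem freeComp_mem_coeffIn {J : Ideal (Poly K n m)} (hJ : J.IsHomogeneous (polyPiece K n m))
    {ι : Type u} (deg : ι → ℤ × ℤ) (d : ℤ × ℤ) {x : ι →₀ Poly K n m} (hx : x ∈ coeffIn J ι) :
    freeComp deg d x ∈ coeffIn J ι := fun j => by
  rw [freeComp_apply]
  exact polyComp_mem hJ (hx j) _

theorem smul_one_quotient (J : Ideal (Poly K n m)) (p : Poly K n m) :
    p • (1 : Poly K n m ⧸ J) = Ideal.Quotient.mk J p := by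
  change Ideal.Quotient.mk J (p * 1) = _
  rw [mul_one]

/-- `S/J ⊗ F` is `F/JF`, computed coefficientwise. Through this every statement about Tor becomes
one about elements of `F` modulo `J`. -/
theorem one_tmul_eq_zero_iff {J : Ideal (Poly K n m)} {ι : Type u} (x : ι →₀ Poly K n m) :
    (1 : Poly K n m ⧸ J) ⊗ₜ[Poly K n m] x = 0 ↔ x ∈ coeffIn J ι := by
  classical
  rw [← (TensorProduct.finsuppScalarRight (Poly K n m) (Poly K n m) (Poly K n m ⧸ J) ι).map_eq_zero_iff,
    Finsupp.ext_iff]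
  refine forall_congr' fun j => ?_
  rw [TensorProduct.finsuppScalarRight_apply_tmul_apply, smul_one_quotient,
    Finsupp.zero_apply]
  exact Ideal.Quotient.eq_zero_iff_mem

theorem exists_one_tmul {J : Ideal (Poly K n m)} {ι : Type u}
    (t : (Poly K n m ⧸ J) ⊗[Poly K n m] (ι →₀ Poly K n m)) :
    ∃ x, t = (1 : Poly K n m ⧸ J) ⊗ₜ[Poly K n m] x := by
  induction t using TensorProduct.induction_on with
  | zero => exact ⟨0, by simp⟩
  | add a b ha hb =>
    obtain ⟨x, rfl⟩ := ha
    obtain ⟨y, rfl⟩ := hb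
    exact ⟨x + y, by rw [TensorProduct.tmul_add]⟩
  | tmul r c =>
    obtain ⟨p, rfl⟩ := Ideal.Quotient.mk_surjective r
    refine ⟨p • c, ?_⟩
    rw [← TensorProduct.smul_tmul, smul_one_quotient]

namespace FreeResolution

variable {I : Ideal (Poly K n m)}

/-- The index set of `F_{i-1}`, empty for `i = 0`. -/
def prevι (F : FreeResolution I) : ℕ → Type u
  | 0 => PEmpty
  | i + 1 => F.ι i

/-- The bidegrees of the basis of `F_{i-1}`. -/
def prevDeg (F : FreeResolution I) : ∀ i, F.prevι i → ℤ × ℤ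
  | 0 => fun j => PEmpty.elim j
  | i + 1 => F.deg i

/-- The differential `F_i → F_{i-1}`, where `F_{-1} = 0`. -/
def bd (F : FreeResolution I) :
    ∀ i, (F.ι i →₀ Poly K n m) →ₗ[Poly K n m] (F.prevι i →₀ Poly K n m)
  | 0 => 0
  | i + 1 => F.d i

/-- `x ∈ F_i` is a cycle modulo `J`. -/
def IsCycle (F : FreeResolution I) (J : Ideal (Poly K n m)) (i : ℕ) (x : F.ι i →₀ Poly K n m) :
    Prop := F.bd i x ∈ coeffIn J (F.prevι i)

/-- `x ∈ F_i` is a boundary modulo `J`. -/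
def IsBdry (F : FreeResolution I) (J : Ideal (Poly K n m)) (i : ℕ) (x : F.ι i →₀ Poly K n m) :
    Prop := ∃ y, x - F.d i y ∈ coeffIn J (F.ι i)

/-- Every homogeneous `i`-cycle of bidegree `d` modulo `J` is a boundary modulo `J`. -/
def Van (F : FreeResolution I) (J : Ideal (Poly K n m)) (i : ℕ) (d : ℤ × ℤ) : Prop :=
  ∀ x ∈ freePiece (K := K) (F.deg i) d, F.IsCycle J i x → F.IsBdry J i x

theorem d_d (F : FreeResolution I) (i : ℕ) (x) : F.d i (F.d (i + 1) x) = 0 :=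
  (F.exact_succ i).apply_apply_eq_zero x

theorem bd_d (F : FreeResolution I) (i : ℕ) (x) : F.bd i (F.d i x) = 0 := by
  cases i with
  | zero => rfl
  | succ i => exact F.d_d i x

theorem bd_homogeneous (F : FreeResolution I) (i : ℕ) (j : F.ι i) :
    F.bd i (Finsupp.single j 1) ∈ freePiece (K := K) (F.prevDeg i) (F.deg i j) := by
  cases i with
  | zero => exact zero_mem _
  | succ i => exact F.d_homogeneous i j

theorem d_freeComp (F : FreeResolution I) (i : ℕ) (d : ℤ × ℤ) (x) :
    F.d i (freeComp (F.deg (i + 1)) d x) = freeComp (F.deg i) d (F.d i x) :=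
  map_freeComp _ _ _ (F.d_homogeneous i) d x

variable {F : FreeResolution I} {J : Ideal (Poly K n m)} {i : ℕ}

theorem isCycle_zero (x) : F.IsCycle J 0 x := zero_mem _

theorem IsCycle.smul (p : Poly K n m) {x} (hx : F.IsCycle J i x) : F.IsCycle J i (p • x) := by
  unfold IsCycle at *
  rw [map_smul]
  exact Submodule.smul_mem _ _ hx

theorem IsBdry.add {x y} (hx : F.IsBdry J i x) (hy : F.IsBdry J i y) : F.IsBdry J i (x + y) := by
  obtain ⟨a, ha⟩ := hx
  obtain ⟨b, hb⟩ := hy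
  refine ⟨a + b, ?_⟩
  convert add_mem ha hb using 1
  rw [map_add]; abel

theorem IsBdry.smul (p : Poly K n m) {x} (hx : F.IsBdry J i x) : F.IsBdry J i (p • x) := by
  obtain ⟨a, ha⟩ := hx
  refine ⟨p • a, ?_⟩
  convert Submodule.smul_mem _ p ha using 1
  rw [map_smul, smul_sub]

theorem isBdry_of_mem {x} (hx : x ∈ coeffIn J (F.ι i)) : F.IsBdry J i x := ⟨0, by simpa using hx⟩

/-- A homogeneous boundary is the boundary of a homogeneous element. -/
theorem IsBdry.homogeneous (hJ : J.IsHomogeneous (polyPiece K n m)) {d : ℤ × ℤ} {x}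
    (hx : F.IsBdry J i x) (hd : x ∈ freePiece (K := K) (F.deg i) d) :
    ∃ y ∈ freePiece (K := K) (F.deg (i + 1)) d, x - F.d i y ∈ coeffIn J (F.ι i) := by
  obtain ⟨y, hy⟩ := hx
  refine ⟨freeComp (F.deg (i + 1)) d y, freeComp_mem _ _ _, ?_⟩
  have := freeComp_mem_coeffIn hJ (F.deg i) d hy
  rwa [map_sub, freeComp_of_mem _ _ _ _ hd, if_pos rfl, ← d_freeComp] at this

theorem mem_tensorPiece_iff {d : ℤ × ℤ} {t} :
    t ∈ tensorPiece F J i d ↔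
      ∃ x ∈ freePiece (K := K) (F.deg i) d, t = (1 : Poly K n m ⧸ J) ⊗ₜ[Poly K n m] x := by
  constructor
  · intro ht
    induction ht using Submodule.span_induction with
    | mem t ht =>
      obtain ⟨a, b, r, c, hab, ⟨p, hp, rfl⟩, hc, rfl⟩ := ht
      refine ⟨p • c, hab ▸ smul_freePiece _ hp hc, ?_⟩
      rw [← TensorProduct.smul_tmul, smul_one_quotient]
      rfl
    | zero => exact ⟨0, zero_mem _, by simp⟩
    | add a b _ _ ha hb =>
      obtain ⟨x, hx, rfl⟩ := ha
      obtain ⟨y, hy, rfl⟩ := hb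
      exact ⟨x + y, add_mem hx hy, by rw [TensorProduct.tmul_add]⟩
    | smul k a _ ha =>
      obtain ⟨x, hx, rfl⟩ := ha
      exact ⟨k • x, Submodule.smul_mem _ k hx, by rw [TensorProduct.tmul_smul]⟩
  · rintro ⟨x, hx, rfl⟩
    exact Submodule.subset_span ⟨0, d, 1, x, zero_add d,
      ⟨1, MvPolynomial.isWeightedHomogeneous_one K (varDeg n m), rfl⟩, hx, rfl⟩

theorem one_tmul_mem_cycles_iff {x} :
    (1 : Poly K n m ⧸ J) ⊗ₜ[Poly K n m] x ∈ cycles F J i ↔ F.IsCycle J i x := by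
  cases i with
  | zero => exact iff_of_true trivial (isCycle_zero x)
  | succ i =>
    change _ = _ ↔ _
    rw [LinearMap.lTensor_tmul, one_tmul_eq_zero_iff]
    rfl

theorem one_tmul_mem_boundaries_iff {x} :
    (1 : Poly K n m ⧸ J) ⊗ₜ[Poly K n m] x ∈ boundaries F J i ↔ F.IsBdry J i x := by
  constructor
  · rintro ⟨t, ht⟩
    obtain ⟨y, rfl⟩ := exists_one_tmul t
    refine ⟨y, ?_⟩
    rw [← one_tmul_eq_zero_iff, TensorProduct.tmul_sub, ← ht, LinearMap.lTensor_tmul, sub_self]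
  · rintro ⟨y, hy⟩
    refine ⟨1 ⊗ₜ y, ?_⟩
    rw [← one_tmul_eq_zero_iff, TensorProduct.tmul_sub, sub_eq_zero] at hy
    rw [LinearMap.lTensor_tmul, hy]

theorem torPiece_eq_bot_iff {d : ℤ × ℤ} : torPiece F J i d = ⊥ ↔ F.Van J i d := by
  rw [torPiece, ← le_bot_iff, Submodule.map_le_iff_le_comap, Submodule.comap_bot, Submodule.ker_mkQ]
  constructor
  · intro h x hx hc
    rw [← one_tmul_mem_boundaries_iff]
    exact h ⟨one_tmul_mem_cycles_iff.2 hc, mem_tensorPiece_iff.2 ⟨x, hx, rfl⟩⟩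
  · rintro h t ⟨hc, ht⟩
    obtain ⟨x, hx, rfl⟩ := mem_tensorPiece_iff.1 ht
    exact one_tmul_mem_boundaries_iff.2 (h x hx (one_tmul_mem_cycles_iff.1 hc))

end FreeResolution

theorem betti_eq_zero_iff {J : Ideal (Poly K n m)} {i : ℕ} {d : ℤ × ℤ} :
    betti J i d = 0 ↔ (residueResolution K n m).Van J i d := by
  rw [betti, rank_zero_iff, ← FreeResolution.torPiece_eq_bot_iff, Submodule.subsingleton_iff_eq_bot]

/-! ### Comparison of resolutions -/

theorem linearMap_ext_single {ι : Type u} {N : Type u} [AddCommGroup N] [Module (Poly K n m) N]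
    {f g : (ι →₀ Poly K n m) →ₗ[Poly K n m] N}
    (h : ∀ j, f (Finsupp.single j 1) = g (Finsupp.single j 1)) : f = g := by
  ext j
  simpa using h j

/-- Projectivity of free modules. The predicate `P` lets the images of the basis be chosen
homogeneous. -/
theorem exists_lift_of_mem_range {α ι N : Type u} [AddCommGroup N] [Module (Poly K n m) N]
    (d : (α →₀ Poly K n m) →ₗ[Poly K n m] N) (f : (ι →₀ Poly K n m) →ₗ[Poly K n m] N)
    (P : ι → (α →₀ Poly K n m) → Prop)
    (h : ∀ j, ∃ y, P j y ∧ d y = f (Finsupp.single j 1)) :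
    ∃ g : (ι →₀ Poly K n m) →ₗ[Poly K n m] (α →₀ Poly K n m),
      (∀ j, P j (g (Finsupp.single j 1))) ∧ ∀ x, d (g x) = f x := by
  choose y hP hy using h
  refine ⟨Finsupp.linearCombination _ y, fun j => by simpa using hP j, fun x => ?_⟩
  have : d ∘ₗ Finsupp.linearCombination _ y = f := linearMap_ext_single fun j => by simp [hy]
  exact LinearMap.congr_fun this x

theorem map_freePiece {ι ι' : Type u} {deg : ι → ℤ × ℤ} {deg' : ι' → ℤ × ℤ}
    {φ : (ι →₀ Poly K n m) →ₗ[Poly K n m] (ι' →₀ Poly K n m)}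
    (hφ : ∀ j, φ (Finsupp.single j 1) ∈ freePiece (K := K) deg' (deg j)) {d : ℤ × ℤ} {x}
    (hx : x ∈ freePiece (K := K) deg d) : φ x ∈ freePiece (K := K) deg' d := by
  have h := map_freeComp deg deg' φ hφ d x
  rw [freeComp_of_mem _ _ _ _ hx, if_pos rfl] at h
  rw [h]
  exact freeComp_mem _ _ _

theorem quotPiece_smul {I : Ideal (Poly K n m)} {a b : ℤ × ℤ} {p : Poly K n m}
    {r : Poly K n m ⧸ I} (hp : p ∈ polyPiece K n m a) (hr : r ∈ quotPiece I b) :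
    p • r ∈ quotPiece I (a + b) := by
  obtain ⟨q, hq, rfl⟩ := hr
  exact ⟨p * q, SetLike.mul_mem_graded hp hq, rfl⟩

namespace FreeResolution

variable {I : Ideal (Poly K n m)}

theorem aug_mem (F : FreeResolution I) {d : ℤ × ℤ} {x} (hx : x ∈ freePiece (K := K) (F.deg 0) d) :
    F.aug x ∈ quotPiece I d := by
  rw [← Finsupp.sum_single x, Finsupp.sum, map_sum]
  refine Submodule.sum_mem _ fun j _ => ?_
  rw [← mul_one (x j), ← smul_eq_mul, ← Finsupp.smul_single, map_smul]
  simpa using quotPiece_smul (hx j) (F.aug_homogeneous j)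

theorem exists_aug_eq (hI : I.IsHomogeneous (polyPiece K n m)) (F : FreeResolution I) {d : ℤ × ℤ}
    {p : Poly K n m} (hp : p ∈ polyPiece K n m d) :
    ∃ y ∈ freePiece (K := K) (F.deg 0) d, F.aug y = Ideal.Quotient.mk I p := by
  classical
  obtain ⟨y, hy⟩ := F.aug_surjective (Ideal.Quotient.mk I p)
  refine ⟨freeComp (F.deg 0) d y, freeComp_mem _ _ _, ?_⟩
  obtain ⟨D, hD⟩ := sum_freeComp (F.deg 0) y
  have hq : ∀ d', ∃ q ∈ polyPiece K n m d', Ideal.Quotient.mk I q = F.aug (freeComp (F.deg 0) d' y) :=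
    fun d' => F.aug_mem (freeComp_mem _ _ _)
  choose q hq hqa using hq
  -- Since `I` is bigraded, the component of bidegree `d` of this relation, `q d - p`, lies in `I`.
  -- The index `d` is inserted because it need not occur in `D`.
  have h1 : ∑ d' ∈ insert d D, q d' - p ∈ I := by
    rw [← Ideal.Quotient.eq_zero_iff_mem, map_sub, map_sum, sub_eq_zero]
    simp_rw [hqa]
    rw [← map_sum, hD _ (Finset.subset_insert _ _), hy]
  have h2 := polyComp_mem hI h1 d
  rw [map_sub, map_sum, Finset.sum_eq_single d, MvPolynomial.weightedHomogeneousComponent_of_mem hp,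
    MvPolynomial.weightedHomogeneousComponent_of_mem (hq d), if_pos rfl, if_pos rfl] at h2
  · rw [← hqa, ← sub_eq_zero, ← map_sub]
    exact Ideal.Quotient.eq_zero_iff_mem.2 h2
  · intro d' _ hd'
    rw [MvPolynomial.weightedHomogeneousComponent_of_mem (hq d'), if_neg hd'.symm]
  · simp

variable (F G : FreeResolution I)

/-- `x ∈ F_i` is a cycle of the augmented complex. -/
def AugCycle : ∀ i, (F.ι i →₀ Poly K n m) → Prop
  | 0, x => F.aug x = 0
  | i + 1, x => F.d i x = 0

variable {F} in
theorem AugCycle.exists_eq {i : ℕ} {x} (hx : F.AugCycle i x) : ∃ y, F.d i y = x := by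
  cases i with
  | zero => exact (F.exact_zero x).1 hx
  | succ i => exact (F.exact_succ i x).1 hx

theorem augCycle_d (i : ℕ) (x) : F.AugCycle i (F.d i x) := by
  cases i with
  | zero => exact F.exact_zero.apply_apply_eq_zero x
  | succ i => exact F.d_d i x

/-- A map `F_i → G_i` that can be continued to a map of complexes. -/
structure StepMap (i : ℕ) where
  /-- the map -/
  toMap : (F.ι i →₀ Poly K n m) →ₗ[Poly K n m] (G.ι i →₀ Poly K n m)
  homogeneous : ∀ j, toMap (Finsupp.single j 1) ∈ freePiece (K := K) (G.deg i) (F.deg i j)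
  cycle : ∀ x, F.AugCycle i x → G.AugCycle i (toMap x)

theorem StepMap.exists_next {F G : FreeResolution I} {i : ℕ} (φ : StepMap F G i) :
    ∃ ψ : StepMap F G (i + 1), ∀ x, G.d i (ψ.toMap x) = φ.toMap (F.d i x) := by
  obtain ⟨g, hg, hdg⟩ := exists_lift_of_mem_range (G.d i) (φ.toMap ∘ₗ F.d i)
    (fun j y => y ∈ freePiece (K := K) (G.deg (i + 1)) (F.deg (i + 1) j)) fun j => by
      obtain ⟨y, hy⟩ := (φ.cycle _ (F.augCycle_d i (Finsupp.single j 1))).exists_eq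
      refine ⟨freeComp (G.deg (i + 1)) (F.deg (i + 1) j) y, freeComp_mem _ _ _, ?_⟩
      rw [d_freeComp, hy, freeComp_of_mem _ _ (F.deg (i + 1) j), if_pos rfl, LinearMap.comp_apply]
      exact map_freePiece φ.homogeneous (F.d_homogeneous i j)
  refine ⟨⟨g, hg, fun x hx => ?_⟩, hdg⟩
  change G.d i (g x) = 0
  rw [hdg, LinearMap.comp_apply, show F.d i x = 0 from hx, map_zero]

theorem exists_chainMap (hI : I.IsHomogeneous (polyPiece K n m)) :
    ∃ φ : ∀ i, StepMap F G i, (∀ x, G.aug ((φ 0).toMap x) = F.aug x) ∧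
      ∀ i x, G.d i ((φ (i + 1)).toMap x) = (φ i).toMap (F.d i x) := by
  obtain ⟨g, hg, hdg⟩ := exists_lift_of_mem_range G.aug F.aug
    (fun j y => y ∈ freePiece (K := K) (G.deg 0) (F.deg 0 j)) fun j => by
      obtain ⟨p, hp, hpa⟩ := F.aug_homogeneous j
      obtain ⟨y, hy, hya⟩ := G.exists_aug_eq hI hp
      exact ⟨y, hy, hya.trans hpa⟩
  let φ₀ : StepMap F G 0 := ⟨g, hg, fun x hx => (hdg x).trans hx⟩
  let φ : ∀ i, StepMap F G i := fun i =>
    Nat.rec φ₀ (fun _ ψ => Classical.choose ψ.exists_next) i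
  exact ⟨φ, hdg, fun i => Classical.choose_spec (φ i).exists_next⟩

/-- A chain map that is zero on the augmentation is null-homotopic. The homotopy need not be
homogeneous, as it only serves to exhibit boundaries. -/
theorem exists_homotopy
    (θ : ∀ i, (F.ι i →₀ Poly K n m) →ₗ[Poly K n m] (F.ι i →₀ Poly K n m))
    (h0 : ∀ x, F.aug (θ 0 x) = 0) (hθ : ∀ i x, F.d i (θ (i + 1) x) = θ i (F.d i x)) :
    ∃ h : ∀ i, (F.ι i →₀ Poly K n m) →ₗ[Poly K n m] (F.ι (i + 1) →₀ Poly K n m),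
      (∀ x, F.d 0 (h 0 x) = θ 0 x) ∧
      ∀ i x, F.d (i + 1) (h (i + 1) x) = θ (i + 1) x - h i (F.d i x) := by
  let T (i : ℕ) := {h : (F.ι i →₀ Poly K n m) →ₗ[Poly K n m] (F.ι (i + 1) →₀ Poly K n m) //
    ∀ x, F.d i (h (F.d i x)) = θ i (F.d i x)}
  obtain ⟨g, -, hg⟩ := exists_lift_of_mem_range (F.d 0) (θ 0) (fun _ _ => True) fun j => by
    obtain ⟨y, hy⟩ := (F.exact_zero _).1 (h0 (Finsupp.single j 1))
    exact ⟨y, trivial, hy⟩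
  -- The invariant stored in `T i` says that `θ (i + 1) - h ∘ d` takes values in the cycles, so
  -- exactness provides the next map.
  have step : ∀ i (h : T i), ∃ h' : T (i + 1),
      ∀ x, F.d (i + 1) (h'.1 x) = θ (i + 1) x - h.1 (F.d i x) := by
    intro i h
    obtain ⟨g, -, hg⟩ := exists_lift_of_mem_range (F.d (i + 1)) (θ (i + 1) - h.1 ∘ₗ F.d i)
      (fun _ _ => True) fun j => by
        obtain ⟨y, hy⟩ := (F.exact_succ i ((θ (i + 1) - h.1 ∘ₗ F.d i) (Finsupp.single j 1))).1 (by
          simp only [LinearMap.sub_apply, LinearMap.comp_apply, map_sub]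
          rw [hθ, h.2, sub_self])
        exact ⟨y, trivial, hy⟩
    refine ⟨⟨g, fun x => ?_⟩, hg⟩
    rw [hg, LinearMap.sub_apply, LinearMap.comp_apply, F.d_d, map_zero, sub_zero]
  choose next hnext using step
  let h : ∀ i, T i := fun i => Nat.rec ⟨g, fun x => hg _⟩ (fun i h => next i h) i
  exact ⟨fun i => (h i).1, hg, fun i x => hnext i (h i) x⟩

/-- Homology modulo `J` does not depend on the resolution. -/
theorem exists_comparison (hI : I.IsHomogeneous (polyPiece K n m)) (J : Ideal (Poly K n m))
    (i : ℕ) : ∃ φ : (F.ι i →₀ Poly K n m) → (G.ι i →₀ Poly K n m),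
      (∀ d, ∀ x ∈ freePiece (K := K) (F.deg i) d, φ x ∈ freePiece (K := K) (G.deg i) d) ∧
      (∀ x, F.IsCycle J i x → G.IsCycle J i (φ x)) ∧
      ∀ x, F.IsCycle J i x → G.IsBdry J i (φ x) → F.IsBdry J i x := by
  obtain ⟨φ, hφ0, hφ⟩ := exists_chainMap F G hI
  obtain ⟨ψ, hψ0, hψ⟩ := exists_chainMap G F hI
  obtain ⟨h, hh0, hh⟩ := F.exists_homotopy
    (fun i => (ψ i).toMap ∘ₗ (φ i).toMap - LinearMap.id)
    (fun x => by simp [hψ0, hφ0]) (fun i x => by simp [hφ, hψ])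
  refine ⟨(φ i).toMap, fun d x hx => map_freePiece (φ i).homogeneous hx, fun x hx => ?_,
    fun x hx hb => ?_⟩
  · cases i with
    | zero => exact isCycle_zero _
    | succ i =>
      change G.d i _ ∈ _
      rw [hφ]
      exact map_mem_coeffIn _ hx
  -- `ψφ - 1 = dh + hd`, and on a cycle modulo `J` the term `h (d x)` has coefficients in `J`.
  · have h1 : F.IsBdry J i ((ψ i).toMap ((φ i).toMap x) - x) := by
      cases i with
      | zero => exact ⟨h 0 x, by rw [hh0]; simp⟩
      | succ i =>
        refine ⟨h (i + 1) x, ?_⟩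
        rw [hh]
        have h1 := map_mem_coeffIn (h i) (x := F.d i x) hx
        simpa using h1
    obtain ⟨y, hy⟩ := hb
    have h2 : F.IsBdry J i ((ψ i).toMap ((φ i).toMap x)) := by
      refine ⟨(ψ (i + 1)).toMap y, ?_⟩
      rw [hψ, ← map_sub]
      exact map_mem_coeffIn _ hy
    have h3 := h2.add (h1.smul (-1))
    rwa [neg_smul, one_smul, neg_sub, add_sub_cancel] at h3

variable {F G}

theorem Van.of_resolution (hI : I.IsHomogeneous (polyPiece K n m)) {J : Ideal (Poly K n m)}
    {i : ℕ} {d : ℤ × ℤ} (h : G.Van J i d) (F : FreeResolution I) : F.Van J i d := by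
  obtain ⟨φ, h1, h2, h3⟩ := exists_comparison F G hI J i
  exact fun x hx hc => h3 x hc (h _ (h1 d x hx) (h2 x hc))

end FreeResolution

theorem single_one_mem_freePiece {ι : Type u} (deg : ι → ℤ × ℤ) (j : ι) :
    (Finsupp.single j 1 : ι →₀ Poly K n m) ∈ freePiece (K := K) deg (deg j) := by
  simpa using single_monomial_mem (K := K) (n := n) (m := m) deg j 0 1

/-! ### Mapping cones -/

namespace FreeResolution

variable {I : Ideal (Poly K n m)} (F : FreeResolution I)

/-- The free module `F_i ⊕ F_{i-1}`, as a product. -/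
def coneEquiv (i : ℕ) : (F.ι i ⊕ F.prevι i →₀ Poly K n m) ≃ₗ[Poly K n m]
    (F.ι i →₀ Poly K n m) × (F.prevι i →₀ Poly K n m) :=
  Finsupp.sumFinsuppLEquivProdFinsupp (Poly K n m)

/-- The bidegrees of the basis of `F_i ⊕ F_{i-1}(-e)`. -/
def coneDeg (e : ℤ × ℤ) (i : ℕ) : F.ι i ⊕ F.prevι i → ℤ × ℤ :=
  Sum.elim (F.deg i) fun j => F.prevDeg i j + e

/-- The free module `F_{i+1} ⊕ F_i`, as a product. -/
def coneEquivSucc (i : ℕ) : (F.ι (i + 1) ⊕ F.prevι (i + 1) →₀ Poly K n m) ≃ₗ[Poly K n m]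
    (F.ι (i + 1) →₀ Poly K n m) × (F.ι i →₀ Poly K n m) := F.coneEquiv (i + 1)

/-- The differential `(a, b) ↦ (d a + z b, - d b)` of the mapping cone of the multiplication
by `z`. -/
def coneD (z : Poly K n m) (i : ℕ) : (F.ι (i + 1) ⊕ F.prevι (i + 1) →₀ Poly K n m) →ₗ[Poly K n m]
    (F.ι i ⊕ F.prevι i →₀ Poly K n m) :=
  (F.coneEquiv i).symm.toLinearMap ∘ₗ
    (LinearMap.prod
      (F.d i ∘ₗ LinearMap.fst (Poly K n m) _ (F.ι i →₀ Poly K n m) +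
        z • LinearMap.snd (Poly K n m) _ (F.ι i →₀ Poly K n m))
      (-(F.bd i ∘ₗ LinearMap.snd (Poly K n m) _ (F.ι i →₀ Poly K n m)))) ∘ₗ
    (F.coneEquivSucc i).toLinearMap

/-- The element `(a, b)` of `F_{i+1} ⊕ F_i`. -/
def coneMk {i : ℕ} (a : F.ι (i + 1) →₀ Poly K n m) (b : F.ι i →₀ Poly K n m) :
    F.ι (i + 1) ⊕ F.prevι (i + 1) →₀ Poly K n m := (F.coneEquivSucc i).symm (a, b)

theorem coneD_coneMk (z : Poly K n m) (i : ℕ) (a : F.ι (i + 1) →₀ Poly K n m)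
    (b : F.ι i →₀ Poly K n m) :
    F.coneD z i (F.coneMk a b) = (F.coneEquiv i).symm (F.d i a + z • b, -F.bd i b) := by
  simp only [coneD, coneMk, LinearMap.comp_apply, LinearEquiv.coe_coe, LinearEquiv.apply_symm_apply]
  rfl

theorem coneD_coneMk_succ (z : Poly K n m) (i : ℕ) (a : F.ι (i + 2) →₀ Poly K n m)
    (b : F.ι (i + 1) →₀ Poly K n m) :
    F.coneD z (i + 1) (F.coneMk a b) = F.coneMk (F.d (i + 1) a + z • b) (-F.d i b) :=
  F.coneD_coneMk z (i + 1) a b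

theorem exists_coneMk {i : ℕ} (x : F.ι (i + 1) ⊕ F.prevι (i + 1) →₀ Poly K n m) :
    ∃ a b, x = F.coneMk a b :=
  ⟨(F.coneEquivSucc i x).1, (F.coneEquivSucc i x).2, ((F.coneEquivSucc i).symm_apply_apply x).symm⟩

theorem cone_mem_coeffIn_iff {J : Ideal (Poly K n m)} {i : ℕ} {a b} :
    (F.coneEquiv i).symm (a, b) ∈ coeffIn J (F.ι i ⊕ F.prevι i) ↔
      a ∈ coeffIn J (F.ι i) ∧ b ∈ coeffIn J (F.prevι i) := by
  simp only [mem_coeffIn, Sum.forall]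
  rfl

theorem cone_mem_freePiece_iff {e d : ℤ × ℤ} {i : ℕ} {a b} :
    (F.coneEquiv i).symm (a, b) ∈ freePiece (K := K) (F.coneDeg e i) d ↔
      a ∈ freePiece (K := K) (F.deg i) d ∧ b ∈ freePiece (K := K) (F.prevDeg i) (d - e) := by
  change (∀ j, _) ↔ (∀ j, _) ∧ (∀ j, _)
  rw [Sum.forall]
  refine and_congr Iff.rfl (forall_congr' fun j => ?_)
  rw [show d - e - F.prevDeg i j = d - F.coneDeg e i (Sum.inr j) by
    simp only [coneDeg, Sum.elim_inr]; abel]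
  rfl

theorem coneMk_mem_coeffIn_iff {J : Ideal (Poly K n m)} {i : ℕ} {a : F.ι (i + 1) →₀ Poly K n m}
    {b : F.ι i →₀ Poly K n m} : F.coneMk a b ∈ coeffIn J (F.ι (i + 1) ⊕ F.prevι (i + 1)) ↔
      a ∈ coeffIn J (F.ι (i + 1)) ∧ b ∈ coeffIn J (F.ι i) := F.cone_mem_coeffIn_iff

theorem coneMk_mem_freePiece_iff {e d : ℤ × ℤ} {i : ℕ} {a : F.ι (i + 1) →₀ Poly K n m}
    {b : F.ι i →₀ Poly K n m} : F.coneMk a b ∈ freePiece (K := K) (F.coneDeg e (i + 1)) d ↔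
      a ∈ freePiece (K := K) (F.deg (i + 1)) d ∧ b ∈ freePiece (K := K) (F.deg i) (d - e) :=
  F.cone_mem_freePiece_iff

theorem exists_coneEquiv_symm {i : ℕ} (x : F.ι i ⊕ F.prevι i →₀ Poly K n m) :
    ∃ a b, x = (F.coneEquiv i).symm (a, b) :=
  ⟨(F.coneEquiv i x).1, (F.coneEquiv i x).2, by simp⟩

theorem bd_mem_freePiece {i : ℕ} {d : ℤ × ℤ} {x} (hx : x ∈ freePiece (K := K) (F.deg i) d) :
    F.bd i x ∈ freePiece (K := K) (F.prevDeg i) d := map_freePiece (F.bd_homogeneous i) hx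

/-- The augmentation of the mapping cone. -/
def coneAug (z : Poly K n m) :
    (F.ι 0 ⊕ F.prevι 0 →₀ Poly K n m) →ₗ[Poly K n m] (Poly K n m ⧸ (I ⊔ Ideal.span {z})) :=
  Submodule.factor (le_sup_left : I ≤ I ⊔ Ideal.span {z}) ∘ₗ F.aug ∘ₗ
    LinearMap.fst (Poly K n m) _ _ ∘ₗ (F.coneEquiv 0).toLinearMap

theorem coneAug_symm (z : Poly K n m) (a b) {p : Poly K n m}
    (hp : F.aug a = Ideal.Quotient.mk I p) :
    F.coneAug z ((F.coneEquiv 0).symm (a, b)) = Ideal.Quotient.mk (I ⊔ Ideal.span {z}) p := by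
  simp only [coneAug, LinearMap.comp_apply, LinearEquiv.coe_coe, LinearEquiv.apply_symm_apply,
    LinearMap.fst_apply, hp]
  rfl

/-- The mapping cone of the multiplication by `z`, a resolution of `S / (I, z)` if `z` is a
nonzerodivisor on `S / I`. -/
def cone {z : Poly K n m} {e : ℤ × ℤ} (hz : z ∈ polyPiece K n m e)
    (hreg : ∀ p, z * p ∈ I → p ∈ I) : FreeResolution (I ⊔ Ideal.span {z}) where
  ι i := F.ι i ⊕ F.prevι i
  deg := F.coneDeg e
  d := F.coneD z
  aug := F.coneAug z
  d_homogeneous i j := by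
    have h := single_one_mem_freePiece (K := K) (n := n) (m := m) (F.coneDeg e (i + 1)) j
    obtain ⟨a, b, hab⟩ := F.exists_coneMk (Finsupp.single j 1)
    rw [hab, F.coneMk_mem_freePiece_iff] at h
    rw [hab, coneD_coneMk, F.cone_mem_freePiece_iff]
    refine ⟨add_mem (map_freePiece (F.d_homogeneous i) h.1) ?_, neg_mem (F.bd_mem_freePiece h.2)⟩
    have := smul_freePiece (F.deg i) hz h.2
    rwa [add_sub_cancel] at this
  aug_homogeneous j := by
    have h := single_one_mem_freePiece (K := K) (n := n) (m := m) (F.coneDeg e 0) j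
    obtain ⟨a, b, hab⟩ := F.exists_coneEquiv_symm (Finsupp.single j 1)
    rw [hab, F.cone_mem_freePiece_iff] at h
    obtain ⟨p, hp, hpa⟩ := F.aug_mem h.1
    rw [hab, F.coneAug_symm z a b hpa.symm]
    exact ⟨p, hp, rfl⟩
  aug_surjective r := by
    obtain ⟨p, rfl⟩ := Ideal.Quotient.mk_surjective r
    obtain ⟨a, ha⟩ := F.aug_surjective (Ideal.Quotient.mk I p)
    exact ⟨(F.coneEquiv 0).symm (a, 0), F.coneAug_symm z a 0 ha⟩
  exact_zero x := by
    obtain ⟨a, b, rfl⟩ := F.exists_coneEquiv_symm x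
    obtain ⟨p, hp⟩ := Ideal.Quotient.mk_surjective (F.aug a)
    rw [F.coneAug_symm z a b hp.symm, Ideal.Quotient.eq_zero_iff_mem]
    constructor
    · intro h
      obtain ⟨q, hq, r, hr, rfl⟩ := Submodule.mem_sup.1 h
      obtain ⟨s, rfl⟩ := Ideal.mem_span_singleton'.1 hr
      obtain ⟨c, hc⟩ := F.aug_surjective (Ideal.Quotient.mk I s)
      obtain ⟨f, hf⟩ := (F.exact_zero (a - z • c)).1 (by
        rw [map_sub, map_smul, hc, ← hp, sub_eq_zero, map_add, Ideal.Quotient.eq_zero_iff_mem.2 hq,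
          zero_add, mul_comm, map_mul]
        rfl)
      refine ⟨F.coneMk f c, ?_⟩
      rw [coneD_coneMk, hf, sub_add_cancel]
      congr 2
      ext j
      exact PEmpty.elim j
    · rintro ⟨y, hy⟩
      obtain ⟨f, c, rfl⟩ := F.exists_coneMk y
      rw [coneD_coneMk] at hy
      obtain ⟨s, hs⟩ := Ideal.Quotient.mk_surjective (F.aug c)
      have ha : F.d 0 f + z • c = a := congrArg Prod.fst ((F.coneEquiv 0).symm.injective hy)
      have h1 : Ideal.Quotient.mk I p = Ideal.Quotient.mk I (z * s) := by
        rw [hp, ← ha, map_add, map_smul, F.exact_zero.apply_apply_eq_zero, zero_add, ← hs]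
        rfl
      have h2 := Ideal.Quotient.eq.1 h1
      rw [← sub_add_cancel p (z * s)]
      exact Submodule.add_mem_sup h2 (Ideal.mem_span_singleton.2 (dvd_mul_right _ _))
  exact_succ i x := by
    obtain ⟨a, b, rfl⟩ := F.exists_coneMk x
    constructor
    · intro h
      rw [coneD_coneMk, LinearEquiv.map_eq_zero_iff, Prod.mk_eq_zero] at h
      obtain ⟨h1, h2⟩ := h
      -- The regularity of `z` enters only here: if `z b` is a boundary for `b` in `F_0`, then `b`
      -- is one. In higher degrees `F` itself is exact.
      have h3 : ∃ c, F.d i c = b := by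
        cases i with
        | zero =>
          refine (F.exact_zero b).1 ?_
          obtain ⟨s, hs⟩ := Ideal.Quotient.mk_surjective (F.aug b)
          have h4 : Ideal.Quotient.mk I (z * s) = 0 := by
            have := congrArg F.aug h1
            rw [map_add, F.exact_zero.apply_apply_eq_zero, zero_add, map_smul, map_zero, ← hs] at this
            exact this
          rw [← hs]
          exact Ideal.Quotient.eq_zero_iff_mem.2 (hreg s (Ideal.Quotient.eq_zero_iff_mem.1 h4))
        | succ i => exact (F.exact_succ i b).1 (neg_eq_zero.1 h2)
      obtain ⟨c, rfl⟩ := h3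
      obtain ⟨f, hf⟩ := (F.exact_succ i (a + z • c)).1 (by rwa [map_add, map_smul])
      refine ⟨F.coneMk f (-c), ?_⟩
      rw [coneD_coneMk_succ, hf, smul_neg, add_neg_cancel_right, map_neg, neg_neg]
    · rintro ⟨y, hy⟩
      obtain ⟨f, c, rfl⟩ := F.exists_coneMk y
      rw [coneD_coneMk_succ] at hy
      rw [← hy, coneD_coneMk, LinearEquiv.map_eq_zero_iff, Prod.mk_eq_zero, map_add, F.d_d,
        map_smul, zero_add, map_neg, smul_neg]
      exact ⟨add_neg_cancel _, by rw [F.bd_d, neg_zero, neg_zero]⟩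

end FreeResolution

/-! ### The long exact homology sequence of a mapping cone -/

namespace FreeResolution

variable {I : Ideal (Poly K n m)} {F : FreeResolution I} {J : Ideal (Poly K n m)}
  {z : Poly K n m} {e : ℤ × ℤ} (hz : z ∈ polyPiece K n m e) (hreg : ∀ p, z * p ∈ I → p ∈ I)

theorem cone_isCycle_iff {i : ℕ} {a : F.ι (i + 1) →₀ Poly K n m} {b : F.ι i →₀ Poly K n m} :
    (F.cone hz hreg).IsCycle J (i + 1) (F.coneMk a b) ↔
      F.d i a + z • b ∈ coeffIn J (F.ι i) ∧ F.IsCycle J i b := by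
  have h : F.coneD z i (F.coneMk a b) ∈ coeffIn J (F.ι i ⊕ F.prevι i) ↔
      F.d i a + z • b ∈ coeffIn J (F.ι i) ∧ F.IsCycle J i b := by
    rw [coneD_coneMk, cone_mem_coeffIn_iff, neg_mem_iff]
    rfl
  exact h

theorem cone_isBdry_succ {i : ℕ} {a : F.ι (i + 1) →₀ Poly K n m} {b : F.ι i →₀ Poly K n m} (f c)
    (h1 : a - (F.d (i + 1) f + z • c) ∈ coeffIn J (F.ι (i + 1)))
    (h2 : b + F.d i c ∈ coeffIn J (F.ι i)) :
    (F.cone hz hreg).IsBdry J (i + 1) (F.coneMk a b) := by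
  have h : F.coneMk a b - F.coneD z (i + 1) (F.coneMk f c) ∈
      coeffIn J (F.ι (i + 1) ⊕ F.prevι (i + 1)) := by
    rw [coneD_coneMk_succ, coneMk, coneMk, ← map_sub, Prod.mk_sub_mk, sub_neg_eq_add]
    exact F.coneMk_mem_coeffIn_iff.2 ⟨h1, h2⟩
  exact ⟨F.coneMk f c, h⟩

theorem exists_of_cone_isBdry_succ (hJ : J.IsHomogeneous (polyPiece K n m)) {i : ℕ} {d : ℤ × ℤ}
    {a : F.ι (i + 1) →₀ Poly K n m} {b : F.ι i →₀ Poly K n m}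
    (ha : a ∈ freePiece (K := K) (F.deg (i + 1)) d)
    (hb : b ∈ freePiece (K := K) (F.deg i) (d - e))
    (h : (F.cone hz hreg).IsBdry J (i + 1) (F.coneMk a b)) :
    ∃ f, ∃ c ∈ freePiece (K := K) (F.deg (i + 1)) (d - e),
      a - (F.d (i + 1) f + z • c) ∈ coeffIn J (F.ι (i + 1)) ∧
      b + F.d i c ∈ coeffIn J (F.ι i) := by
  obtain ⟨y, hy, hyx⟩ := h.homogeneous hJ
    (show _ ∈ freePiece (K := K) (F.coneDeg e (i + 1)) d from
      F.coneMk_mem_freePiece_iff.2 ⟨ha, hb⟩)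
  obtain ⟨f, c, rfl⟩ := F.exists_coneMk y
  refine ⟨f, c, (F.coneMk_mem_freePiece_iff.1 hy).2, ?_⟩
  change F.coneMk a b - F.coneD z (i + 1) (F.coneMk f c) ∈
      coeffIn J (F.ι (i + 1) ⊕ F.prevι (i + 1)) at hyx
  rw [coneD_coneMk_succ, coneMk, coneMk, ← map_sub, Prod.mk_sub_mk, sub_neg_eq_add] at hyx
  exact F.coneMk_mem_coeffIn_iff.1 hyx

/-- `H_0` of the cone is a quotient of `H_0` of `F`. -/
theorem van_cone_zero {d : ℤ × ℤ} (h : F.Van J 0 d) : (F.cone hz hreg).Van J 0 d := by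
  intro x hx _
  obtain ⟨a, b, rfl⟩ := F.exists_coneEquiv_symm x
  obtain ⟨f, hf⟩ := h a (F.cone_mem_freePiece_iff.1 hx).1 (isCycle_zero a)
  refine ⟨F.coneMk f 0, ?_⟩
  change (F.coneEquiv 0).symm (a, b) - F.coneD z 0 (F.coneMk f 0) ∈ coeffIn J (F.ι 0 ⊕ F.prevι 0)
  rw [coneD_coneMk, smul_zero, add_zero, ← map_sub, Prod.mk_sub_mk]
  exact F.cone_mem_coeffIn_iff.2 ⟨hf, fun j => PEmpty.elim j⟩

/-- Exactness of `H_{i+1}(F)_d → H_{i+1}(cone)_d → H_i(F)_{d-e} → H_i(F)_d`, where the last map is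
multiplication by `z`: the first term is zero by `h` and the last map is injective by `hinj`. -/
theorem van_cone_succ (hJ : J.IsHomogeneous (polyPiece K n m)) {i : ℕ} {d : ℤ × ℤ}
    (hinj : ∀ b ∈ freePiece (K := K) (F.deg i) (d - e), F.IsCycle J i b →
      F.IsBdry J i (z • b) → F.IsBdry J i b)
    (h : F.Van J (i + 1) d) : (F.cone hz hreg).Van J (i + 1) d := by
  intro x hx hc
  obtain ⟨a, b, rfl⟩ := F.exists_coneMk x
  obtain ⟨ha, hb⟩ := F.coneMk_mem_freePiece_iff.1 hx
  obtain ⟨h1, h2⟩ := (cone_isCycle_iff hz hreg).1 hc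
  obtain ⟨c, hc, hbc⟩ := (hinj b hb h2 ⟨-a, by rwa [map_neg, sub_neg_eq_add, add_comm]⟩).homogeneous
    hJ hb
  have hzc := smul_freePiece (F.deg (i + 1)) hz hc
  rw [add_sub_cancel] at hzc
  obtain ⟨f, hf⟩ := h (a + z • c) (add_mem ha hzc) (by
    change F.d i _ ∈ coeffIn J (F.ι i)
    have h3 := sub_mem h1 (Submodule.smul_mem _ z hbc)
    rwa [smul_sub, add_sub_assoc, sub_sub_cancel, ← map_smul, ← map_add] at h3)
  refine cone_isBdry_succ hz hreg f (-c) ?_ (by rwa [map_neg, ← sub_eq_add_neg])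
  rwa [smul_neg, sub_add_eq_sub_sub, sub_neg_eq_add, sub_add_eq_add_sub]

/-- The same sequence at `H_i(F)_{d-e}`: if `d a = z b` modulo `J`, then `(-a, b)` is a cycle of the
cone, and once it is a boundary so is `b`. -/
theorem isBdry_of_smul_of_van_cone (hJ : J.IsHomogeneous (polyPiece K n m)) {i : ℕ} {d : ℤ × ℤ}
    (h : (F.cone hz hreg).Van J (i + 1) d) {b} (hb : b ∈ freePiece (K := K) (F.deg i) (d - e))
    (hc : F.IsCycle J i b) (hzb : F.IsBdry J i (z • b)) : F.IsBdry J i b := by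
  have h0 := smul_freePiece (F.deg i) hz hb
  rw [add_sub_cancel] at h0
  obtain ⟨a, ha, hab⟩ := hzb.homogeneous hJ h0
  have h1 := h (F.coneMk (-a) b) (F.coneMk_mem_freePiece_iff.2 ⟨neg_mem ha, hb⟩)
    ((cone_isCycle_iff hz hreg).2 ⟨by rwa [map_neg, neg_add_eq_sub], hc⟩)
  obtain ⟨f, c, -, -, h2⟩ := exists_of_cone_isBdry_succ hz hreg hJ (neg_mem ha) hb h1
  exact ⟨-c, by rwa [map_neg, sub_neg_eq_add]⟩

/-- If `H_i(cone)_d = 0`, then `H_i(F)_d = z H_i(F)_{d-e}`. The factor `c` is homogeneous of smaller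
bidegree, which is what an induction on the bidegree needs. -/
theorem exists_smul_of_van_cone (hJ : J.IsHomogeneous (polyPiece K n m)) {i : ℕ} {d : ℤ × ℤ}
    (h : (F.cone hz hreg).Van J i d) {x} (hx : x ∈ freePiece (K := K) (F.deg i) d)
    (hc : F.IsCycle J i x) : ∃ c ∈ freePiece (K := K) (F.deg i) (d - e), F.IsCycle J i c ∧
      F.IsBdry J i (x - z • c) := by
  cases i with
  | zero =>
    have h0 : (F.coneEquiv 0).symm (x, 0) ∈ freePiece (K := K) (F.coneDeg e 0) d :=
      F.cone_mem_freePiece_iff.2 ⟨hx, zero_mem _⟩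
    obtain ⟨y, hy, hyx⟩ := (h _ h0 (isCycle_zero _)).homogeneous hJ h0
    obtain ⟨f, c, rfl⟩ := F.exists_coneMk y
    refine ⟨c, (F.coneMk_mem_freePiece_iff.1 hy).2, isCycle_zero _, f, ?_⟩
    change (F.coneEquiv 0).symm (x, 0) - F.coneD z 0 (F.coneMk f c) ∈
      coeffIn J (F.ι 0 ⊕ F.prevι 0) at hyx
    rw [coneD_coneMk, ← map_sub, Prod.mk_sub_mk] at hyx
    rw [sub_sub, add_comm]
    exact (F.cone_mem_coeffIn_iff.1 hyx).1
  | succ i =>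
    obtain ⟨f, c, hcd, h1, h2⟩ := exists_of_cone_isBdry_succ hz hreg hJ hx (zero_mem _)
      (h (F.coneMk x 0) (F.coneMk_mem_freePiece_iff.2 ⟨hx, zero_mem _⟩)
        ((cone_isCycle_iff hz hreg).2 ⟨by rw [smul_zero, add_zero]; exact hc,
          by unfold IsCycle; rw [map_zero]; exact zero_mem _⟩))
    rw [zero_add] at h2
    exact ⟨c, hcd, h2, f, by rwa [sub_sub, add_comm (z • c)]⟩

/-- A homology class that is annihilated by a power of `w`. -/
theorem exists_pow_smul_cone (w : Poly K n m) {i : ℕ}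
    (hinj : ∀ b, F.IsCycle J i b → F.IsBdry J i (z • b) → ∃ k : ℕ, F.IsBdry J i (w ^ k • b))
    (h : ∀ a, F.IsCycle J (i + 1) a → ∃ k : ℕ, F.IsBdry J (i + 1) (w ^ k • a)) (x)
    (hc : (F.cone hz hreg).IsCycle J (i + 1) x) :
    ∃ k : ℕ, (F.cone hz hreg).IsBdry J (i + 1) (w ^ k • x) := by
  obtain ⟨a, b, rfl⟩ := F.exists_coneMk x
  obtain ⟨h1, h2⟩ := (cone_isCycle_iff hz hreg).1 hc
  obtain ⟨k, c, hbc⟩ := hinj b h2 ⟨-a, by rwa [map_neg, sub_neg_eq_add, add_comm]⟩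
  -- `w ^ k` makes the second component a boundary; `w ^ l` then kills the class of the cycle that
  -- remains in the first component.
  obtain ⟨l, f, hf⟩ := h (w ^ k • a + z • c) (by
    change F.d i _ ∈ coeffIn J (F.ι i)
    have h3 := sub_mem (Submodule.smul_mem _ (w ^ k) h1) (Submodule.smul_mem _ z hbc)
    rw [smul_sub, smul_add, smul_comm (w ^ k) z b, add_sub_assoc, sub_sub_cancel] at h3
    rwa [map_add, map_smul, map_smul])
  refine ⟨l + k, ?_⟩
  have h4 : w ^ (l + k) • F.coneMk a b = F.coneMk (w ^ (l + k) • a) (w ^ (l + k) • b) := by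
    rw [coneMk, ← map_smul]; rfl
  have h5 : (F.cone hz hreg).IsBdry J (i + 1) (F.coneMk (w ^ (l + k) • a) (w ^ (l + k) • b)) := by
    refine cone_isBdry_succ hz hreg f (-(w ^ l • c)) ?_ ?_
    · rwa [smul_neg, sub_add_eq_sub_sub, sub_neg_eq_add, sub_add_eq_add_sub, pow_add, mul_smul,
        smul_comm z, ← smul_add]
    · rw [map_neg, ← sub_eq_add_neg, pow_add, mul_smul, map_smul, ← smul_sub]
      exact Submodule.smul_mem _ _ hbc
  rw [← h4] at h5
  exact h5

/-- `H_0` is `S/(J + I)`, so injectivity of `z` on it is a condition on the colon ideal `(J + I) :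
z`. -/
theorem isBdry_zero_iff (F : FreeResolution I) {x} {p : Poly K n m}
    (hp : F.aug x = Ideal.Quotient.mk I p) : F.IsBdry J 0 x ↔ p ∈ J ⊔ I := by
  constructor
  · rintro ⟨y, hy⟩
    have key : ∀ x ∈ coeffIn J (F.ι 0), ∃ q ∈ J, F.aug x = Ideal.Quotient.mk I q := by
      intro x hx
      choose q hq using fun j => Ideal.Quotient.mk_surjective (F.aug (Finsupp.single j 1))
      refine ⟨x.sum fun j c => c * q j, Submodule.sum_mem _ fun j _ => J.mul_mem_right _ (hx j), ?_⟩
      conv_lhs => rw [← Finsupp.sum_single x]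
      rw [Finsupp.sum, Finsupp.sum, map_sum, map_sum]
      refine Finset.sum_congr rfl fun j _ => ?_
      rw [← mul_one (x j), ← smul_eq_mul, ← Finsupp.smul_single, map_smul, ← hq, smul_eq_mul,
        mul_one, map_mul]
      rfl
    obtain ⟨q, hq, hqx⟩ := key _ hy
    rw [map_sub, F.exact_zero.apply_apply_eq_zero, sub_zero, hp] at hqx
    rw [← add_sub_cancel q p]
    exact Submodule.add_mem_sup hq (Ideal.Quotient.eq.1 hqx)
  · intro h
    obtain ⟨q, hq, r, hr, rfl⟩ := Submodule.mem_sup.1 h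
    obtain ⟨v, hv⟩ := F.aug_surjective 1
    obtain ⟨y, hy⟩ := (F.exact_zero (x - q • v)).1 (by
      rw [map_sub, map_smul, hv, smul_one_quotient, hp, map_add, Ideal.Quotient.eq_zero_iff_mem.2 hr,
        add_zero, sub_self])
    exact ⟨y, by rw [hy, sub_sub_cancel]; exact smul_mem_coeffIn hq v⟩

/-- All basis elements have nonnegative bidegrees. -/
def Nonneg (F : FreeResolution I) : Prop := ∀ i j, 0 ≤ F.deg i j

theorem Nonneg.cone (hF : F.Nonneg) (he : 0 ≤ e) : (F.cone hz hreg).Nonneg := by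
  rintro i (j | j)
  · exact hF i j
  · cases i with
    | zero => exact PEmpty.elim j
    | succ i => exact add_nonneg (hF i j) he

/-- The resolution of `S` over itself. -/
def trivial (K : Type u) [Field K] (n m : ℕ) : FreeResolution (⊥ : Ideal (Poly K n m)) where
  ι
    | 0 => PUnit
    | _ + 1 => PEmpty
  deg _ _ := 0
  d _ := 0
  aug := cyclicAug ⊥
  d_homogeneous i j := zero_mem _
  aug_homogeneous j := ⟨1, MvPolynomial.isWeightedHomogeneous_one K (varDeg n m),
    (cyclicAug_single ⊥ 1).symm⟩
  aug_surjective r := by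
    obtain ⟨p, rfl⟩ := Ideal.Quotient.mk_surjective r
    exact ⟨Finsupp.single PUnit.unit p, cyclicAug_single ⊥ p⟩
  exact_zero x := by
    obtain ⟨p, rfl⟩ : ∃ p, x = Finsupp.single PUnit.unit p :=
      ⟨x PUnit.unit, by ext j; cases j; simp⟩
    rw [cyclicAug_single, Ideal.Quotient.eq_zero_iff_mem, Ideal.mem_bot]
    constructor
    · rintro rfl
      exact ⟨0, by simp⟩
    · rintro ⟨y, hy⟩
      exact (Finsupp.single_eq_zero.1 hy.symm)
  exact_succ i x := iff_of_true rfl ⟨0, by ext j; exact PEmpty.elim j⟩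

theorem nonneg_trivial : (trivial K n m).Nonneg := fun _ _ => le_rfl

theorem isBdry_trivial_succ (i : ℕ) (x) : (trivial K n m).IsBdry J (i + 1) x :=
  ⟨0, fun j => PEmpty.elim j⟩

end FreeResolution

/-! ### Vanishing of Tor along a regular sequence of forms -/

/-- The bidegrees `e`, `e'` of the two kinds of variables, with the corresponding projections. -/
def IsSide (e e' : ℤ × ℤ) (π π' : ℤ × ℤ → ℤ) : Prop :=
  (e = (1, 0) ∧ e' = (0, 1) ∧ π = Prod.fst ∧ π' = Prod.snd) ∨
  (e = (0, 1) ∧ e' = (1, 0) ∧ π = Prod.snd ∧ π' = Prod.fst)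

namespace IsSide

variable {e e' : ℤ × ℤ} {π π' : ℤ × ℤ → ℤ} (hs : IsSide e e' π π')

include hs

theorem nonneg : 0 ≤ e := by
  rcases hs with ⟨rfl, -⟩ | ⟨rfl, -⟩ <;> simp [Prod.le_def]

theorem nonneg' : 0 ≤ e' := by
  rcases hs with ⟨-, rfl, -⟩ | ⟨-, rfl, -⟩ <;> simp [Prod.le_def]

theorem map_sub_left (d : ℤ × ℤ) : π (d - e) = π d - 1 := by
  rcases hs with ⟨rfl, -, rfl, -⟩ | ⟨rfl, -, rfl, -⟩ <;> simp

theorem map_add_left (d : ℤ × ℤ) : π (d + e) = π d + 1 := by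
  rcases hs with ⟨rfl, -, rfl, -⟩ | ⟨rfl, -, rfl, -⟩ <;> simp

theorem map_add_nsmul (d : ℤ × ℤ) (k : ℕ) : π (k • e + d) = k + π d := by
  rcases hs with ⟨rfl, -, rfl, -⟩ | ⟨rfl, -, rfl, -⟩ <;> simp

theorem map_sub_right (d : ℤ × ℤ) : π (d - e') = π d := by
  rcases hs with ⟨-, rfl, rfl, -⟩ | ⟨-, rfl, rfl, -⟩ <;> simp

theorem map_sub_right' (d : ℤ × ℤ) : π' (d - e') = π' d - 1 := by
  rcases hs with ⟨-, rfl, -, rfl⟩ | ⟨-, rfl, -, rfl⟩ <;> simp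

theorem varDeg_eq (s : Fin n ⊕ Fin m) : varDeg n m s = e ∨ varDeg n m s = e' := by
  rcases hs with ⟨rfl, rfl, -⟩ | ⟨rfl, rfl, -⟩ <;> rcases s with s | s <;> simp [varDeg]

theorem le_of_nonneg {d : ℤ × ℤ} (hd : 0 ≤ d) : 0 ≤ π' d := by
  rcases hs with ⟨-, -, -, rfl⟩ | ⟨-, -, -, rfl⟩
  · exact hd.2
  · exact hd.1

end IsSide

/-- `Tor_i(S / J, S / I)_d = 0`. -/
def TorVan (I J : Ideal (Poly K n m)) (i : ℕ) (d : ℤ × ℤ) : Prop :=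
  ∀ F : FreeResolution I, F.Van J i d

/-- `I` is bigraded and `S / I` has a resolution by bigraded free modules with generators of
nonnegative bidegrees. -/
def HasNonneg (I : Ideal (Poly K n m)) : Prop :=
  I.IsHomogeneous (polyPiece K n m) ∧ ∃ F : FreeResolution I, F.Nonneg

theorem isHomogeneous_sup_span {I : Ideal (Poly K n m)} (hI : I.IsHomogeneous (polyPiece K n m))
    {z : Poly K n m} {e : ℤ × ℤ} (hz : z ∈ polyPiece K n m e) :
    (I ⊔ Ideal.span {z}).IsHomogeneous (polyPiece K n m) := by
  refine hI.sup (Ideal.homogeneous_span _ _ ?_)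
  rintro _ rfl
  exact ⟨e, hz⟩

theorem HasNonneg.sup_span {I : Ideal (Poly K n m)} (hI : HasNonneg I) {z : Poly K n m}
    {e : ℤ × ℤ} (hz : z ∈ polyPiece K n m e) (hreg : ∀ p, z * p ∈ I → p ∈ I) (he : 0 ≤ e) :
    HasNonneg (I ⊔ Ideal.span {z}) := by
  obtain ⟨h, F, hF⟩ := hI
  exact ⟨isHomogeneous_sup_span h hz, F.cone hz hreg, hF.cone hz hreg he⟩

theorem mul_mem_iff_isBdry {I J : Ideal (Poly K n m)} (F : FreeResolution I) {z p : Poly K n m} {b}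
    (hp : F.aug b = Ideal.Quotient.mk I p) : F.IsBdry J 0 (z • b) ↔ z * p ∈ J ⊔ I :=
  F.isBdry_zero_iff (by rw [map_smul, hp, map_mul]; rfl)

/-! ### One step: from `I` to `I + (z)` -/

section

variable {e e' : ℤ × ℤ} {π π' : ℤ × ℤ → ℤ} {I J : Ideal (Poly K n m)} {z : Poly K n m}

/-- By `van_cone_succ` the obstruction is the kernel of `z` on `H_i(F)_{d-e}`. Since `π (d - e) = π
d - 1 > i`, this homology is zero for `i ≥ 1`, and for `i = 0` the kernel vanishes by the colon
condition. -/
theorem torVan_sup_span (hs : IsSide e e' π π') (hJ : J.IsHomogeneous (polyPiece K n m))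
    (hI : HasNonneg I) (hz : z ∈ polyPiece K n m e) (hreg : ∀ p, z * p ∈ I → p ∈ I)
    (hcol : ∀ d, 1 ≤ π d → ∀ p ∈ polyPiece K n m d, z * p ∈ J ⊔ I → p ∈ J ⊔ I)
    (h : ∀ (i : ℕ) d, ((i + 1 : ℕ) : ℤ) < π d → TorVan I J (i + 1) d) (i : ℕ) (d : ℤ × ℤ)
    (hd : ((i + 1 : ℕ) : ℤ) < π d) : TorVan (I ⊔ Ideal.span {z}) J (i + 1) d := by
  intro G
  obtain ⟨hI, F, -⟩ := hI
  refine FreeResolution.Van.of_resolution (G := F.cone hz hreg) (isHomogeneous_sup_span hI hz) ?_ G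
  refine F.van_cone_succ hz hreg hJ (fun b hb hc hzb => ?_) (h i d hd F)
  have hd' := hs.map_sub_left d
  cases i with
  | zero =>
    obtain ⟨p, hp, hpa⟩ := F.aug_mem hb
    exact (F.isBdry_zero_iff hpa.symm).2 (hcol _ (by push_cast at hd; omega) p hp
      ((mul_mem_iff_isBdry F hpa.symm).1 hzb))
  | succ i => exact h i _ (by push_cast at hd ⊢; omega) F b hb hc

/-- Multiplication by a form of bidegree `e'` stays inside the range `π d > i`. If the cone has no
homology there, then `H_i(F)_d = z H_i(F)_{d-e'}`, and repeating this lowers `π' d` until the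
bidegree is one where `F` is zero. -/
theorem torVan_sup_span_right_iff (hs : IsSide e e' π π') (hJ : J.IsHomogeneous (polyPiece K n m))
    (hI : HasNonneg I) (hz : z ∈ polyPiece K n m e') (hreg : ∀ p, z * p ∈ I → p ∈ I) :
    (∀ (i : ℕ) d, (i : ℤ) < π d → TorVan (I ⊔ Ideal.span {z}) J i d) ↔
      ∀ (i : ℕ) d, (i : ℤ) < π d → TorVan I J i d := by
  obtain ⟨hI, F, hF⟩ := hI
  constructor
  · intro h i
    suffices H : ∀ (k : ℕ) d, (i : ℤ) < π d → π' d < k → F.Van J i d by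
      intro d hd G
      exact (H (π' d).toNat.succ d hd (by push_cast; omega)).of_resolution hI G
    intro k
    induction k with
    | zero =>
      intro d _ hd x hx _
      have : x = 0 := by
        ext1 j
        by_contra hne
        obtain ⟨s, hs'⟩ := MvPolynomial.ne_zero_iff.1 hne
        have h1 := hx j hs'
        have h2 : (0 : ℤ × ℤ) ≤ Finsupp.weight (varDeg n m) s := by
          rw [Finsupp.weight_apply]
          refine Finset.sum_nonneg fun t _ => nsmul_nonneg ?_ _
          rcases hs.varDeg_eq t with h | h <;> rw [h]
          exacts [hs.nonneg, hs.nonneg']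
        rw [h1] at h2
        have h3 : 0 ≤ d := (hF i j).trans (sub_nonneg.1 h2)
        exact absurd (hs.le_of_nonneg h3) (by simpa using hd)
      rw [this]
      exact F.isBdry_of_mem (zero_mem _)
    | succ k ih =>
      intro d hd hk x hx hc
      obtain ⟨c, hc1, hc2, hc3⟩ := F.exists_smul_of_van_cone hz hreg hJ (h i d hd _) hx hc
      have h1 := ih (d - e') (by rwa [hs.map_sub_right]) (by
        rw [hs.map_sub_right']; push_cast at hk; omega) c hc1 hc2
      have h2 := hc3.add (h1.smul z)
      rwa [sub_add_cancel] at h2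
  · intro h i d hd G
    refine FreeResolution.Van.of_resolution (G := F.cone hz hreg) (isHomogeneous_sup_span hI hz) ?_ G
    cases i with
    | zero => exact F.van_cone_zero hz hreg (h 0 d hd F)
    | succ i =>
      refine F.van_cone_succ hz hreg hJ (fun b hb hc _ => ?_) (h _ d hd F)
      exact h i _ (by rw [hs.map_sub_right]; push_cast at hd; omega) F b hb hc

/-- The homology of `S / J ⊗ F` in positive degrees is annihilated by powers of the forms of
bidegree `e`. -/
def IsTorsion (e : ℤ × ℤ) (J : Ideal (Poly K n m)) (F : FreeResolution I) : Prop :=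
  ∀ i x, F.IsCycle J (i + 1) x → ∀ w ∈ polyPiece K n m e, ∃ k : ℕ, F.IsBdry J (i + 1) (w ^ k • x)

theorem IsTorsion.cone {F : FreeResolution I} (hF : IsTorsion e J F)
    (hz : z ∈ polyPiece K n m e) (hreg : ∀ p, z * p ∈ I → p ∈ I)
    (htors : ∀ p, z * p ∈ J ⊔ I → ∀ w ∈ polyPiece K n m e, ∃ k : ℕ, w ^ k * p ∈ J ⊔ I) :
    IsTorsion e J (F.cone hz hreg) := by
  intro i x hx w hw
  refine F.exists_pow_smul_cone hz hreg w (fun b hb hzb => ?_) (fun a ha => hF i a ha w hw) x hx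
  cases i with
  | zero =>
    obtain ⟨p, hp⟩ := Ideal.Quotient.mk_surjective (F.aug b)
    obtain ⟨k, hk⟩ := htors p ((mul_mem_iff_isBdry F hp.symm).1 hzb) w hw
    exact ⟨k, (mul_mem_iff_isBdry F hp.symm).2 hk⟩
  | succ i => exact hF i b hb w hw

theorem pow_smul_mem_freePiece {ι : Type u} (deg : ι → ℤ × ℤ) {e d : ℤ × ℤ} {p : Poly K n m}
    {x : ι →₀ Poly K n m} (hp : p ∈ polyPiece K n m e) (hx : x ∈ freePiece (K := K) deg d)
    (k : ℕ) : p ^ k • x ∈ freePiece (K := K) deg (k • e + d) :=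
  smul_freePiece deg (SetLike.pow_mem_graded k hp) hx

/-- Vanishing of `H_{i+2}(cone)` makes `z` injective on `H_{i+1}(F)` in all bidegrees with `π > i +
1`, a range stable under `z`. A class killed by a power of `z` is therefore zero. -/
theorem torVan_of_sup_span (hs : IsSide e e' π π') (hJ : J.IsHomogeneous (polyPiece K n m))
    (hI : I.IsHomogeneous (polyPiece K n m)) {F : FreeResolution I} (hF : IsTorsion e J F)
    (hz : z ∈ polyPiece K n m e) (hreg : ∀ p, z * p ∈ I → p ∈ I)
    (h : ∀ (i : ℕ) d, ((i + 1 : ℕ) : ℤ) < π d → TorVan (I ⊔ Ideal.span {z}) J (i + 1) d)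
    (i : ℕ) (d : ℤ × ℤ) (hd : ((i + 1 : ℕ) : ℤ) < π d) : TorVan I J (i + 1) d := by
  refine fun G => FreeResolution.Van.of_resolution (G := F) hI (fun x hx hc => ?_) G
  obtain ⟨k, hk⟩ := hF i x hc z hz
  induction k with
  | zero => simpa using hk
  | succ k ih =>
    refine ih (F.isBdry_of_smul_of_van_cone hz hreg hJ (h (i + 1) (k • e + d + e) ?_ _) ?_
      (hc.smul _) ?_)
    · rw [hs.map_add_left, hs.map_add_nsmul]; push_cast at hd ⊢; omega
    · rw [add_sub_cancel_right]
      exact pow_smul_mem_freePiece _ hz hx k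
    · rwa [smul_smul, ← pow_succ']

/-- `H_1(cone)_{d+e} = 0` makes `z` injective on `H_0(F)_d = (S/(J + I))_d`. -/
theorem mem_sup_of_mul_mem_of_torVan (hJ : J.IsHomogeneous (polyPiece K n m)) (hI : HasNonneg I)
    (hz : z ∈ polyPiece K n m e) (hreg : ∀ p, z * p ∈ I → p ∈ I) {d : ℤ × ℤ}
    (h : TorVan (I ⊔ Ideal.span {z}) J 1 (d + e)) {p : Poly K n m} (hp : p ∈ polyPiece K n m d)
    (hzp : z * p ∈ J ⊔ I) : p ∈ J ⊔ I := by
  obtain ⟨hI, F, -⟩ := hI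
  obtain ⟨b, hb, hba⟩ := F.exists_aug_eq hI hp
  rw [← F.isBdry_zero_iff hba]
  exact F.isBdry_of_smul_of_van_cone hz hreg hJ (h _) (by rwa [add_sub_cancel_right])
    (FreeResolution.isCycle_zero b) ((mul_mem_iff_isBdry F hba).2 hzp)

end

/-- The ideal generated by the first `j` elements of the sequence `u`. -/
def initIdeal {A : Type u} [CommRing A] {N : ℕ} (u : Fin N → A) (j : ℕ) : Ideal A :=
  Ideal.span (u '' {k | (k : ℕ) < j})

theorem initIdeal_zero {A : Type u} [CommRing A] {N : ℕ} (u : Fin N → A) : initIdeal u 0 = ⊥ := by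
  simp [initIdeal]

theorem initIdeal_succ {A : Type u} [CommRing A] {N : ℕ} (u : Fin N → A) (j : Fin N) :
    initIdeal u (j + 1) = initIdeal u j ⊔ Ideal.span {u j} := by
  rw [initIdeal, initIdeal, ← Ideal.span_union, ← Set.image_singleton, ← Set.image_union]
  congr 2
  ext k
  simp only [Set.mem_ofPred_eq, Set.mem_union, Set.mem_singleton_iff, Fin.ext_iff]
  omega

theorem initIdeal_of_le {A : Type u} [CommRing A] {N j : ℕ} (u : Fin N → A) (h : N ≤ j) :
    initIdeal u j = Ideal.span (Set.range u) := by
  rw [initIdeal, ← Set.image_univ]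
  congr 2
  ext k
  simpa using k.2.trans_le h

/-! ### Induction along a regular sequence of forms -/

section

variable {e e' : ℤ × ℤ} {π π' : ℤ × ℤ → ℤ} {J : Ideal (Poly K n m)} {N : ℕ}
  {u : Fin N → Poly K n m}

theorem hasNonneg_initIdeal (he : 0 ≤ e) (hu : ∀ k, u k ∈ polyPiece K n m e)
    (hreg : ∀ (j : Fin N) p, u j * p ∈ initIdeal u j → p ∈ initIdeal u j) (j : ℕ) (hj : j ≤ N) :
    HasNonneg (initIdeal u j) := by
  induction j with
  | zero =>
    rw [initIdeal_zero]
    exact ⟨Ideal.IsHomogeneous.bot _, .trivial K n m, FreeResolution.nonneg_trivial⟩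
  | succ j ih =>
    rw [initIdeal_succ u ⟨j, hj⟩]
    exact (ih (by omega)).sup_span (hu ⟨j, hj⟩) (hreg ⟨j, hj⟩) he

theorem torVan_initIdeal (hs : IsSide e e' π π') (hJ : J.IsHomogeneous (polyPiece K n m))
    (hu : ∀ k, u k ∈ polyPiece K n m e)
    (hreg : ∀ (j : Fin N) p, u j * p ∈ initIdeal u j → p ∈ initIdeal u j)
    (hcol : ∀ (j : Fin N) d, 1 ≤ π d → ∀ p ∈ polyPiece K n m d,
      u j * p ∈ J ⊔ initIdeal u j → p ∈ J ⊔ initIdeal u j) (j : ℕ) (hj : j ≤ N) :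
    ∀ (i : ℕ) d, ((i + 1 : ℕ) : ℤ) < π d → TorVan (initIdeal u j) J (i + 1) d := by
  induction j with
  | zero =>
    intro i d _
    rw [initIdeal_zero]
    exact FreeResolution.Van.of_resolution (G := .trivial K n m) (Ideal.IsHomogeneous.bot _)
      fun x _ _ => FreeResolution.isBdry_trivial_succ i x
  | succ j ih =>
    rw [initIdeal_succ u ⟨j, hj⟩]
    exact torVan_sup_span hs hJ (hasNonneg_initIdeal hs.nonneg hu hreg j (by omega)) (hu ⟨j, hj⟩)
      (hreg ⟨j, hj⟩) (hcol ⟨j, hj⟩) (ih (by omega))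

theorem exists_isTorsion_initIdeal (hu : ∀ k, u k ∈ polyPiece K n m e)
    (hreg : ∀ (j : Fin N) p, u j * p ∈ initIdeal u j → p ∈ initIdeal u j)
    (htors : ∀ (j : Fin N) p, u j * p ∈ J ⊔ initIdeal u j → ∀ w ∈ polyPiece K n m e,
      ∃ k : ℕ, w ^ k * p ∈ J ⊔ initIdeal u j) (j : ℕ) (hj : j ≤ N) :
    ∃ F : FreeResolution (initIdeal u j), IsTorsion e J F := by
  induction j with
  | zero =>
    rw [initIdeal_zero]
    exact ⟨.trivial K n m, fun i x _ w _ => ⟨0, FreeResolution.isBdry_trivial_succ i _⟩⟩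
  | succ j ih =>
    rw [initIdeal_succ u ⟨j, hj⟩]
    obtain ⟨F, hF⟩ := ih (by omega)
    exact ⟨F.cone (hu ⟨j, hj⟩) (hreg ⟨j, hj⟩), hF.cone _ _ (htors ⟨j, hj⟩)⟩

theorem torVan_initIdeal_of_last (hs : IsSide e e' π π') (hJ : J.IsHomogeneous (polyPiece K n m))
    (hu : ∀ k, u k ∈ polyPiece K n m e)
    (hreg : ∀ (j : Fin N) p, u j * p ∈ initIdeal u j → p ∈ initIdeal u j)
    (htors : ∀ (j : Fin N) p, u j * p ∈ J ⊔ initIdeal u j → ∀ w ∈ polyPiece K n m e,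
      ∃ k : ℕ, w ^ k * p ∈ J ⊔ initIdeal u j)
    (h : ∀ (i : ℕ) d, ((i + 1 : ℕ) : ℤ) < π d → TorVan (initIdeal u N) J (i + 1) d)
    (j : ℕ) (hj : j ≤ N) :
    ∀ (i : ℕ) d, ((i + 1 : ℕ) : ℤ) < π d → TorVan (initIdeal u j) J (i + 1) d := by
  induction hj using Nat.decreasingInduction with
  | self => exact h
  | of_succ j hj ih =>
    obtain ⟨F, hF⟩ := exists_isTorsion_initIdeal hu hreg htors j hj.le
    rw [initIdeal_succ u ⟨j, hj⟩] at ih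
    exact torVan_of_sup_span hs hJ (hasNonneg_initIdeal hs.nonneg hu hreg j hj.le).1 hF
      (hu ⟨j, hj⟩) (hreg ⟨j, hj⟩) ih

theorem mem_of_mul_mem_of_torVan (hs : IsSide e e' π π') (hJ : J.IsHomogeneous (polyPiece K n m))
    (hu : ∀ k, u k ∈ polyPiece K n m e)
    (hreg : ∀ (j : Fin N) p, u j * p ∈ initIdeal u j → p ∈ initIdeal u j)
    (htors : ∀ (j : Fin N) p, u j * p ∈ J ⊔ initIdeal u j → ∀ w ∈ polyPiece K n m e,
      ∃ k : ℕ, w ^ k * p ∈ J ⊔ initIdeal u j)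
    (h : ∀ (i : ℕ) d, ((i + 1 : ℕ) : ℤ) < π d → TorVan (initIdeal u N) J (i + 1) d)
    (j : Fin N) (d : ℤ × ℤ) (hd : 1 ≤ π d) (p : Poly K n m) (hp : p ∈ polyPiece K n m d)
    (hup : u j * p ∈ J ⊔ initIdeal u j) : p ∈ J ⊔ initIdeal u j := by
  have h1 := torVan_initIdeal_of_last hs hJ hu hreg htors h (j + 1) j.2 0 (d + e)
    (by rw [hs.map_add_left]; push_cast; omega)
  rw [initIdeal_succ] at h1
  exact mem_sup_of_mul_mem_of_torVan hJ (hasNonneg_initIdeal hs.nonneg hu hreg j j.2.le) (hu j)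
    (hreg j) h1 hp hup

end

/-! ### Forms of bidegree `e` and coordinate changes -/

/-- The kernels of the powers of `f` become stationary at some `k`. An element of the kernel of `f`
has the form `f ^ k y`, so `y` lies in the kernel of `f ^ (k + 1)`, which is that of `f ^ k`. -/
theorem injective_of_surjective_ringHom {A : Type u} [CommRing A] [IsNoetherianRing A] (f : A →+* A)
    (hf : Function.Surjective f) : Function.Injective f := by
  have hiter : ∀ k : ℕ, Function.Surjective (f ^ k : A →+* A) := by
    intro k
    rw [RingHom.coe_pow]
    exact hf.iterate k
  obtain ⟨k, hk⟩ := monotone_stabilizes_iff_noetherian.2 (inferInstance : IsNoetherian A A)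
    ⟨fun k => RingHom.ker (f ^ k), monotone_nat_of_le_succ fun k x hx => by
      rw [RingHom.mem_ker] at hx ⊢
      rw [pow_succ', RingHom.mul_def, RingHom.comp_apply, hx, map_zero]⟩
  rw [injective_iff_map_eq_zero]
  intro x hx
  obtain ⟨y, rfl⟩ := hiter k x
  have h1 : y ∈ RingHom.ker (f ^ (k + 1)) := by
    rw [RingHom.mem_ker, pow_succ', RingHom.mul_def, RingHom.comp_apply, hx]
  have h2 : RingHom.ker (f ^ k) = RingHom.ker (f ^ (k + 1)) := hk (k + 1) (Nat.le_succ k)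
  rw [← h2] at h1
  exact h1

theorem weight_fst_add_snd (s : Fin n ⊕ Fin m →₀ ℕ) :
    (Finsupp.weight (varDeg n m) s).1 + (Finsupp.weight (varDeg n m) s).2 = (s.degree : ℤ) := by
  rw [Finsupp.weight_apply, Finsupp.sum, Prod.fst_sum, Prod.snd_sum, ← Finset.sum_add_distrib,
    Finsupp.degree_apply, Nat.cast_sum]
  refine Finset.sum_congr rfl fun t _ => ?_
  rcases t with t | t <;> simp [varDeg]

theorem finite_weight_eq (n m : ℕ) (d : ℤ × ℤ) :
    {s : Fin n ⊕ Fin m →₀ ℕ | Finsupp.weight (varDeg n m) s = d}.Finite := by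
  refine (Finsupp.finite_of_degree_le (d.1 + d.2).toNat).subset fun s hs => ?_
  have := weight_fst_add_snd s
  rw [Set.mem_ofPred_eq] at hs
  rw [hs] at this
  simp only [Set.mem_ofPred_eq]
  omega

instance finite_polyPiece (d : ℤ × ℤ) : Module.Finite K (polyPiece K n m d) := by
  rw [polyPiece, MvPolynomial.weightedHomogeneousSubmodule_eq_finsupp_supported]
  have := (finite_weight_eq n m d).to_subtype
  exact Module.Finite.of_basis
    (MvPolynomial.basisRestrictSupport K {s | Finsupp.weight (varDeg n m) s = d})

theorem X_mem_polyPiece (s : Fin n ⊕ Fin m) : (MvPolynomial.X s : Poly K n m) ∈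
    polyPiece K n m (varDeg n m s) := MvPolynomial.isWeightedHomogeneous_X K (varDeg n m) s

section

variable {e e' : ℤ × ℤ} {π π' : ℤ × ℤ → ℤ} (hs : IsSide e e' π π')

include hs

theorem IsSide.ne : e ≠ e' := by
  rcases hs with ⟨rfl, rfl, -⟩ | ⟨rfl, rfl, -⟩ <;> simp

/-- A monomial free of variables of bidegree `e` has a multiple of `e'` as bidegree, and `π` is zero
on it. -/
theorem mem_span_X_of_mem_polyPiece {d : ℤ × ℤ} (hd : 1 ≤ π d) {p : Poly K n m}
    (hp : p ∈ polyPiece K n m d) :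
    p ∈ Ideal.span (MvPolynomial.X '' {s : Fin n ⊕ Fin m | varDeg n m s = e}) := by
  rw [MvPolynomial.mem_ideal_span_X_image]
  intro s hsp
  have h1 : Finsupp.weight (varDeg n m) s = d := hp (MvPolynomial.mem_support_iff.1 hsp)
  by_contra! hne
  have hterm : ∀ t, s t • varDeg n m t = s t • e' := by
    intro t
    rcases hs.varDeg_eq t with h | h
    · rw [hne t h, zero_smul, zero_smul]
    · rw [h]
  rw [Finsupp.weight_apply, Finsupp.sum, Finset.sum_congr rfl fun t _ => hterm t,
    ← Finset.sum_smul] at h1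
  rw [← h1] at hd
  rcases hs with ⟨-, rfl, rfl, -⟩ | ⟨-, rfl, rfl, -⟩ <;> simp at hd

theorem span_X_eq_polyPiece :
    Submodule.span K (Set.range fun s : {s : Fin n ⊕ Fin m // varDeg n m s = e} =>
      (MvPolynomial.X s.1 : Poly K n m)) = polyPiece K n m e := by
  apply le_antisymm
  · rw [Submodule.span_le]
    rintro _ ⟨s, rfl⟩
    have := X_mem_polyPiece (K := K) s.1
    rwa [s.2] at this
  · intro p hp
    rw [p.as_sum]
    refine Submodule.sum_mem _ fun s hsp => ?_
    have h1 : Finsupp.weight (varDeg n m) s = e := hp (MvPolynomial.mem_support_iff.1 hsp)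
    have h2 : s.degree = 1 := by
      have := weight_fst_add_snd s
      rw [h1] at this
      rcases hs with ⟨rfl, -⟩ | ⟨rfl, -⟩ <;> simpa using this.symm
    obtain ⟨t, rfl⟩ := (Finsupp.sum_eq_one_iff s).1 h2
    have ht : varDeg n m t = e := by simpa [Finsupp.weight_apply] using h1
    have : (MvPolynomial.monomial (Finsupp.single t 1) (p.coeff (Finsupp.single t 1)) : Poly K n m) =
        p.coeff (Finsupp.single t 1) • MvPolynomial.X t := by
      rw [MvPolynomial.X, MvPolynomial.smul_monomial, smul_eq_mul, mul_one]
    rw [this]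
    exact Submodule.smul_mem _ _ (Submodule.subset_span ⟨⟨t, ht⟩, rfl⟩)

theorem card_eq_of_span {N : ℕ} {u : Fin N → Poly K n m} (hli : LinearIndependent K u)
    (hspan : Submodule.span K (Set.range u) = polyPiece K n m e) :
    Nonempty (Fin N ≃ {s : Fin n ⊕ Fin m // varDeg n m s = e}) := by
  have h1 := finrank_span_eq_card hli
  have h2 := finrank_span_eq_card (R := K)
    ((MvPolynomial.linearIndependent_X (Fin n ⊕ Fin m) K).comp
      (Subtype.val : {s : Fin n ⊕ Fin m // varDeg n m s = e} → _) Subtype.val_injective)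
  have h3 := span_X_eq_polyPiece (K := K) (n := n) (m := m) hs
  change Module.finrank K (Submodule.span K (Set.range fun s : {s : Fin n ⊕ Fin m //
    varDeg n m s = e} => (MvPolynomial.X s.1 : Poly K n m))) = _ at h2
  rw [h3] at h2
  rw [hspan, h2] at h1
  exact Fintype.card_eq.1 h1.symm

theorem span_range_eq_span_X {N : ℕ} {u : Fin N → Poly K n m}
    (hspan : Submodule.span K (Set.range u) = polyPiece K n m e) :
    Ideal.span (Set.range u) =
      Ideal.span (MvPolynomial.X '' {s : Fin n ⊕ Fin m | varDeg n m s = e}) := by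
  have key : ∀ A : Set (Poly K n m), (Submodule.span K A : Set (Poly K n m)) ⊆ Ideal.span A := by
    intro A x hx
    exact Submodule.span_le_restrictScalars K (Poly K n m) A hx
  apply le_antisymm
  · rw [Ideal.span_le]
    have h1 := key (Set.range fun s : {s : Fin n ⊕ Fin m // varDeg n m s = e} =>
      (MvPolynomial.X s.1 : Poly K n m))
    rw [span_X_eq_polyPiece hs, ← hspan] at h1
    refine (Submodule.subset_span.trans h1).trans (Ideal.span_mono ?_)
    rintro _ ⟨s, rfl⟩
    exact ⟨s.1, s.2, rfl⟩
  · rw [Ideal.span_le]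
    rintro _ ⟨s, hs', rfl⟩
    refine key _ ?_
    have := X_mem_polyPiece (K := K) s
    rw [hs', ← hspan] at this
    exact this

end

/-- Membership in an ideal of variables is tested on each monomial, and multiplication by `X s`
changes no exponent of a variable in `T`. -/
theorem mem_span_X_of_X_mul_mem {T : Set (Fin n ⊕ Fin m)} {s : Fin n ⊕ Fin m} (hs : s ∉ T)
    {p : Poly K n m} (hp : MvPolynomial.X s * p ∈ Ideal.span (MvPolynomial.X '' T)) :
    p ∈ Ideal.span (MvPolynomial.X '' T) := by
  classical
  rw [MvPolynomial.mem_ideal_span_X_image] at hp ⊢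
  intro t ht
  obtain ⟨i, hi, hne⟩ := hp (Finsupp.single s 1 + t) (by
    rw [MvPolynomial.mem_support_iff, MvPolynomial.coeff_X_mul]
    exact MvPolynomial.mem_support_iff.1 ht)
  refine ⟨i, hi, ?_⟩
  rwa [Finsupp.add_apply, Finsupp.single_eq_of_ne (by rintro rfl; exact hs hi), zero_add] at hne

/-- A basis of the space of forms of bidegree `e` is a regular sequence on `S`. -/
theorem mem_initIdeal_of_mul_mem {e e' : ℤ × ℤ} {π π' : ℤ × ℤ → ℤ} (hs : IsSide e e' π π') {N : ℕ}
    {u : Fin N → Poly K n m} (hli : LinearIndependent K u)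
    (hspan : Submodule.span K (Set.range u) = polyPiece K n m e) (j : Fin N) (p : Poly K n m)
    (hp : u j * p ∈ initIdeal u j) : p ∈ initIdeal u j := by
  classical
  obtain ⟨ε⟩ := card_eq_of_span hs hli hspan
  let z : Fin n ⊕ Fin m → Poly K n m := fun s =>
    if h : varDeg n m s = e then u (ε.symm ⟨s, h⟩) else MvPolynomial.X s
  have hz : ∀ k, z (ε k) = u k := fun k => by simp [z, (ε k).2]
  -- The linear change of coordinates that sends variables of bidegree `e` to the `u k`. It is
  -- surjective as the `u k` span `S_e`, hence bijective, which reduces the claim to variables.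
  let Φ : Poly K n m →ₐ[K] Poly K n m := MvPolynomial.aeval z
  have hΦu : ∀ k, Φ (MvPolynomial.X (ε k : Fin n ⊕ Fin m)) = u k := fun k => by
    rw [MvPolynomial.aeval_X, hz]
  have hsurj : Function.Surjective Φ := by
    rw [← AlgHom.range_eq_top, ← top_le_iff, ← MvPolynomial.adjoin_range_X, Algebra.adjoin_le_iff]
    rintro _ ⟨s, rfl⟩
    by_cases h : varDeg n m s = e
    · have h1 := X_mem_polyPiece (K := K) s
      rw [h, ← hspan] at h1
      have h2 : Submodule.span K (Set.range u) ≤ Subalgebra.toSubmodule Φ.range := by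
        rw [Submodule.span_le]
        rintro _ ⟨k, rfl⟩
        exact ⟨_, hΦu k⟩
      exact h2 h1
    · exact ⟨MvPolynomial.X s, by simp [Φ, z, h]⟩
  have hinj : Function.Injective Φ := injective_of_surjective_ringHom Φ.toRingHom hsurj
  have hmap : initIdeal u j = Ideal.map Φ
      (Ideal.span (MvPolynomial.X '' ((fun k => (ε k : Fin n ⊕ Fin m)) '' {k | (k : ℕ) < j}))) := by
    rw [Ideal.map_span, Set.image_image, Set.image_image, initIdeal]
    congr 1
    exact Set.image_congr fun k _ => (hΦu k).symm
  obtain ⟨q, rfl⟩ := hsurj p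
  rw [hmap] at hp ⊢
  refine Ideal.mem_map_of_mem Φ (mem_span_X_of_X_mul_mem (s := ε j) ?_ ?_)
  · rintro ⟨k, hk, hkj⟩
    have : k = j := ε.injective (Subtype.val_injective hkj)
    exact absurd hk (by simp [this])
  · rw [← hΦu, ← map_mul] at hp
    have h3 := Ideal.mem_map_iff_of_surjective Φ hsurj |>.1 hp
    obtain ⟨r, hr, hrq⟩ := h3
    rwa [← hinj hrq]

/-! ### The regularity in terms of a basis of the forms of bidegree `e` -/

/-- `Tor_i(S / J, K)_d = 0` if the `π`-component of `d` is larger than `i`. -/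
def LinearTor (π : ℤ × ℤ → ℤ) (J : Ideal (Poly K n m)) : Prop :=
  ∀ (i : ℕ) d, (i : ℤ) < π d → TorVan (maxIdeal K n m) J i d

section

variable {e e' : ℤ × ℤ} {π π' : ℤ × ℤ → ℤ} (hs : IsSide e e' π π') {J : Ideal (Poly K n m)}
  (hJ : J.IsHomogeneous (polyPiece K n m)) {N : ℕ} {u : Fin N → Poly K n m}
  (hli : LinearIndependent K u) (hspan : Submodule.span K (Set.range u) = polyPiece K n m e)

include hspan in
theorem mem_polyPiece_of_span (k : Fin N) : u k ∈ polyPiece K n m e := by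
  rw [← hspan]
  exact Submodule.subset_span ⟨k, rfl⟩

include hs hJ hli hspan

/-- The `u k` generate the ideal of the variables of bidegree `e`. Those of bidegree `e'` are
adjoined one at a time, each step leaving the vanishing range unchanged, until the maximal ideal is
reached. -/
theorem linearTor_iff_initIdeal :
    LinearTor π J ↔ ∀ (i : ℕ) d, (i : ℤ) < π d → TorVan (initIdeal u N) J i d := by
  classical
  have hreg := mem_initIdeal_of_mul_mem hs hli hspan
  have hI := hasNonneg_initIdeal hs.nonneg (mem_polyPiece_of_span hspan) hreg N le_rfl
  rw [initIdeal_of_le u le_rfl, span_range_eq_span_X hs hspan] at hI ⊢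
  have key : ∀ T : Finset (Fin n ⊕ Fin m), (∀ s ∈ T, varDeg n m s = e') →
      HasNonneg (Ideal.span (MvPolynomial.X '' ({s | varDeg n m s = e} ∪ T)) :
        Ideal (Poly K n m)) ∧
      ((∀ (i : ℕ) d, (i : ℤ) < π d → TorVan (Ideal.span (MvPolynomial.X ''
        ({s | varDeg n m s = e} ∪ T))) J i d) ↔
        ∀ (i : ℕ) d, (i : ℤ) < π d → TorVan (Ideal.span (MvPolynomial.X ''
        {s | varDeg n m s = e})) J i d) := by
    intro T
    induction T using Finset.induction_on with
    | empty =>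
      intro _
      rw [Finset.coe_empty, Set.union_empty]
      exact ⟨hI, Iff.rfl⟩
    | insert s T hsT ih =>
      intro hT
      have hse : varDeg n m s = e' := hT s (Finset.mem_insert_self s T)
      obtain ⟨h1, h2⟩ := ih fun t ht => hT t (Finset.mem_insert_of_mem ht)
      have h3 : (Ideal.span (MvPolynomial.X '' ({s | varDeg n m s = e} ∪ ↑(insert s T))) :
          Ideal (Poly K n m)) = Ideal.span (MvPolynomial.X '' ({s | varDeg n m s = e} ∪ T)) ⊔
            Ideal.span {MvPolynomial.X s} := by
        rw [← Ideal.span_union, ← Set.image_singleton, ← Set.image_union, Set.union_assoc,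
          Finset.coe_insert, ← Set.union_singleton]
      have h4 := X_mem_polyPiece (K := K) s
      rw [hse] at h4
      have h5 : ∀ p : Poly K n m, MvPolynomial.X s * p ∈
          Ideal.span (MvPolynomial.X '' ({s | varDeg n m s = e} ∪ (T : Set (Fin n ⊕ Fin m)))) →
          p ∈ Ideal.span (MvPolynomial.X '' ({s | varDeg n m s = e} ∪ (T : Set (Fin n ⊕ Fin m)))) := by
        refine fun p => mem_span_X_of_X_mul_mem ?_
        rintro (h | h)
        · exact hs.ne (h.symm.trans hse)
        · exact hsT h
      rw [h3]
      exact ⟨h1.sup_span h4 h5 hs.nonneg', (torVan_sup_span_right_iff hs hJ h1 h4 h5).trans h2⟩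
  have h1 := (key (Finset.univ.filter fun s => varDeg n m s = e') (by simp)).2
  rw [← h1]
  have h2 : ({s | varDeg n m s = e} ∪ ↑(Finset.univ.filter fun s => varDeg n m s = e') :
      Set (Fin n ⊕ Fin m)) = Set.univ := by
    ext s
    simpa using hs.varDeg_eq s
  rw [h2, Set.image_univ]
  rfl

theorem linearTor_of_colon
    (hcol : ∀ (j : Fin N) d, 1 ≤ π d → ∀ p ∈ polyPiece K n m d,
      u j * p ∈ J ⊔ initIdeal u j → p ∈ J ⊔ initIdeal u j) : LinearTor π J := by
  have hreg := mem_initIdeal_of_mul_mem hs hli hspan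
  have hu := mem_polyPiece_of_span hspan
  rw [linearTor_iff_initIdeal hs hJ hli hspan]
  intro i d hd
  cases i with
  | zero =>
    -- `S/(J + (u))` lives in `π`-degree `0`, whereas here `π d > 0`.
    intro F x hx _
    obtain ⟨p, hp, hpa⟩ := F.aug_mem hx
    refine (F.isBdry_zero_iff hpa.symm).2 (le_sup_right (a := J) ?_)
    rw [initIdeal_of_le u le_rfl, span_range_eq_span_X hs hspan]
    exact mem_span_X_of_mem_polyPiece hs (by push_cast at hd; omega) hp
  | succ i => exact torVan_initIdeal hs hJ hu hreg hcol N le_rfl i d hd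

theorem colon_of_linearTor (h : LinearTor π J)
    (htors : ∀ (j : Fin N) p, u j * p ∈ J ⊔ initIdeal u j → ∀ w ∈ polyPiece K n m e,
      ∃ k : ℕ, w ^ k * p ∈ J ⊔ initIdeal u j)
    (j : Fin N) (d : ℤ × ℤ) (hd : 1 ≤ π d) (p : Poly K n m) (hp : p ∈ polyPiece K n m d)
    (hup : u j * p ∈ J ⊔ initIdeal u j) : p ∈ J ⊔ initIdeal u j := by
  rw [linearTor_iff_initIdeal hs hJ hli hspan] at h
  exact mem_of_mul_mem_of_torVan hs hJ (mem_polyPiece_of_span hspan)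
    (mem_initIdeal_of_mul_mem hs hli hspan) htors (fun i => h (i + 1)) j d hd p hp hup

end

/-! ### Hilbert functions in families of ideals -/

/-- Dickson's lemma: the minimal elements form an antichain, hence a finite set. -/
theorem exists_finite_basis_of_wellQuasiOrdered {α : Type*} [PartialOrder α] [WellQuasiOrderedLE α]
    (G : Set α) : ∃ B : Finset α, ↑B ⊆ G ∧ ∀ s ∈ G, ∃ b ∈ B, b ≤ s := by
  have hfin : {x | Minimal (· ∈ G) x}.Finite :=
    WellQuasiOrderedLE.finite_of_isAntichain (setOfPred_minimal_antichain _)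
  refine ⟨hfin.toFinset, fun x hx => (hfin.mem_toFinset.1 hx).1, fun s hs => ?_⟩
  obtain ⟨b, hb, hmin⟩ := exists_minimal_le_of_wellFoundedLT (· ∈ G) s hs
  exact ⟨b, hfin.mem_toFinset.2 hmin, hb⟩

theorem exists_monomialOrder (σ : Type) [Finite σ] : Nonempty (MonomialOrder.{0, 0} σ) := by
  obtain ⟨k, ⟨f⟩⟩ := Finite.exists_equiv_fin σ
  let _ : LinearOrder σ := LinearOrder.lift' f f.injective
  exact ⟨MonomialOrder.lex⟩

theorem map_weightedHomogeneousComponent {σ A B M : Type*} [CommRing A] [CommRing B]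
    [AddCommMonoid M] (w : σ → M) (f : A →+* B) (d : M) (p : MvPolynomial σ A) :
    MvPolynomial.map f (MvPolynomial.weightedHomogeneousComponent w d p) =
      MvPolynomial.weightedHomogeneousComponent w d (MvPolynomial.map f p) := by
  classical
  ext s
  simp only [MvPolynomial.coeff_map, MvPolynomial.coeff_weightedHomogeneousComponent]
  split_ifs <;> simp

/-- Polynomials with distinct leading monomials are linearly independent. -/
theorem linearIndependent_of_leading {σ ι : Type*} (mo : MonomialOrder σ) (lead : ι → σ →₀ ℕ)
    (hlead : Function.Injective lead) (q : ι → MvPolynomial σ K)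
    (h1 : ∀ i, (q i).coeff (lead i) ≠ 0)
    (h2 : ∀ i t, mo.toSyn (lead i) < mo.toSyn t → (q i).coeff t = 0) : LinearIndependent K q := by
  classical
  rw [linearIndependent_iff']
  intro s g hg
  by_contra! hne
  obtain ⟨i₀, hi₀, hgi₀⟩ := hne
  -- The largest leading monomial that occurs in the relation cannot cancel.
  obtain ⟨i, hi, hmax⟩ := Finset.exists_max_image (s.filter fun i => g i ≠ 0)
    (fun i => mo.toSyn (lead i)) ⟨i₀, by simp [hi₀, hgi₀]⟩
  rw [Finset.mem_filter] at hi
  have h := congrArg (MvPolynomial.coeff (lead i)) hg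
  rw [MvPolynomial.coeff_sum, Finset.sum_eq_single i, MvPolynomial.coeff_smul, smul_eq_mul,
    MvPolynomial.coeff_zero, mul_eq_zero] at h
  · exact h.elim hi.2 (h1 i)
  · intro j hj hji
    rw [MvPolynomial.coeff_smul, smul_eq_mul]
    by_cases hgj : g j = 0
    · rw [hgj, zero_mul]
    · rw [h2 j, mul_zero]
      refine lt_of_le_of_ne (hmax j (by simp [hj, hgj])) fun h => hji (hlead ?_)
      exact mo.toSyn.injective h
  · exact fun h => absurd hi.1 h

/-- Lifts of linearly independent polynomials are linearly independent. -/
theorem linearIndependent_of_map {σ A : Type*} [CommRing A] [IsDomain A] [Algebra K A]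
    (ev : A →ₐ[K] K) {k : ℕ} (F : Fin k → MvPolynomial σ A)
    (h : LinearIndependent K fun i => MvPolynomial.map (ev : A →+* K) (F i)) (a : Fin k → A)
    (ha : ∑ i, a i • F i = 0) : a = 0 := by
  obtain ⟨ψ, hψ⟩ := LinearMap.exists_leftInverse_of_injective
    (Fintype.linearCombination K fun i => MvPolynomial.map (ev : A →+* K) (F i))
    (LinearMap.ker_eq_bot.2 (linearIndependent_iff_injective_fintypeLinearCombination.1 h))
  -- `Ψ` extends the left inverse `ψ` to `A` with constant coefficients. The square matrix `M` of
  -- its values on the `F i` specializes to the identity, so its determinant is nonzero in the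
  -- domain `A`.
  let Ψ : MvPolynomial σ A →ₗ[A] (Fin k → A) := (MvPolynomial.basisMonomials σ A).constr A
    fun t j => algebraMap K A (ψ (MvPolynomial.monomial t 1) j)
  have hΨ : ∀ p j, ev (Ψ p j) = ψ (MvPolynomial.map (ev : A →+* K) p) j := by
    intro p j
    induction p using MvPolynomial.induction_on' with
    | monomial t c =>
      have h1 : (MvPolynomial.monomial t c : MvPolynomial σ A) =
          c • MvPolynomial.basisMonomials σ A t := by
        rw [MvPolynomial.coe_basisMonomials, MvPolynomial.smul_monomial, smul_eq_mul, mul_one]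
      have h2 : (MvPolynomial.monomial t (ev c) : MvPolynomial σ K) =
          ev c • MvPolynomial.monomial t 1 := by
        rw [MvPolynomial.smul_monomial, smul_eq_mul, mul_one]
      rw [MvPolynomial.map_monomial, RingHom.coe_coe, h2, h1, map_smul, map_smul,
        Module.Basis.constr_basis, Pi.smul_apply, Pi.smul_apply, smul_eq_mul, smul_eq_mul, map_mul,
        AlgHom.commutes]
      rfl
    | add p q hp hq => simp only [map_add, Pi.add_apply, hp, hq]
  let M : Matrix (Fin k) (Fin k) A := fun i j => Ψ (F i) j
  have hM : (ev : A →+* K).mapMatrix M = 1 := by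
    ext i j
    rw [RingHom.mapMatrix_apply, Matrix.map_apply, RingHom.coe_coe, hΨ]
    have h3 := LinearMap.congr_fun hψ (Pi.single i 1)
    rw [LinearMap.comp_apply, Fintype.linearCombination_apply_single, one_smul] at h3
    rw [h3, LinearMap.id_apply, Matrix.one_apply, Pi.single_apply]
    simp only [eq_comm]
  have hdet : M.det ≠ 0 := by
    intro h0
    have h4 := RingHom.map_det (ev : A →+* K) M
    rw [h0, hM, map_zero, Matrix.det_one] at h4
    exact zero_ne_one h4
  refine Matrix.eq_zero_of_vecMul_eq_zero hdet ?_
  ext j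
  have h5 := congrFun (congrArg Ψ ha) j
  rw [map_sum, Finset.sum_apply] at h5
  simpa [Matrix.vecMul, dotProduct, M] using h5

/-- In a family of bigraded ideals, the Hilbert function is constant on a nonempty open set. -/
theorem exists_finrank_eq {A : Type*} [CommRing A] [IsDomain A] [Algebra K A]
    (I : Ideal (MvPolynomial (Fin n ⊕ Fin m) A))
    (hI : ∀ p ∈ I, ∀ d, MvPolynomial.weightedHomogeneousComponent (varDeg n m) d p ∈ I) :
    ∃ c : A, c ≠ 0 ∧ ∃ g : ℤ × ℤ → ℕ, ∀ ev : A →ₐ[K] K, ev c ≠ 0 → ∀ d,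
      Module.finrank K ((I.map (MvPolynomial.map (ev : A →+* K))).restrictScalars K ⊓
        polyPiece K n m d : Submodule K (Poly K n m)) = g d := by
  classical
  obtain ⟨mo⟩ := exists_monomialOrder (Fin n ⊕ Fin m)
  -- The leading exponents of `I` over `A`. The generic Hilbert function will count those of each
  -- bidegree.
  let G : Set (Fin n ⊕ Fin m →₀ ℕ) := {s | ∃ f ∈ I, f ≠ 0 ∧ mo.degree f = s}
  obtain ⟨B, hBG, hB⟩ := exists_finite_basis_of_wellQuasiOrdered G
  choose! f hf hf0 hfdeg using fun s (hs : s ∈ G) => hs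
  have hGfin : ∀ d, {s | s ∈ G ∧ Finsupp.weight (varDeg n m) s = d}.Finite := fun d =>
    (finite_weight_eq n m d).subset fun s hs => hs.2
  -- Finitely many leading coefficients suffice for all bidegrees at once, since every element of
  -- `G` is a multiple of one in `B`.
  refine ⟨∏ b ∈ B, mo.leadingCoeff (f b), Finset.prod_ne_zero_iff.2 fun b hb =>
    MonomialOrder.leadingCoeff_ne_zero_iff.2 (hf0 b (hBG hb)),
    fun d => (hGfin d).toFinset.card, fun ev hev d => ?_⟩
  set Q := I.map (MvPolynomial.map (ev : A →+* K)) with hQ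
  let W : Submodule K (Poly K n m) := Q.restrictScalars K ⊓ polyPiece K n m d
  have hWfin : Module.Finite K W :=
    Submodule.finiteDimensional_of_le (inf_le_right : W ≤ polyPiece K n m d)
  rw [map_prod, Finset.prod_ne_zero_iff] at hev
  change Module.finrank K W = _
  apply le_antisymm
  -- Upper bound: with more lifts `F i` than exponents in `G` of bidegree `d`, some nontrivial
  -- combination over `A` has no term at such an exponent. It lies in `I`, so it is zero,
  -- contradicting the independence of the specializations.
  · have hsurj : Function.Surjective (MvPolynomial.map (σ := Fin n ⊕ Fin m) (ev : A →+* K)) :=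
      MvPolynomial.map_surjective _ fun x => ⟨algebraMap K A x, by simp⟩
    let q := Module.finBasis K W
    have hlift : ∀ i, ∃ F ∈ I, MvPolynomial.IsWeightedHomogeneous (varDeg n m) F d ∧
        MvPolynomial.map (ev : A →+* K) F = q i := by
      intro i
      obtain ⟨F, hF, hFq⟩ := (Ideal.mem_map_iff_of_surjective _ hsurj).1 (q i).2.1
      refine ⟨_, hI F hF d, MvPolynomial.weightedHomogeneousComponent_mem _ _ _, ?_⟩
      rw [map_weightedHomogeneousComponent, hFq,
        MvPolynomial.weightedHomogeneousComponent_of_mem (q i).2.2, if_pos rfl]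
    choose F hFI hFd hFq using hlift
    by_contra! hlt
    let L : (Fin (Module.finrank K W) → A) →ₗ[A] ((hGfin d).toFinset → A) :=
      LinearMap.pi fun s => (MvPolynomial.lcoeff A s.1) ∘ₗ Fintype.linearCombination A F
    have hL : ¬ Function.Injective L := by
      intro hinj
      have := card_le_of_injective A L hinj
      rw [Fintype.card_fin, Fintype.card_coe] at this
      omega
    rw [injective_iff_map_eq_zero] at hL
    push Not at hL
    obtain ⟨a, haL, ha⟩ := hL
    refine ha (linearIndependent_of_map ev F ?_ a ?_)
    · simp_rw [hFq]
      exact q.linearIndependent.map' W.subtype W.ker_subtype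
    · by_contra hne
      have hmem : ∑ i, a i • F i ∈ I := I.sum_mem fun i _ => by
        rw [MvPolynomial.smul_eq_C_mul]
        exact I.mul_mem_left _ (hFI i)
      have hdeg : (∑ i, a i • F i).coeff (mo.degree (∑ i, a i • F i)) ≠ 0 :=
        MonomialOrder.coeff_degree_ne_zero_iff.2 hne
      have hhom : ∑ i, a i • F i ∈
          MvPolynomial.weightedHomogeneousSubmodule A (varDeg n m) d :=
        Submodule.sum_mem _ fun i _ => Submodule.smul_mem _ _ (hFd i)
      refine hdeg ?_
      exact congrFun haL ⟨mo.degree (∑ i, a i • F i), (hGfin d).mem_toFinset.2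
        ⟨⟨_, hmem, hne, rfl⟩, hhom hdeg⟩⟩
  -- Lower bound: where `c` does not vanish, a monomial multiple of `f b` keeps its leading exponent
  -- `s` under specialization, and so does its component of bidegree `d`.
  · have hq : ∀ s : (hGfin d).toFinset, ∃ q : W, (q : Poly K n m).coeff s.1 ≠ 0 ∧
        ∀ t, mo.toSyn s.1 < mo.toSyn t → (q : Poly K n m).coeff t = 0 := by
      rintro ⟨s, hs⟩
      obtain ⟨hsG, hsd⟩ := (hGfin d).mem_toFinset.1 hs
      obtain ⟨b, hb, hbs⟩ := hB s hsG
      set h : MvPolynomial (Fin n ⊕ Fin m) A := MvPolynomial.monomial (s - b) 1 * f b with hh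
      have hcoeff : ∀ t, (MvPolynomial.map (ev : A →+* K)
          (MvPolynomial.weightedHomogeneousComponent (varDeg n m) d h)).coeff t =
          if Finsupp.weight (varDeg n m) t = d then ev (h.coeff t) else 0 := by
        intro t
        rw [MvPolynomial.coeff_map, MvPolynomial.coeff_weightedHomogeneousComponent]
        split_ifs <;> simp
      have hdeg : mo.degree h = s := by
        rw [hh, MonomialOrder.degree_mul (by simp) (hf0 b (hBG hb)), hfdeg b (hBG hb),
          MonomialOrder.degree_monomial, if_neg one_ne_zero, tsub_add_cancel_of_le hbs]
      refine ⟨⟨MvPolynomial.map (ev : A →+* K)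
        (MvPolynomial.weightedHomogeneousComponent (varDeg n m) d h),
        Ideal.mem_map_of_mem _ (hI _ (I.mul_mem_left _ (hf b (hBG hb))) d), ?_⟩, ?_, ?_⟩
      · rw [map_weightedHomogeneousComponent]
        exact MvPolynomial.weightedHomogeneousComponent_mem _ _ _
      · rw [hcoeff, if_pos hsd]
        have h1 : h.coeff s = mo.leadingCoeff (f b) := by
          have h2 : mo.leadingCoeff h = mo.leadingCoeff (f b) := by
            rw [hh, MonomialOrder.leadingCoeff_mul, MonomialOrder.leadingCoeff_monomial, one_mul]
          rw [← h2, MonomialOrder.leadingCoeff, hdeg]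
        rw [h1]
        exact hev b hb
      · intro t ht
        rw [hcoeff, MonomialOrder.coeff_eq_zero_of_lt (m := mo) (by rwa [hdeg]), map_zero, ite_self]
    choose q hq1 hq2 using hq
    have hli := linearIndependent_of_leading (K := K) mo (fun s : (hGfin d).toFinset => s.1)
      Subtype.val_injective (fun s => (q s : Poly K n m)) hq1 hq2
    have := (LinearIndependent.of_comp W.subtype hli).fintype_card_le_finrank
    rwa [Fintype.card_coe] at this

/-! ### Colon ideals and Hilbert functions -/

theorem component_mul_of_mem {e : ℤ × ℤ} {z : Poly K n m} (hz : z ∈ polyPiece K n m e)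
    (g : Poly K n m) (d : ℤ × ℤ) :
    MvPolynomial.weightedHomogeneousComponent (varDeg n m) (d + e) (g * z) =
      MvPolynomial.weightedHomogeneousComponent (varDeg n m) d g * z := by
  have h := DirectSum.coe_decompose_mul_add_of_right_mem (polyPiece K n m) (i := d) (a := g) hz
  rw [← MvPolynomial.decompose'_apply K (varDeg n m), ← MvPolynomial.decompose'_apply K (varDeg n m)]
  exact h

theorem component_mem (d : ℤ × ℤ) (p : Poly K n m) :
    MvPolynomial.weightedHomogeneousComponent (varDeg n m) d p ∈ polyPiece K n m d :=
  MvPolynomial.weightedHomogeneousComponent_mem _ _ _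

theorem component_eq_self {d : ℤ × ℤ} {p : Poly K n m} (hp : p ∈ polyPiece K n m d) :
    MvPolynomial.weightedHomogeneousComponent (varDeg n m) d p = p := by
  rw [MvPolynomial.weightedHomogeneousComponent_of_mem hp, if_pos rfl]

/-- The part of an ideal in bidegree `d`. -/
def idealPiece (Q : Ideal (Poly K n m)) (d : ℤ × ℤ) : Submodule K (Poly K n m) :=
  Q.restrictScalars K ⊓ polyPiece K n m d

instance finite_idealPiece (Q : Ideal (Poly K n m)) (d : ℤ × ℤ) :
    Module.Finite K (idealPiece Q d) :=
  Submodule.finiteDimensional_of_le (inf_le_right : idealPiece Q d ≤ polyPiece K n m d)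

/-- The part of `Q : z` in bidegree `d`. -/
def colonPiece (Q : Ideal (Poly K n m)) (z : Poly K n m) (d : ℤ × ℤ) :
    Submodule K (Poly K n m) :=
  (Q.restrictScalars K).comap (LinearMap.mulLeft K z) ⊓ polyPiece K n m d

theorem mem_colonPiece {Q : Ideal (Poly K n m)} {z p : Poly K n m} {d : ℤ × ℤ} :
    p ∈ colonPiece Q z d ↔ z * p ∈ Q ∧ p ∈ polyPiece K n m d := Iff.rfl

instance finite_colonPiece (Q : Ideal (Poly K n m)) (z : Poly K n m) (d : ℤ × ℤ) :
    Module.Finite K (colonPiece Q z d) :=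
  Submodule.finiteDimensional_of_le (inf_le_right : colonPiece Q z d ≤ polyPiece K n m d)

/-- Multiplication by `z` maps `S_d` onto `((Q + (z))/Q)_{d+e}` with kernel `(Q : z)_d`. The maps
`φ` and `ψ` into `S/Q` have this common range, and rank-nullity is applied to both. -/
theorem finrank_colonPiece {Q : Ideal (Poly K n m)} (hQ : Q.IsHomogeneous (polyPiece K n m))
    {z : Poly K n m} {e : ℤ × ℤ} (hz : z ∈ polyPiece K n m e) (d : ℤ × ℤ) :
    Module.finrank K (colonPiece Q z d) +
        Module.finrank K (idealPiece (Q ⊔ Ideal.span {z}) (d + e)) =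
      Module.finrank K (polyPiece K n m d) + Module.finrank K (idealPiece Q (d + e)) := by
  let mkQ : Poly K n m →ₗ[K] Poly K n m ⧸ Q := (Ideal.Quotient.mkₐ K Q).toLinearMap
  have hmk : ∀ p, mkQ p = 0 ↔ p ∈ Q := fun p => Ideal.Quotient.eq_zero_iff_mem
  let φ : polyPiece K n m d →ₗ[K] Poly K n m ⧸ Q :=
    mkQ ∘ₗ LinearMap.mulLeft K z ∘ₗ (polyPiece K n m d).subtype
  let ψ : idealPiece (Q ⊔ Ideal.span {z}) (d + e) →ₗ[K] Poly K n m ⧸ Q :=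
    mkQ ∘ₗ (idealPiece (Q ⊔ Ideal.span {z}) (d + e)).subtype
  have hφ : Module.finrank K (LinearMap.ker φ) = Module.finrank K (colonPiece Q z d) := by
    suffices h : (LinearMap.ker φ).map (polyPiece K n m d).subtype = colonPiece Q z d by
      rw [← h, Submodule.finrank_map_subtype_eq]
    ext p
    rw [Submodule.mem_map, mem_colonPiece]
    constructor
    · rintro ⟨p, hp, rfl⟩
      exact ⟨(hmk _).1 hp, p.2⟩
    · rintro ⟨h1, h2⟩
      exact ⟨⟨p, h2⟩, (hmk _).2 h1, rfl⟩
  have hψ : Module.finrank K (LinearMap.ker ψ) = Module.finrank K (idealPiece Q (d + e)) := by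
    suffices h : (LinearMap.ker ψ).map (idealPiece (Q ⊔ Ideal.span {z}) (d + e)).subtype =
        idealPiece Q (d + e) by
      rw [← h, Submodule.finrank_map_subtype_eq]
    ext p
    rw [Submodule.mem_map]
    constructor
    · rintro ⟨p, hp, rfl⟩
      exact ⟨(hmk _).1 hp, p.2.2⟩
    · rintro ⟨h1, h2⟩
      exact ⟨⟨p, le_sup_left (a := Q) h1, h2⟩, (hmk _).2 h1, rfl⟩
  have hrange : LinearMap.range φ = LinearMap.range ψ := by
    apply le_antisymm
    · rintro _ ⟨p, rfl⟩
      refine ⟨⟨z * p, le_sup_right (a := Q)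
        (Ideal.mem_span_singleton.2 (dvd_mul_right z (p : Poly K n m))), ?_⟩, rfl⟩
      rw [add_comm]
      exact SetLike.mul_mem_graded hz p.2
    · rintro _ ⟨⟨w, hw, hwd⟩, rfl⟩
      obtain ⟨q, hq, r, hr, rfl⟩ := Submodule.mem_sup.1 hw
      obtain ⟨g, rfl⟩ := Ideal.mem_span_singleton'.1 hr
      refine ⟨⟨_, component_mem d g⟩, ?_⟩
      have h1 := component_eq_self hwd
      rw [map_add, component_mul_of_mem hz] at h1
      change mkQ (z * _) = mkQ (q + g * z)
      rw [← h1, map_add, (hmk _).2 (polyComp_mem hQ hq _), zero_add, mul_comm]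
      rfl
  have h1 := φ.finrank_range_add_finrank_ker
  have h2 := ψ.finrank_range_add_finrank_ker
  rw [hφ] at h1
  rw [hψ, ← hrange] at h2
  omega

/-- The condition `(Q : z)_d = Q_d` depends only on Hilbert functions. -/
theorem mem_of_mul_mem_of_finrank_eq {Q Q' : Ideal (Poly K n m)}
    (hQ : Q.IsHomogeneous (polyPiece K n m)) (hQ' : Q'.IsHomogeneous (polyPiece K n m))
    {z z' : Poly K n m} {e d : ℤ × ℤ} (hz : z ∈ polyPiece K n m e) (hz' : z' ∈ polyPiece K n m e)
    (h1 : ∀ d, Module.finrank K (idealPiece Q d) = Module.finrank K (idealPiece Q' d))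
    (h2 : ∀ d, Module.finrank K (idealPiece (Q ⊔ Ideal.span {z}) d) =
      Module.finrank K (idealPiece (Q' ⊔ Ideal.span {z'}) d))
    (h : ∀ p ∈ polyPiece K n m d, z' * p ∈ Q' → p ∈ Q') (p : Poly K n m)
    (hp : p ∈ polyPiece K n m d) (hzp : z * p ∈ Q) : p ∈ Q := by
  have hle : ∀ (Q : Ideal (Poly K n m)) z, idealPiece Q d ≤ colonPiece Q z d :=
    fun Q z q hq => ⟨Q.mul_mem_left z hq.1, hq.2⟩
  have h3 := finrank_colonPiece hQ hz d
  have h4 := finrank_colonPiece hQ' hz' d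
  have h5 : idealPiece Q' d = colonPiece Q' z' d :=
    le_antisymm (hle Q' z') fun q hq => ⟨h q hq.2 hq.1, hq.2⟩
  rw [← h5, ← h1, ← h1, ← h2] at h4
  have h6 : idealPiece Q d = colonPiece Q z d :=
    Submodule.eq_of_le_of_finrank_eq (hle Q z) (by omega)
  have h7 : p ∈ idealPiece Q d := h6 ▸ mem_colonPiece.2 ⟨hzp, hp⟩
  exact h7.1

/-! ### Avoiding associated primes -/

/-- A minimal prime over `Q : p` is associated to `A/Q`. It contains `v`, hence all of `V`, hence
`w`; so `w` lies in the radical of `Q : p`. -/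
theorem exists_pow_mul_mem_of_notMem_associatedPrimes {A : Type u} [CommRing A] [IsNoetherianRing A]
    {Q : Ideal A} {V : Set A} {v : A}
    (hv : ∀ P ∈ associatedPrimes A (A ⧸ Q), ¬ V ⊆ P → v ∉ P) {p : A} (hp : v * p ∈ Q) {w : A}
    (hw : w ∈ V) : ∃ k : ℕ, w ^ k * p ∈ Q := by
  let N : Submodule A (A ⧸ Q) := Submodule.span A {Ideal.Quotient.mk Q p}
  have hann : ∀ a, a ∈ Module.annihilator A N ↔ a * p ∈ Q := by
    intro a
    rw [← Submodule.annihilator, Submodule.mem_annihilator_span_singleton]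
    exact Ideal.Quotient.eq_zero_iff_mem
  suffices h : w ∈ (Module.annihilator A N).radical by
    obtain ⟨k, hk⟩ := h
    exact ⟨k, (hann _).1 hk⟩
  rw [← Ideal.sInf_minimalPrimes, Submodule.mem_sInf]
  intro P hP
  have h1 : P ∈ associatedPrimes A (A ⧸ Q) :=
    associatedPrimes.subset_of_injective N.injective_subtype
      (Module.associatedPrimes.minimalPrimes_annihilator_subset_associatedPrimes A N hP)
  by_contra hwP
  exact hv P h1 (fun h => hwP (h hw)) (hP.1.2 ((hann v).2 hp))

/-- A functional on `S/P` that is nonzero on the class of `b k`, written in the coordinates `t`. -/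
theorem exists_linear_form_of_notMem {r : ℕ} (b : Fin r → Poly K n m) (P : Ideal (Poly K n m))
    {k : Fin r} (hk : b k ∉ P) : ∃ l : MvPolynomial (Fin r) K, l ≠ 0 ∧
      ∀ t : Fin r → K, MvPolynomial.eval t l ≠ 0 → ∑ i, t i • b i ∉ P := by
  classical
  have h1 : Ideal.Quotient.mkₐ K P (b k) ≠ 0 := fun h => hk (Ideal.Quotient.eq_zero_iff_mem.1 h)
  obtain ⟨θ, hθ⟩ : ∃ θ : Module.Dual K (Poly K n m ⧸ P), θ (Ideal.Quotient.mkₐ K P (b k)) ≠ 0 := by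
    by_contra! h
    exact h1 ((Module.forall_dual_apply_eq_zero_iff K _).1 h)
  have heval : ∀ t : Fin r → K, MvPolynomial.eval t
      (∑ i, MvPolynomial.C (θ (Ideal.Quotient.mkₐ K P (b i))) * MvPolynomial.X i) =
      θ (Ideal.Quotient.mkₐ K P (∑ i, t i • b i)) := by
    intro t
    simp only [map_sum, map_mul, MvPolynomial.eval_C, MvPolynomial.eval_X, map_smul, smul_eq_mul]
    exact Finset.sum_congr rfl fun i _ => mul_comm _ _
  refine ⟨∑ i, MvPolynomial.C (θ (Ideal.Quotient.mkₐ K P (b i))) * MvPolynomial.X i, ?_, ?_⟩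
  · intro h0
    have h2 := heval (Pi.single k 1)
    rw [h0, map_zero, Finset.sum_eq_single k (fun i _ hi => by simp [hi]) (by simp)] at h2
    exact hθ (by simpa using h2.symm)
  · intro t ht hmem
    rw [heval] at ht
    apply ht
    rw [show Ideal.Quotient.mkₐ K P (∑ i, t i • b i) = 0 from Ideal.Quotient.eq_zero_iff_mem.2 hmem,
      map_zero]

theorem exists_eval_ne_zero [Infinite K] {τ : Type*} {p : MvPolynomial τ K} (hp : p ≠ 0) :
    ∃ t, MvPolynomial.eval t p ≠ 0 := by
  by_contra! h
  exact hp (MvPolynomial.funext fun t => by rw [h, map_zero])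

theorem initIdeal_congr {A : Type u} [CommRing A] {N N' : ℕ} {u : Fin N → A} {u' : Fin N' → A}
    {j : ℕ} (hj : j ≤ N) (hj' : j ≤ N')
    (h : ∀ k (hk : k < j), u ⟨k, hk.trans_le hj⟩ = u' ⟨k, hk.trans_le hj'⟩) :
    initIdeal u j = initIdeal u' j := by
  unfold initIdeal
  congr 1
  ext x
  constructor
  · rintro ⟨k, hk, rfl⟩
    exact ⟨⟨k, lt_of_lt_of_le hk hj'⟩, hk, (h k hk).symm⟩
  · rintro ⟨k, hk, rfl⟩
    exact ⟨⟨k, lt_of_lt_of_le hk hj⟩, hk, h k hk⟩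

/-- The forms with coordinates `t` with respect to `b`. -/
def formsOf {r : ℕ} (b : Fin r → Poly K n m) (t : Fin r × Fin r → K) (i : Fin r) : Poly K n m :=
  ∑ k, t (i, k) • b k

/-- The rows of `t` are chosen one by one. For given first `j` rows, the ideal has finitely many
associated primes, and one that does not contain `S_e` misses some `b k` because it contains `J`. A
row outside finitely many hyperplanes avoids them all, and changing it leaves the conditions on
earlier rows intact. -/
theorem exists_torsion_point [Infinite K] {J : Ideal (Poly K n m)} {r : ℕ} (b : Fin r → Poly K n m)
    {e : ℤ × ℤ} (hb : ∀ p ∈ polyPiece K n m e, ∃ a : Fin r → K, p - ∑ k, a k • b k ∈ J)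
    {c : MvPolynomial (Fin r × Fin r) K} (hc : c ≠ 0) :
    ∃ t, MvPolynomial.eval t c ≠ 0 ∧ ∀ (i : Fin r) p,
      formsOf b t i * p ∈ J ⊔ initIdeal (formsOf b t) i → ∀ w ∈ polyPiece K n m e,
        ∃ k : ℕ, w ^ k * p ∈ J ⊔ initIdeal (formsOf b t) i := by
  classical
  suffices H : ∀ j ≤ r, ∃ t, MvPolynomial.eval t c ≠ 0 ∧ ∀ i : Fin r, (i : ℕ) < j → ∀ p,
      formsOf b t i * p ∈ J ⊔ initIdeal (formsOf b t) i → ∀ w ∈ polyPiece K n m e,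
        ∃ k : ℕ, w ^ k * p ∈ J ⊔ initIdeal (formsOf b t) i by
    obtain ⟨t, h1, h2⟩ := H r le_rfl
    exact ⟨t, h1, fun i => h2 i i.2⟩
  intro j
  induction j with
  | zero =>
    intro _
    obtain ⟨t, ht⟩ := exists_eval_ne_zero hc
    exact ⟨t, ht, fun i hi => absurd hi (Nat.not_lt_zero _)⟩
  | succ j ih =>
    intro hj
    obtain ⟨t, htc, ht⟩ := ih (by omega)
    let j' : Fin r := ⟨j, hj⟩
    let Q := J ⊔ initIdeal (formsOf b t) j
    have hfin := associatedPrimes.finite (Poly K n m) (Poly K n m ⧸ Q)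
    have hl : ∀ P : Ideal (Poly K n m), ∃ l : MvPolynomial (Fin r) K, l ≠ 0 ∧
        (P ∈ associatedPrimes (Poly K n m) (Poly K n m ⧸ Q) →
          ¬ (polyPiece K n m e : Set (Poly K n m)) ⊆ P →
          ∀ s : Fin r → K, MvPolynomial.eval s l ≠ 0 → ∑ i, s i • b i ∉ P) := by
      intro P
      by_cases hP : P ∈ associatedPrimes (Poly K n m) (Poly K n m ⧸ Q) ∧
          ¬ (polyPiece K n m e : Set (Poly K n m)) ⊆ P
      · obtain ⟨k, hk⟩ : ∃ k, b k ∉ P := by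
          by_contra! hall
          refine hP.2 fun p hp => ?_
          obtain ⟨a, ha⟩ := hb p hp
          have hJP : J ≤ P := by
            refine le_trans ?_ (IsAssociatedPrime.annihilator_le hP.1)
            intro x hx
            rw [Submodule.mem_annihilator]
            rintro y -
            obtain ⟨y, rfl⟩ := Ideal.Quotient.mk_surjective y
            exact Ideal.Quotient.eq_zero_iff_mem.2 (Q.mul_mem_right y (le_sup_left (a := J) hx))
          rw [← sub_add_cancel p (∑ k, a k • b k)]
          refine P.add_mem (hJP ha) (P.sum_mem fun k _ => ?_)
          rw [MvPolynomial.smul_eq_C_mul]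
          exact P.mul_mem_left _ (hall k)
        obtain ⟨l, hl0, hl⟩ := exists_linear_form_of_notMem b P hk
        exact ⟨l, hl0, fun _ _ => hl⟩
      · exact ⟨1, one_ne_zero, fun h1 h2 => absurd ⟨h1, h2⟩ hP⟩
    choose l hl0 hl using hl
    let upd : (Fin r → K) → Fin r × Fin r → K := fun s ik => if ik.1 = j' then s ik.2 else t ik
    -- `c` as a polynomial in row `j'` alone. It is nonzero because it does not vanish at the old
    -- row of `t`.
    let c' : MvPolynomial (Fin r) K := MvPolynomial.aeval
      (fun ik : Fin r × Fin r => if ik.1 = j' then MvPolynomial.X ik.2 else MvPolynomial.C (t ik)) c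
    have hc' : ∀ s, MvPolynomial.eval s c' = MvPolynomial.eval (upd s) c := by
      intro s
      have h : (MvPolynomial.aeval s).comp (MvPolynomial.aeval fun ik : Fin r × Fin r =>
          if ik.1 = j' then MvPolynomial.X ik.2 else MvPolynomial.C (t ik)) =
          (MvPolynomial.aeval (upd s) : MvPolynomial (Fin r × Fin r) K →ₐ[K] K) := by
        refine MvPolynomial.algHom_ext fun ik => ?_
        rw [AlgHom.comp_apply, MvPolynomial.aeval_X, MvPolynomial.aeval_X]
        simp only [upd]
        split_ifs <;> simp
      exact DFunLike.congr_fun h c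
    have hc'0 : c' ≠ 0 := by
      intro h0
      have h1 := hc' fun k => t (j', k)
      have h2 : upd (fun k => t (j', k)) = t := by
        ext ⟨i, k⟩
        simp only [upd]
        split_ifs with h
        · rw [h]
        · rfl
      rw [h0, map_zero, h2] at h1
      exact htc h1.symm
    obtain ⟨s, hs⟩ := exists_eval_ne_zero (p := c' * ∏ P ∈ hfin.toFinset, l P)
      (mul_ne_zero hc'0 (Finset.prod_ne_zero_iff.2 fun P _ => hl0 P))
    rw [map_mul, map_prod, mul_ne_zero_iff, Finset.prod_ne_zero_iff, hc'] at hs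
    have hforms : ∀ i : Fin r, i ≠ j' → formsOf b (upd s) i = formsOf b t i := by
      intro i hi
      simp [formsOf, upd, hi]
    have hinit : ∀ i ≤ j, initIdeal (formsOf b (upd s)) i = initIdeal (formsOf b t) i := by
      intro i hi
      refine initIdeal_congr (by omega) (by omega) fun k hk => hforms _ fun h => ?_
      have := congrArg Fin.val h
      simp only [j'] at this
      omega
    refine ⟨upd s, hs.1, fun i hi => ?_⟩
    rcases Nat.lt_succ_iff_lt_or_eq.1 hi with hi | hi
    · rw [hinit i hi.le, hforms i fun h => by simp [h, j'] at hi]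
      exact ht i hi
    · obtain rfl : i = j' := Fin.ext hi
      rw [hinit j' le_rfl]
      have hji : formsOf b (upd s) j' = ∑ i, s i • b i := by simp [formsOf, upd]
      rw [hji]
      intro p hp w hw
      exact exists_pow_mul_mem_of_notMem_associatedPrimes (Q := Q)
        (V := (polyPiece K n m e : Set (Poly K n m)))
        (fun P hP hV => hl P hP hV s (hs.2 P (hfin.mem_toFinset.2 hP))) hp hw

/-! ### Minimal systems of generators and d-sequences -/

theorem component_zero (g : Poly K n m) :
    MvPolynomial.weightedHomogeneousComponent (varDeg n m) 0 g = MvPolynomial.C (g.coeff 0) := by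
  classical
  ext s
  rw [MvPolynomial.coeff_weightedHomogeneousComponent, MvPolynomial.coeff_C]
  by_cases h : s = 0
  · simp [h]
  · rw [if_neg, if_neg (Ne.symm h)]
    intro hw
    have h1 := weight_fst_add_snd s
    rw [hw] at h1
    exact h ((Finsupp.degree_eq_zero_iff s).1 (by simpa using h1.symm))

/-- A form of bidegree `e` in an ideal generated by forms of bidegree `e` is a linear combination
of them. -/
theorem mem_span_of_mem_ideal_span {J : Ideal (Poly K n m)} (hJ : J.IsHomogeneous (polyPiece K n m))
    {e : ℤ × ℤ} {A : Set (Poly K n m ⧸ J)} (hA : A ⊆ quotPiece J e) {x : Poly K n m ⧸ J}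
    (hx : x ∈ quotPiece J e) (hxA : x ∈ Ideal.span A) : x ∈ Submodule.span K A := by
  have key : ∃ p, Ideal.Quotient.mk J p = x ∧ Ideal.Quotient.mk J
      (MvPolynomial.weightedHomogeneousComponent (varDeg n m) e p) ∈ Submodule.span K A := by
    clear hx
    induction hxA using Submodule.closure_induction with
    | zero => exact ⟨0, by simp, by simp⟩
    | add x y _ _ hx hy =>
      obtain ⟨p, rfl, hp⟩ := hx
      obtain ⟨q, rfl, hq⟩ := hy
      exact ⟨p + q, map_add _ _ _, by rw [map_add, map_add]; exact add_mem hp hq⟩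
    | smul_mem r a ha =>
      obtain ⟨g, rfl⟩ := Ideal.Quotient.mk_surjective r
      obtain ⟨v, hv, hva⟩ := hA ha
      refine ⟨g * v, by rw [map_mul, smul_eq_mul, ← hva]; rfl, ?_⟩
      -- In bidegree `e`, only the constant term of the coefficient `g` contributes.
      have h1 := component_mul_of_mem hv g 0
      rw [zero_add, component_zero, ← MvPolynomial.smul_eq_C_mul] at h1
      rw [h1]
      have h2 : Ideal.Quotient.mk J (g.coeff 0 • v) = g.coeff 0 • a := by
        rw [← hva]
        exact map_smul (Ideal.Quotient.mkₐ K J) _ _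
      rw [h2]
      exact Submodule.smul_mem _ _ (Submodule.subset_span ha)
  obtain ⟨p, hp, hpA⟩ := key
  obtain ⟨q, hq, rfl⟩ := hx
  have h1 := polyComp_mem hJ (Ideal.Quotient.eq.1 hp) e
  rw [map_sub, component_eq_self hq] at h1
  rw [Ideal.Quotient.eq.2 h1] at hpA
  exact hpA

variable {J : Ideal (Poly K n m)} {e e' : ℤ × ℤ} {π π' : ℤ × ℤ → ℤ}

instance finite_quotPiece (d : ℤ × ℤ) : Module.Finite K (quotPiece J d) :=
  inferInstanceAs (Module.Finite K ((polyPiece K n m d).map _))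

/-- Graded Nakayama: in bidegree `e`, ideal membership amounts to lying in the `K`-span, and `dim
R_e` vectors span `R_e` exactly when they are independent. -/
theorem isMinimalSystem_iff (hJ : J.IsHomogeneous (polyPiece K n m))
    (f : Fin (Module.finrank K (quotPiece J e)) → quotPiece J e) :
    IsMinimalSystem (fun i => (f i : Poly K n m ⧸ J)) (formIdeal J e) ↔ LinearIndependent K f := by
  have hA : ∀ T, (fun i => (f i : Poly K n m ⧸ J)) '' T ⊆ quotPiece J e := by
    rintro T _ ⟨i, -, rfl⟩
    exact (f i).2
  constructor
  · rintro ⟨h, -⟩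
    refine linearIndependent_of_top_le_span_of_card_eq_finrank ?_ (Fintype.card_fin _)
    rintro ⟨x, hx⟩ -
    have h1 := mem_span_of_mem_ideal_span hJ (hA Set.univ) hx (by
      rw [Set.image_univ, h]
      exact Ideal.subset_span hx)
    rw [Set.image_univ] at h1
    have h2 : Set.range (fun i => (f i : Poly K n m ⧸ J)) =
        (quotPiece J e).subtype '' Set.range f := (Set.range_comp _ f)
    rw [h2, Submodule.span_image] at h1
    obtain ⟨y, hy, hyx⟩ := h1
    rwa [show y = ⟨x, hx⟩ from Subtype.ext hyx] at hy
  · intro h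
    have hspan := h.span_eq_top_of_card_eq_finrank' (Fintype.card_fin _)
    have hli : LinearIndependent K fun i => (f i : Poly K n m ⧸ J) :=
      h.map' (quotPiece J e).subtype (Submodule.ker_subtype _)
    have hle : ∀ T, Ideal.span ((fun i => (f i : Poly K n m ⧸ J)) '' T) ≤ formIdeal J e :=
      fun T => Ideal.span_mono (hA T)
    constructor
    · apply le_antisymm
      · rw [← Set.image_univ]
        exact hle _
      · refine Ideal.span_le.2 fun x hx => ?_
        have h1 : (⟨x, hx⟩ : quotPiece J e) ∈ Submodule.span K (Set.range f) := hspan ▸ trivial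
        have h2 := Submodule.mem_map_of_mem (f := (quotPiece J e).subtype) h1
        rw [← Submodule.span_image, ← Set.range_comp] at h2
        exact Submodule.span_le_restrictScalars K (Poly K n m ⧸ J) _ h2
    · intro i hi
      have h1 : (f i : Poly K n m ⧸ J) ∈
          Ideal.span ((fun i => (f i : Poly K n m ⧸ J)) '' {j | j ≠ i}) := by
        rw [hi]
        exact Ideal.subset_span (f i).2
      refine hli.notMem_span_image (s := {j | j ≠ i}) (x := i) (by simp) ?_
      exact mem_span_of_mem_ideal_span hJ (hA _) (f i).2 h1

theorem formIdeal_eq_map (hs : IsSide e e' π π') : formIdeal J e = (Ideal.span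
    (MvPolynomial.X '' {s : Fin n ⊕ Fin m | varDeg n m s = e})).map (Ideal.Quotient.mk J) := by
  have h1 : (Ideal.span (MvPolynomial.X '' {s : Fin n ⊕ Fin m | varDeg n m s = e}) :
      Ideal (Poly K n m)) = Ideal.span (polyPiece K n m e) := by
    apply le_antisymm
    · rw [Ideal.span_le]
      rintro _ ⟨s, hs', rfl⟩
      have := X_mem_polyPiece (K := K) s
      rw [hs'] at this
      exact Ideal.subset_span this
    · rw [Ideal.span_le, ← span_X_eq_polyPiece hs]
      refine fun x hx => Submodule.span_le_restrictScalars K (Poly K n m) _ (Submodule.span_mono ?_ hx)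
      rintro _ ⟨s, rfl⟩
      exact ⟨s.1, s.2, rfl⟩
  rw [h1, Ideal.map_span]
  rfl

/-- Every monomial of such a polynomial contains a variable of bidegree `e`, so its `π`-degree is at
least `1`. -/
theorem eq_zero_of_mem_span_X (hs : IsSide e e' π π') {d : ℤ × ℤ} (hd : π d ≤ 0) {p : Poly K n m}
    (hp : p ∈ polyPiece K n m d)
    (hpX : p ∈ Ideal.span (MvPolynomial.X '' {s : Fin n ⊕ Fin m | varDeg n m s = e})) : p = 0 := by
  rw [MvPolynomial.mem_ideal_span_X_image] at hpX
  by_contra hne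
  obtain ⟨s, hs'⟩ := MvPolynomial.ne_zero_iff.1 hne
  obtain ⟨i, hi, hsi⟩ := hpX s (MvPolynomial.mem_support_iff.2 hs')
  have h1 : Finsupp.weight (varDeg n m) s = d := hp hs'
  have h2 : s i • e ≤ d := by
    rw [← h1, Finsupp.weight_apply, Finsupp.sum, ← show varDeg n m i = e from hi]
    refine Finset.single_le_sum (f := fun t => s t • varDeg n m t) (fun t _ => nsmul_nonneg ?_ _)
      (Finsupp.mem_support_iff.2 hsi)
    rcases hs.varDeg_eq t with h | h <;> rw [h]
    exacts [hs.nonneg, hs.nonneg']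
  have h3 : 0 < s i := Nat.pos_of_ne_zero hsi
  rcases hs with ⟨rfl, -, rfl, -⟩ | ⟨rfl, -, rfl, -⟩
  · have := h2.1
    simp at this
    omega
  · have := h2.2
    simp at this
    omega

theorem sup_initIdeal_isHomogeneous (hJ : J.IsHomogeneous (polyPiece K n m)) {N : ℕ}
    {v : Fin N → Poly K n m} (hv : ∀ i, v i ∈ polyPiece K n m e) (j : ℕ) :
    (J ⊔ initIdeal v j).IsHomogeneous (polyPiece K n m) := by
  refine hJ.sup (Ideal.homogeneous_span _ _ ?_)
  rintro _ ⟨i, -, rfl⟩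
  exact ⟨e, hv i⟩

theorem span_image_lt_eq_map {r : ℕ} {v : Fin r → Poly K n m} {f : Fin r → Poly K n m ⧸ J}
    (hvf : ∀ i, Ideal.Quotient.mk J (v i) = f i) (i : Fin r) :
    Ideal.span (f '' {j | j < i}) = (initIdeal v i).map (Ideal.Quotient.mk J) := by
  rw [initIdeal, Ideal.map_span, Set.image_image]
  congr 1
  exact Set.image_congr fun k _ => (hvf k).symm

theorem mem_span_image_lt_iff {r : ℕ} {v : Fin r → Poly K n m} {f : Fin r → Poly K n m ⧸ J}
    (hvf : ∀ i, Ideal.Quotient.mk J (v i) = f i) (i : Fin r) (p : Poly K n m) :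
    Ideal.Quotient.mk J p ∈ Ideal.span (f '' {j | j < i}) ↔ p ∈ J ⊔ initIdeal v i := by
  rw [span_image_lt_eq_map hvf, Ideal.mem_quotient_iff_mem_sup, sup_comm]

/-- The colon condition in the definition of a d-sequence, for forms of bidegree `e`. -/
theorem colon_inf_eq_iff (hs : IsSide e e' π π') (hJ : J.IsHomogeneous (polyPiece K n m)) {r : ℕ}
    {v : Fin r → Poly K n m} (hv : ∀ i, v i ∈ polyPiece K n m e) {f : Fin r → Poly K n m ⧸ J}
    (hvf : ∀ i, Ideal.Quotient.mk J (v i) = f i) (hf : Ideal.span (Set.range f) = formIdeal J e)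
    (i : Fin r) :
    (Ideal.span (f '' {j | j < i})).colon {f i} ⊓ Ideal.span (Set.range f) =
      Ideal.span (f '' {j | j < i}) ↔
    ∀ d, 1 ≤ π d → ∀ p ∈ polyPiece K n m d, v i * p ∈ J ⊔ initIdeal v i →
      p ∈ J ⊔ initIdeal v i := by
  have hcol : ∀ p, Ideal.Quotient.mk J p ∈ (Ideal.span (f '' {j | j < i})).colon {f i} ↔
      v i * p ∈ J ⊔ initIdeal v i := by
    intro p
    rw [Submodule.mem_colon_singleton, ← mem_span_image_lt_iff hvf, ← hvf i, smul_eq_mul,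
      ← map_mul, mul_comm]
  constructor
  · intro h d hd p hp hvp
    rw [← mem_span_image_lt_iff hvf, ← h]
    refine ⟨(hcol p).2 hvp, ?_⟩
    rw [hf, formIdeal_eq_map hs]
    exact Ideal.mem_map_of_mem _ (mem_span_X_of_mem_polyPiece hs hd hp)
  · intro h
    apply le_antisymm
    · rintro x ⟨hx1, hx2⟩
      obtain ⟨p, rfl⟩ := Ideal.Quotient.mk_surjective x
      have hx2' : Ideal.Quotient.mk J p ∈ formIdeal J e := hf ▸ hx2
      rw [formIdeal_eq_map hs, Ideal.mem_quotient_iff_mem_sup] at hx2'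
      have hx1' := (hcol p).1 hx1
      have hQ := sup_initIdeal_isHomogeneous hJ hv i
      rw [mem_span_image_lt_iff hvf, ← MvPolynomial.sum_weightedHomogeneousComponent (varDeg n m) p]
      refine finsum_induction (· ∈ J ⊔ initIdeal v i) (zero_mem _) (fun _ _ => add_mem) fun d => ?_
      by_cases hd : 1 ≤ π d
      · refine h d hd _ (component_mem d p) ?_
        rw [mul_comm, ← component_mul_of_mem (hv i), mul_comm]
        exact polyComp_mem hQ hx1' _
      -- In `π`-degree at most `0` the part from the ideal of variables vanishes, so the component
      -- of `p` lies in `J`.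
      · obtain ⟨a, ha, q, hq, rfl⟩ := Submodule.mem_sup.1 hx2'
        have hX : (Ideal.span (MvPolynomial.X '' {s : Fin n ⊕ Fin m | varDeg n m s = e}) :
            Ideal (Poly K n m)).IsHomogeneous (polyPiece K n m) := by
          refine Ideal.homogeneous_span _ _ ?_
          rintro _ ⟨s, -, rfl⟩
          exact ⟨_, X_mem_polyPiece s⟩
        rw [map_add, eq_zero_of_mem_span_X hs (by omega) (component_mem d a)
          (polyComp_mem hX ha d), zero_add]
        exact le_sup_left (a := J) (polyComp_mem hJ hq d)
    · intro x hx
      refine ⟨?_, Ideal.span_mono (Set.image_subset_range _ _) hx⟩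
      exact Submodule.mem_colon_singleton.2 (Ideal.mul_mem_right _ _ hx)

/-- Extension of lifts of a basis of `R_e` to a basis of `S_e` by elements of `J`. -/
theorem exists_extension {r : ℕ} {v : Fin r → Poly K n m} (hv : ∀ i, v i ∈ polyPiece K n m e)
    (hli : LinearIndependent K fun i => Ideal.Quotient.mkₐ K J (v i))
    (hb : ∀ p ∈ polyPiece K n m e, ∃ a : Fin r → K, p - ∑ k, a k • v k ∈ J) :
    ∃ (q : ℕ) (u : Fin (r + q) → Poly K n m), LinearIndependent K u ∧
      Submodule.span K (Set.range u) = polyPiece K n m e ∧ ∀ i, u (Fin.castAdd q i) = v i := by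
  -- The complement is a basis of `J_e`, as the `v i` are a basis of `S_e` modulo `J_e`.
  obtain ⟨q, ⟨w⟩⟩ : ∃ q, Nonempty (Module.Basis (Fin q) K (idealPiece J e)) :=
    ⟨_, ⟨Module.finBasis K (idealPiece J e)⟩⟩
  let u : Fin (r + q) → Poly K n m := Fin.append v fun k => (w k : Poly K n m)
  refine ⟨q, u, ?_, ?_, fun i => Fin.append_left _ _ i⟩
  · rw [Fintype.linearIndependent_iff]
    intro g hg
    rw [Fin.sum_univ_add] at hg
    simp only [u, Fin.append_left, Fin.append_right] at hg
    have h1 : ∀ i, g (Fin.castAdd _ i) = 0 := by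
      refine Fintype.linearIndependent_iff.1 hli _ ?_
      have h2 := congrArg (Ideal.Quotient.mkₐ K J) hg
      have h4 : Ideal.Quotient.mkₐ K J (∑ k, g (Fin.natAdd r k) • (w k : Poly K n m)) = 0 :=
        Ideal.Quotient.eq_zero_iff_mem.2 (Submodule.sum_mem (J.restrictScalars K) fun k _ =>
          Submodule.smul_mem _ _ (w k).2.1)
      rw [map_add, map_zero, h4, add_zero, map_sum] at h2
      rw [← h2]
      exact Finset.sum_congr rfl fun i _ => (map_smul _ _ _).symm
    have h3 : ∀ k, g (Fin.natAdd r k) = 0 := by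
      have hw : LinearIndependent K fun k => (w k : Poly K n m) :=
        w.linearIndependent.map' (idealPiece J e).subtype (Submodule.ker_subtype _)
      refine Fintype.linearIndependent_iff.1 hw _ ?_
      simpa [h1] using hg
    exact fun i => Fin.addCases h1 h3 i
  · apply le_antisymm
    · rw [Submodule.span_le]
      rintro _ ⟨i, rfl⟩
      refine Fin.addCases (fun i => ?_) (fun k => ?_) i
      · rw [show u (Fin.castAdd _ i) = v i from Fin.append_left _ _ i]
        exact hv i
      · rw [show u (Fin.natAdd r k) = w k from Fin.append_right _ _ k]
        exact (w k).2.2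
    · intro p hp
      obtain ⟨a, ha⟩ := hb p hp
      have h1 : p - ∑ k, a k • v k ∈ idealPiece J e :=
        ⟨ha, sub_mem hp (Submodule.sum_mem _ fun k _ => Submodule.smul_mem _ _ (hv k))⟩
      rw [← sub_add_cancel p (∑ k, a k • v k)]
      refine add_mem ?_ (Submodule.sum_mem _ fun k _ => Submodule.smul_mem _ _ (Submodule.subset_span
        ⟨Fin.castAdd _ k, Fin.append_left _ _ k⟩))
      have h2 : (⟨_, h1⟩ : idealPiece J e) ∈ Submodule.span K (Set.range w) := w.span_eq ▸ trivial
      have h3 := Submodule.mem_map_of_mem (f := (idealPiece J e).subtype) h2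
      rw [← Submodule.span_image] at h3
      refine Submodule.span_mono ?_ h3
      rintro _ ⟨_, ⟨k, rfl⟩, rfl⟩
      exact ⟨Fin.natAdd r k, Fin.append_right _ _ k⟩

/-! ### Regularity zero and d-sequences -/

theorem mem_sup_initIdeal_of_le {r N : ℕ} {v : Fin r → Poly K n m} {u : Fin N → Poly K n m}
    (hb : ∀ p ∈ polyPiece K n m e, ∃ a : Fin r → K, p - ∑ k, a k • v k ∈ J) (hrN : r ≤ N)
    (huv : ∀ i : Fin r, u (Fin.castLE hrN i) = v i) {j : ℕ} (hj : r ≤ j) {p : Poly K n m}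
    (hp : p ∈ polyPiece K n m e) : p ∈ J ⊔ initIdeal u j := by
  obtain ⟨a, ha⟩ := hb p hp
  rw [← sub_add_cancel p (∑ k, a k • v k)]
  refine Submodule.add_mem_sup ha (Submodule.sum_mem _ fun k _ => ?_)
  rw [MvPolynomial.smul_eq_C_mul]
  refine Ideal.mul_mem_left _ _ (Ideal.subset_span ⟨Fin.castLE hrN k, ?_, huv k⟩)
  exact k.2.trans_le hj

theorem span_X_le_sup_initIdeal {r N : ℕ} {v : Fin r → Poly K n m} {u : Fin N → Poly K n m}
    (hb : ∀ p ∈ polyPiece K n m e, ∃ a : Fin r → K, p - ∑ k, a k • v k ∈ J) (hrN : r ≤ N)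
    (huv : ∀ i : Fin r, u (Fin.castLE hrN i) = v i) {j : ℕ} (hj : r ≤ j) :
    Ideal.span (MvPolynomial.X '' {s : Fin n ⊕ Fin m | varDeg n m s = e}) ≤ J ⊔ initIdeal u j := by
  rw [Ideal.span_le]
  rintro _ ⟨s, hs, rfl⟩
  have h := X_mem_polyPiece (K := K) s
  rw [hs] at h
  exact mem_sup_initIdeal_of_le hb hrN huv hj h

section

variable (hs : IsSide e e' π π') (hJ : J.IsHomogeneous (polyPiece K n m)) {r : ℕ}
  {v : Fin r → Poly K n m} (hv : ∀ i, v i ∈ polyPiece K n m e)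
  (hli : LinearIndependent K fun i => Ideal.Quotient.mkₐ K J (v i))
  (hb : ∀ p ∈ polyPiece K n m e, ∃ a : Fin r → K, p - ∑ k, a k • v k ∈ J)

include hs hJ hv hli hb

theorem linearTor_of_colon_of_basis
    (hcol : ∀ (i : Fin r) d, 1 ≤ π d → ∀ p ∈ polyPiece K n m d,
      v i * p ∈ J ⊔ initIdeal v i → p ∈ J ⊔ initIdeal v i) : LinearTor π J := by
  obtain ⟨q, u, huli, hspan, huv⟩ := exists_extension hv hli hb
  refine linearTor_of_colon hs hJ huli hspan fun j => Fin.addCases (fun i => ?_) (fun k => ?_) j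
  · have h1 : initIdeal u (Fin.castAdd q i) = initIdeal v i :=
      initIdeal_congr (by simp; omega) i.2.le fun k hk => huv ⟨k, _⟩
    rw [h1, huv]
    exact hcol i
  -- Beyond the first `r` forms the ideal already contains `S_e`, so the conclusion holds for every
  -- form of `π`-degree at least `1`.
  · intro d hd p hp _
    exact span_X_le_sup_initIdeal hb (Nat.le_add_right r q) huv (by simp)
      (mem_span_X_of_mem_polyPiece hs hd hp)

theorem colon_of_linearTor_of_basis (h : LinearTor π J)
    (htors : ∀ (i : Fin r) p, v i * p ∈ J ⊔ initIdeal v i → ∀ w ∈ polyPiece K n m e,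
      ∃ k : ℕ, w ^ k * p ∈ J ⊔ initIdeal v i)
    (i : Fin r) (d : ℤ × ℤ) (hd : 1 ≤ π d) (p : Poly K n m) (hp : p ∈ polyPiece K n m d)
    (hvp : v i * p ∈ J ⊔ initIdeal v i) : p ∈ J ⊔ initIdeal v i := by
  obtain ⟨q, u, huli, hspan, huv⟩ := exists_extension hv hli hb
  have h1 : ∀ i : Fin r, initIdeal u (Fin.castAdd q i) = initIdeal v i := fun i =>
    initIdeal_congr (by simp; omega) i.2.le fun k hk => huv ⟨k, _⟩
  have h2 := colon_of_linearTor hs hJ huli hspan h (fun j => ?_) (Fin.castAdd q i) d hd p hp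
  · rw [h1, huv] at h2
    exact h2 hvp
  · refine Fin.addCases (fun i => ?_) (fun k => ?_) j
    · rw [h1, huv]
      exact htors i
    · intro p _ w hw
      refine ⟨1, Ideal.mul_mem_right _ _ ?_⟩
      rw [pow_one]
      exact mem_sup_initIdeal_of_le hb (Nat.le_add_right r q) huv (by simp) hw

end

theorem exists_sub_sum_mem {r : ℕ} {f : Fin r → quotPiece J e}
    (hf : Submodule.span K (Set.range f) = ⊤) {v : Fin r → Poly K n m}
    (hvf : ∀ i, Ideal.Quotient.mk J (v i) = f i) (p : Poly K n m) (hp : p ∈ polyPiece K n m e) :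
    ∃ a : Fin r → K, p - ∑ k, a k • v k ∈ J := by
  have h1 : (⟨Ideal.Quotient.mk J p, p, hp, rfl⟩ : quotPiece J e) ∈
      Submodule.span K (Set.range f) := hf ▸ trivial
  obtain ⟨a, ha⟩ := (Submodule.mem_span_range_iff_exists_fun K).1 h1
  refine ⟨a, Ideal.Quotient.eq.1 ?_⟩
  have h2 : ∑ i, ((a i • f i : quotPiece J e) : Poly K n m ⧸ J) = Ideal.Quotient.mk J p := by
    rw [← AddSubmonoidClass.coe_finsetSum]
    exact congrArg Subtype.val ha
  rw [← h2, map_sum]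
  refine Finset.sum_congr rfl fun k _ => ?_
  rw [Submodule.coe_smul, ← hvf k]
  exact (map_smul (Ideal.Quotient.mkₐ K J) _ _).symm

theorem linearIndependent_mk {r : ℕ} {f : Fin r → quotPiece J e} (hf : LinearIndependent K f)
    {v : Fin r → Poly K n m} (hvf : ∀ i, Ideal.Quotient.mk J (v i) = f i) :
    LinearIndependent K fun i => Ideal.Quotient.mkₐ K J (v i) := by
  have he : (fun i => Ideal.Quotient.mkₐ K J (v i)) = (quotPiece J e).subtype ∘ f := funext hvf
  rw [he]
  exact hf.map' (quotPiece J e).subtype (Submodule.ker_subtype _)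

theorem linearTor_of_isDSequence (hs : IsSide e e' π π') (hJ : J.IsHomogeneous (polyPiece K n m))
    (f : Fin (Module.finrank K (quotPiece J e)) → quotPiece J e)
    (hmin : IsMinimalSystem (fun i => (f i : Poly K n m ⧸ J)) (formIdeal J e))
    (hf : IsDSequence fun i => (f i : Poly K n m ⧸ J)) : LinearTor π J := by
  have hli := (isMinimalSystem_iff hJ f).1 hmin
  choose v hv hvf using fun i => (f i).2
  refine linearTor_of_colon_of_basis hs hJ hv (linearIndependent_mk hli hvf)
    (exists_sub_sum_mem (hli.span_eq_top_of_card_eq_finrank' (Fintype.card_fin _)) hvf) fun i => ?_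
  exact (colon_inf_eq_iff hs hJ hv hvf hmin.1 i).1 (hf.2 i)

/-! ### The family of ideals given by generic forms -/

section

variable {r : ℕ} (b : Fin r → Poly K n m)

/-- The generic linear combinations of the forms `b`. -/
def genericForm (i : Fin r) : MvPolynomial (Fin n ⊕ Fin m) (MvPolynomial (Fin r × Fin r) K) :=
  ∑ k, MvPolynomial.C (MvPolynomial.X (i, k)) * MvPolynomial.map MvPolynomial.C (b k)

/-- The ideal generated by `J` and the first `j` generic linear combinations of the forms `b`. -/
def genericIdeal (J : Ideal (Poly K n m)) (j : ℕ) :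
    Ideal (MvPolynomial (Fin n ⊕ Fin m) (MvPolynomial (Fin r × Fin r) K)) :=
  J.map (MvPolynomial.map MvPolynomial.C) ⊔ Ideal.span (genericForm b '' {k | (k : ℕ) < j})

theorem map_genericForm (t : Fin r × Fin r → K) (i : Fin r) :
    MvPolynomial.map ((MvPolynomial.aeval t : MvPolynomial (Fin r × Fin r) K →ₐ[K] K) :
      MvPolynomial (Fin r × Fin r) K →+* K) (genericForm b i) = formsOf b t i := by
  rw [genericForm, formsOf, map_sum]
  refine Finset.sum_congr rfl fun k _ => ?_
  rw [map_mul, MvPolynomial.map_C, MvPolynomial.map_map, MvPolynomial.smul_eq_C_mul]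
  congr 1
  · simp
  · convert MvPolynomial.map_id (b k)
    ext; simp

theorem map_genericIdeal (t : Fin r × Fin r → K) (j : ℕ) :
    (genericIdeal b J j).map (MvPolynomial.map
      ((MvPolynomial.aeval t : MvPolynomial (Fin r × Fin r) K →ₐ[K] K) :
        MvPolynomial (Fin r × Fin r) K →+* K)) = J ⊔ initIdeal (formsOf b t) j := by
  rw [genericIdeal, Ideal.map_sup, Ideal.map_map, Ideal.map_span, Set.image_image, initIdeal]
  congr 1
  · convert Ideal.map_id J
    ext <;> simp
  · congr 1
    exact Set.image_congr fun k _ => map_genericForm b t k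

theorem isWeightedHomogeneous_map {A B σ M : Type*} [CommRing A] [CommRing B] [AddCommMonoid M]
    {w : σ → M} {d : M} (φ : A →+* B) {p : MvPolynomial σ A}
    (hp : MvPolynomial.IsWeightedHomogeneous w p d) :
    MvPolynomial.IsWeightedHomogeneous w (MvPolynomial.map φ p) d := by
  intro s hs
  refine hp fun h => hs ?_
  rw [MvPolynomial.coeff_map, h, map_zero]

theorem genericIdeal_component_mem (hJ : J.IsHomogeneous (polyPiece K n m))
    (hb : ∀ k, b k ∈ polyPiece K n m e) (j : ℕ) (p) (hp : p ∈ genericIdeal b J j) (d : ℤ × ℤ) :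
    MvPolynomial.weightedHomogeneousComponent (varDeg n m) d p ∈ genericIdeal b J j := by
  let _ := MvPolynomial.weightedGradedAlgebra (MvPolynomial (Fin r × Fin r) K) (varDeg n m)
  refine MvPolynomial.weightedHomogeneousComponent_mem_of_mem _ (varDeg n m) ?_ hp d
  obtain ⟨T, hT⟩ := (Ideal.IsHomogeneous.iff_exists (polyPiece K n m) J).1 hJ
  refine Ideal.IsHomogeneous.sup ?_ (Ideal.homogeneous_span _ _ ?_)
  · rw [hT, Ideal.map_span]
    refine Ideal.homogeneous_span _ _ ?_
    rintro _ ⟨_, ⟨⟨x, d, hx⟩, -, rfl⟩, rfl⟩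
    exact ⟨d, isWeightedHomogeneous_map _ hx⟩
  · rintro _ ⟨i, -, rfl⟩
    refine ⟨e, Submodule.sum_mem _ fun k _ => ?_⟩
    rw [← MvPolynomial.smul_eq_C_mul]
    exact Submodule.smul_mem _ _ (isWeightedHomogeneous_map _ (hb k))

end

theorem linearIndependent_of_det_ne_zero {V : Type*} [AddCommGroup V] [Module K V] {r : ℕ}
    (b : Module.Basis (Fin r) K V) (T : Matrix (Fin r) (Fin r) K) (hT : T.det ≠ 0) :
    LinearIndependent K fun i => ∑ k, T i k • b k := by
  rw [Fintype.linearIndependent_iff]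
  intro g hg
  refine congrFun (Matrix.eq_zero_of_vecMul_eq_zero hT ?_)
  ext k
  simp_rw [Finset.smul_sum] at hg
  rw [Finset.sum_comm] at hg
  simp_rw [smul_smul, ← Finset.sum_smul] at hg
  exact Fintype.linearIndependent_iff.1 b.linearIndependent _ hg k

theorem genericMinimalSystem_of_linearTor [Infinite K] (hs : IsSide e e' π π')
    (hJ : J.IsHomogeneous (polyPiece K n m)) (h : LinearTor π J) :
    GenericMinimalSystem J e fun f => IsDSequence f := by
  classical
  set r := Module.finrank K (quotPiece J e) with hr
  let β : Module.Basis (Fin r) K (quotPiece J e) := Module.finBasis K (quotPiece J e)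
  choose b hbe hbβ using fun k => (β k).2
  have hb := exists_sub_sum_mem β.span_eq hbβ
  choose c hc0 g hg using fun j => exists_finrank_eq (K := K) (genericIdeal b J j)
    (genericIdeal_component_mem b hJ hbe j)
  -- Where `D` does not vanish the coefficient matrix is invertible and the Hilbert functions are
  -- generic. The range is `r + 1` because the colon condition at `i < r` involves the ideals for
  -- both `i` and `i + 1`.
  let D : MvPolynomial (Fin r × Fin r) K :=
    (Matrix.mvPolynomialX (Fin r) (Fin r) K).det * ∏ j ∈ Finset.range (r + 1), c j
  have hD : D ≠ 0 := mul_ne_zero (Matrix.det_mvPolynomialX_ne_zero (Fin r) K)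
    (Finset.prod_ne_zero_iff.2 fun j _ => hc0 j)
  let F : (Fin r × Fin r → K) → Fin r → quotPiece J e := fun t i => ∑ k, t (i, k) • β k
  have hF : ∀ t i, Ideal.Quotient.mk J (formsOf b t i) = F t i := by
    intro t i
    rw [formsOf, map_sum, AddSubmonoidClass.coe_finsetSum]
    refine Finset.sum_congr rfl fun k _ => ?_
    rw [Submodule.coe_smul, ← hbβ k]
    exact map_smul (Ideal.Quotient.mkₐ K J) _ _
  have hforms : ∀ t i, formsOf b t i ∈ polyPiece K n m e := fun t i =>
    Submodule.sum_mem _ fun k _ => Submodule.smul_mem _ _ (hbe k)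
  have hFli : ∀ t, MvPolynomial.eval t D ≠ 0 → LinearIndependent K (F t) := by
    intro t ht
    rw [map_mul, mul_ne_zero_iff, RingHom.map_det] at ht
    have hM : (MvPolynomial.eval t).mapMatrix (Matrix.mvPolynomialX (Fin r) (Fin r) K) =
        fun i k => t (i, k) := by
      ext i k
      simp [Matrix.mvPolynomialX_apply]
    rw [hM] at ht
    exact linearIndependent_of_det_ne_zero β (fun i k => t (i, k)) ht.1
  have hrank : ∀ t, MvPolynomial.eval t D ≠ 0 → ∀ j ≤ r, ∀ d,
      Module.finrank K (idealPiece (J ⊔ initIdeal (formsOf b t) j) d) = g j d := by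
    intro t ht j hj d
    rw [map_mul, mul_ne_zero_iff, map_prod, Finset.prod_ne_zero_iff] at ht
    rw [← map_genericIdeal b t j]
    exact hg j (MvPolynomial.aeval t) (ht.2 j (Finset.mem_range.2 (by omega))) d
  -- One torsion point inside the open set is enough: its colon equalities pass to all other points
  -- by comparing Hilbert functions, although torsion itself is not compared.
  obtain ⟨t₀, ht₀, htors⟩ := exists_torsion_point b hb hD
  have hli₀ := hFli t₀ ht₀
  have hcol := colon_of_linearTor_of_basis hs hJ (hforms t₀) (linearIndependent_mk hli₀ (hF t₀))
    (exists_sub_sum_mem (hli₀.span_eq_top_of_card_eq_finrank' (Fintype.card_fin _)) (hF t₀)) h htors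
  let φ : Fin r × Fin r → Module.Dual K (Fin r → quotPiece J e) := fun ik =>
    β.coord ik.2 ∘ₗ LinearMap.proj ik.1
  refine ⟨{f | MvPolynomial.eval (fun ik => φ ik f) D ≠ 0}, ⟨{MvPolynomial.rename φ D}, ?_⟩,
    ⟨F t₀, ?_, (isMinimalSystem_iff hJ (F t₀)).2 hli₀⟩, fun f hf hmin => ?_⟩
  · ext f
    simp only [Set.mem_ofPred_eq, Set.mem_singleton_iff, exists_eq_left, MvPolynomial.eval_rename]
    rfl
  · have h1 : (fun ik => φ ik (F t₀)) = t₀ := by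
      ext ⟨i, k⟩
      simp [φ, F, Finsupp.single_apply]
    rw [Set.mem_ofPred_eq, h1]
    exact ht₀
  · set t : Fin r × Fin r → K := fun ik => φ ik f with ht
    have hft : ∀ i, Ideal.Quotient.mk J (formsOf b t i) = f i := by
      intro i
      rw [hF]
      congr 1
      exact β.sum_repr (f i)
    refine ⟨?_, fun i => ?_⟩
    · rw [hmin.1]
      exact hmin
    · refine (colon_inf_eq_iff hs hJ (hforms t) hft hmin.1 i).2 fun d hd => ?_
      refine mem_of_mul_mem_of_finrank_eq (sup_initIdeal_isHomogeneous hJ (hforms t) i)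
        (sup_initIdeal_isHomogeneous hJ (hforms t₀) i) (hforms t i) (hforms t₀ i)
        (fun d => ?_) (fun d => ?_) (hcol i d hd)
      · rw [hrank t hf i i.2.le, hrank t₀ ht₀ i i.2.le]
      · rw [sup_assoc, sup_assoc, ← initIdeal_succ, ← initIdeal_succ, hrank t hf _ i.2,
          hrank t₀ ht₀ _ i.2]

theorem linearTor_iff_genericMinimalSystem [Infinite K] (hs : IsSide e e' π π')
    (hJ : J.IsHomogeneous (polyPiece K n m)) :
    LinearTor π J ↔ GenericMinimalSystem J e fun f => IsDSequence f := by
  refine ⟨genericMinimalSystem_of_linearTor hs hJ, ?_⟩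
  rintro ⟨U, -, ⟨f, hfU, hmin⟩, hU⟩
  exact linearTor_of_isDSequence hs hJ f hmin (hU f hfU hmin)

/-! ### The regularity -/

theorem mem_maxIdeal_iff (p : Poly K n m) : p ∈ maxIdeal K n m ↔ p.coeff 0 = 0 := by
  rw [maxIdeal, ← Set.image_univ, MvPolynomial.mem_ideal_span_X_image]
  constructor
  · intro h
    by_contra hne
    obtain ⟨i, -, hi⟩ := h 0 (MvPolynomial.mem_support_iff.2 hne)
    exact hi rfl
  · intro h s hs
    have hs0 : s ≠ 0 := by
      rintro rfl
      exact MvPolynomial.mem_support_iff.1 hs h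
    obtain ⟨i, hi⟩ := Finsupp.ne_iff.1 hs0
    exact ⟨i, trivial, hi⟩

theorem le_maxIdeal (hJ : J.IsHomogeneous (polyPiece K n m)) (hJ' : J ≠ ⊤) :
    J ≤ maxIdeal K n m := by
  intro p hp
  rw [mem_maxIdeal_iff]
  by_contra hne
  have h := polyComp_mem hJ hp 0
  rw [component_zero] at h
  exact hJ' (Ideal.eq_top_of_isUnit_mem J h ((IsUnit.mk0 _ hne).map MvPolynomial.C))

/-- `Tor_0(R, K) = S/(J + 𝔪) = K` since `J ⊆ 𝔪`. Hence both regularities are at least `0`, and only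
an upper bound is left to decide. -/
theorem betti_zero_ne_zero (hJ : J.IsHomogeneous (polyPiece K n m)) (hJ' : J ≠ ⊤) :
    betti J 0 0 ≠ 0 := by
  rw [Ne, betti_eq_zero_iff]
  intro hvan
  obtain ⟨y, hy, hya⟩ := (residueResolution K n m).exists_aug_eq (maxIdeal_homogeneous K n m)
    (p := 1) (MvPolynomial.isWeightedHomogeneous_one K (varDeg n m))
  have h1 := ((residueResolution K n m).isBdry_zero_iff hya).1
    (hvan y hy (FreeResolution.isCycle_zero y))
  rw [sup_eq_right.2 (le_maxIdeal hJ hJ'), mem_maxIdeal_iff] at h1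
  simp at h1

theorem linearTor_iff_betti : LinearTor π J ↔ ∀ (i : ℕ) d, (i : ℤ) < π d → betti J i d = 0 := by
  simp_rw [betti_eq_zero_iff]
  refine forall_congr' fun i => forall_congr' fun d => imp_congr_right fun _ => ?_
  exact ⟨fun h => h _, fun h => h.of_resolution (maxIdeal_homogeneous K n m)⟩

theorem sSup_eq_zero_iff {P : ℤ → Prop} (h0 : P 0) :
    sSup {s : WithBot (WithTop ℤ) | ∃ a : ℤ, s = ((a : WithTop ℤ) : WithBot (WithTop ℤ)) ∧ P a} = 0 ↔
      ∀ a, 0 < a → ¬ P a := by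
  constructor
  · intro h a ha hP
    have h1 : ((a : WithTop ℤ) : WithBot (WithTop ℤ)) ≤ 0 := h ▸ le_sSup ⟨a, rfl, hP⟩
    exact absurd (WithTop.coe_le_coe.1 (WithBot.coe_le_coe.1 h1)) (not_le.2 ha)
  · intro h
    refine le_antisymm (sSup_le ?_) (le_sSup ⟨0, rfl, h0⟩)
    rintro _ ⟨a, rfl, hP⟩
    exact WithBot.coe_le_coe.2 (WithTop.coe_le_coe.2 (not_lt.1 fun ha => h a ha hP))

theorem regX_eq_zero_iff (hJ : J.IsHomogeneous (polyPiece K n m)) (hJ' : J ≠ ⊤) :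
    regX J = 0 ↔ LinearTor Prod.fst J := by
  rw [regX, sSup_eq_zero_iff ⟨0, 0, betti_zero_ne_zero hJ hJ'⟩, linearTor_iff_betti]
  constructor
  · rintro h i ⟨a, b⟩ hd
    by_contra hne
    exact h (a - i) (by simpa using hd) ⟨i, b, by rwa [sub_add_cancel]⟩
  · rintro h a ha ⟨i, b, hne⟩
    exact hne (h i _ (by simpa using ha))

theorem regY_eq_zero_iff (hJ : J.IsHomogeneous (polyPiece K n m)) (hJ' : J ≠ ⊤) :
    regY J = 0 ↔ LinearTor Prod.snd J := by
  rw [regY, sSup_eq_zero_iff ⟨0, 0, betti_zero_ne_zero hJ hJ'⟩, linearTor_iff_betti]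
  constructor
  · rintro h i ⟨a, b⟩ hd
    by_contra hne
    exact h (b - i) (by simpa using hd) ⟨i, a, by rwa [sub_add_cancel]⟩
  · rintro h a ha ⟨i, b, hne⟩
    exact hne (h i _ (by simpa using ha))

end Bigraded

end

theorem proposition3p1 {K : Type*} [Field K] [Infinite K] (n m : ℕ)
    (J : Ideal (Bigraded.Poly K n m)) (hJ : J.IsHomogeneous (Bigraded.polyPiece K n m))
    (hJ' : J ≠ ⊤) :
    (Bigraded.regX J = 0 ↔
      Bigraded.GenericMinimalSystem J (1, 0) fun f => Bigraded.IsDSequence f) ∧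
    (Bigraded.regY J = 0 ↔
      Bigraded.GenericMinimalSystem J (0, 1) fun f => Bigraded.IsDSequence f) :=
  ⟨(Bigraded.regX_eq_zero_iff hJ hJ').trans
      (Bigraded.linearTor_iff_genericMinimalSystem (.inl ⟨rfl, rfl, rfl, rfl⟩) hJ),
    (Bigraded.regY_eq_zero_iff hJ hJ').trans
      (Bigraded.linearTor_iff_genericMinimalSystem (.inr ⟨rfl, rfl, rfl, rfl⟩) hJ)⟩
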